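/- **Alternating Turing machines with output.** Let $\Lambda$ be a finite alphabet, let $\bot,\triangleright\notin\Lambda$ be two further symbols (blank and left marker), and put $\Lambda'=\Lambda\cup\{\bot,\triangleright\}$. An *alternating Turing machine with output* (ATO) over $\Lambda$ is a tuple $M=(S,\Lambda',s_{\rm init},s_{\rm accept},s_{\rm reject},S_\exists,S_\forall,S_L,\delta)$, where $S$ is a finite set of states, $s_{\rm init},s_{\rm accept},s_{\rm reject}\in S$, the sets $S_\exists$ (existential states) and $S_\forall$ (universal states) partition $S\setminus\{s_{\rm accept},s_{\rm reject}\}$, the set $S_L\subseteq S$ of labeling states contains $s_{\rm init}$, and $\delta$ assigns to each $(s,\alpha,\beta)\in(S\setminus\{s_{\rm accept},s_{\rm reject}\})\times\Lambda'\times\Lambda'$ a finite subset of $S\times\{-1,0,+1\}\times\{-1,0,+1\}\times\Lambda'\times\Lambda'^*$. The function $\delta$ is restricted so that a cursor on $\triangleright$ never moves left and $\triangleright$ is neither overwritten by another symbol nor written over another symbol. A configuration is a tuple $(s,x,y,z,h_x,h_y)$: the state, the contents of the read-only input tape, of the working tape and of the labeling tape, and the positions of the cursors on the input and the working tape; beyond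 $x$ and $y$ the input and working tapes are blank. On input $w\in\Lambda^*$ the initial configuration is $(s_{\rm init},\triangleright w,\triangleright,\epsilon,1,1)$. If the cursors of $C=(s,x,y,z,h_x,h_y)$ read $\alpha$ and $\beta$, then each $(s',d,d',\beta',z')\in\delta(s,\alpha,\beta)$ gives a successor of $C$: the state becomes $s'$, $\beta'$ is written in cell $h_y$ of the working tape (so $y$ is extended when this cell lies beyond it), the cursors move by $d$ and $d'$, and the labeling tape becomes $z'$ if $s\in S_L$ and $zz'$ if $s\notin S_L$. A configuration is accepting, rejecting, existential, universal or labeling according to its state. A *computation* of $M$ on $w$ is a finite rooted tree with nodes labeled by configurations, such that the root is labeled with the initial configuration on $w$; each leaf is labeled with an accepting or rejecting configuration; and each non-leaf node is labeled with a configuration with a non-empty set $\{C_1,\dots,C_n\}$ of successors, and has exactly one child, labeled with some $C_i$, if it is existential, and exactly $n$ children, labeled with $C_1,\dots,C_n$, if it is universal. It is *accepting* if all its leaves are accepting. The *output* of a computation is the node-labeled rooted tree whose nodes are the nodes with a labeling configuration, each labeled with the content $z$ of the labeling tape, where there is an edge from $u$ to $v$ if $u$ reaches $v$ by a downward path all of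 whose intermediate nodes are non-labeling. A *valid output* of $M$ on $w$ is the output of an accepting computation of $M$ on $w$; outputs are unordered trees, identified up to isomorphism. Let $\mathsf{span}_M(w)$ be the number of distinct valid outputs of $M$ on $w$. **The class $\mathsf{SpanTL}$.** An ATO $M$ is *well-behaved* if there are a polynomial $\mathrm{pol}$ and integers $c,k\ge 0$ such that for every $w\in\Lambda^*$, with $n=|w|$, and every computation $T$ of $M$ on $w$: $T$ has at most $c\cdot\mathrm{pol}(n)$ nodes; in every configuration $(\cdot,\cdot,y,z,\cdot,\cdot)$ that labels a node of $T$, $|y|,|z|\le c\,(\lfloor\log_2 \max(n,1)\rfloor+1)$; and every downward path in $T$ without labeling nodes contains at most $k$ universal nodes. A function $f:\Lambda^*\to\mathbb N$ (where $0\in\mathbb N$) belongs to $\mathsf{SpanTL}$ if $f=\mathsf{span}_M$ for some well-behaved ATO $M$ over $\Lambda$. **Logspace computable functions.** A function $h:\Lambda_1^*\to\Lambda_2^*$ is *logspace computable* if there is a deterministic Turing machine with a read-only two-way input tape (whose cursor stays on $\triangleright w\bot$), a read-write working tape over some finite alphabet and a write-only one-way output tape, that on every input $w\in\Lambda_1^*$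 halts with $h(w)$ on its output tape and uses at most $c\,(\lfloor\log_2 \max(|w|,1)\rfloor+1)$ cells of its working tape, for a constant $c$. **Proposition.** $\mathsf{SpanTL}$ is closed under logspace reductions: let $\Lambda_1,\Lambda_2$ be finite alphabets, and let $f:\Lambda_1^*\to\mathbb N$, $g:\Lambda_2^*\to\mathbb N$ and $h:\Lambda_1^*\to\Lambda_2^*$ be functions such that $g\in\mathsf{SpanTL}$, $h$ is logspace computable, and $f(w)=g(h(w))$ for all $w\in\Lambda_1^*$. Then $f\in\mathsf{SpanTL}$. -/

import Mathlib

universe u v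

/-! ### Finite node-labelled rooted trees -/

/-- Finite rooted trees with nodes labelled in `L`. The children of a node are kept in a list; the
order of that list is forgotten in `UTree` below. -/
inductive LTree (L : Type u) : Type u
  | node (a : L) (children : List (LTree L)) : LTree L

namespace LTree

variable {L : Type u}

/-- The label of the root. -/
def root : LTree L → L
  | node a _ => a

mutual
/-- The labels of all nodes, one list entry for each node. -/
def nodes : LTree L → List L
  | node a ts => a :: nodesList ts
/-- The labels of all nodes of a forest. -/
def nodesList : List (LTree L) → List L
  | [] => []
  | t :: ts => nodes t ++ nodesList ts
end

/-- The number of nodes. -/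
def size (t : LTree L) : ℕ := t.nodes.length

mutual
/-- The labels of all leaves, one list entry for each leaf. -/
def leaves : LTree L → List L
  | node a [] => [a]
  | node _ (t :: ts) => leaves t ++ leavesList ts
/-- The labels of all leaves of a forest. -/
def leavesList : List (LTree L) → List L
  | [] => []
  | t :: ts => leaves t ++ leavesList ts
end

/-- `RootPath t p`: `p` lists the labels along a non-empty downward path that starts at the root
of `t` (and ends at an arbitrary node). -/
inductive RootPath : LTree L → List L → Prop
  | single (a : L) (ts : List (LTree L)) : RootPath (node a ts) [a]
  | cons (a : L) (ts : List (LTree L)) (t : LTree L) (p : List L) :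
      t ∈ ts → RootPath t p → RootPath (node a ts) (a :: p)

/-- `IsPath t p`: `p` lists the labels along a non-empty downward path in `t` (from an arbitrary
node of `t` to an arbitrary descendant of it). -/
inductive IsPath : LTree L → List L → Prop
  | here (t : LTree L) (p : List L) : RootPath t p → IsPath t p
  | inside (a : L) (ts : List (LTree L)) (t : LTree L) (p : List L) :
      t ∈ ts → IsPath t p → IsPath (node a ts) p

mutual
/-- Isomorphism of node-labelled rooted trees: equal root labels, and the lists of subtrees agree
up to reordering and isomorphism. -/
inductive Iso : LTree L → LTree L → Prop
  | node (a : L) (ts us : List (LTree L)) : IsoList ts us → Iso (node a ts) (node a us)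
/-- Two lists of trees agree up to reordering and isomorphism of the members. -/
inductive IsoList : List (LTree L) → List (LTree L) → Prop
  | nil : IsoList [] []
  | cons (t u : LTree L) (ts us : List (LTree L)) :
      Iso t u → IsoList ts us → IsoList (t :: ts) (u :: us)
  | swap (t u : LTree L) (ts : List (LTree L)) : IsoList (t :: u :: ts) (u :: t :: ts)
  | trans (ts us vs : List (LTree L)) : IsoList ts us → IsoList us vs → IsoList ts vs
end

mutual
theorem Iso.refl : ∀ t : LTree L, Iso t t
  | .node a ts => Iso.node a ts ts (IsoList.refl ts)
theorem IsoList.refl : ∀ ts : List (LTree L), IsoList ts ts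
  | [] => IsoList.nil
  | t :: ts => IsoList.cons t t ts ts (Iso.refl t) (IsoList.refl ts)
end

mutual
theorem Iso.symm : ∀ {t u : LTree L}, Iso t u → Iso u t
  | _, _, .node a ts us h => Iso.node a us ts (IsoList.symm h)
theorem IsoList.symm : ∀ {ts us : List (LTree L)}, IsoList ts us → IsoList us ts
  | _, _, .nil => IsoList.nil
  | _, _, .cons t u ts us h hs => IsoList.cons u t us ts (Iso.symm h) (IsoList.symm hs)
  | _, _, .swap t u ts => IsoList.swap u t ts
  | _, _, .trans ts us vs h k => IsoList.trans vs us ts (IsoList.symm k) (IsoList.symm h)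
end

theorem Iso.trans {t u v : LTree L} (h : Iso t u) (k : Iso u v) : Iso t v := by
  cases h with
  | node a ts us h =>
    cases k with
    | node _ _ vs k => exact Iso.node a ts vs (IsoList.trans ts us vs h k)

/-- Isomorphism as an equivalence relation. -/
def isoSetoid (L : Type u) : Setoid (LTree L) where
  r := Iso
  iseqv := ⟨Iso.refl, Iso.symm, Iso.trans⟩

end LTree

/-- Finite (unordered) node-labelled rooted trees, up to isomorphism. -/
def UTree (L : Type u) : Type u := Quotient (LTree.isoSetoid L)

/-- The isomorphism class of a tree. -/
def LTree.toUTree {L : Type u} (t : LTree L) : UTree L := Quotient.mk (LTree.isoSetoid L) t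

/-! ### Tapes -/

/-- The machine alphabet over the letters `Λ`: the letters, the blank symbol `⊥` and the left
marker `▷`. -/
inductive TapeSym (Λ : Type u) : Type u
  | blank : TapeSym Λ
  | marker : TapeSym Λ
  | letter (a : Λ) : TapeSym Λ

/-- The cursor moves `-1`, `0`, `+1`. -/
inductive Move : Type
  | left
  | stay
  | right

/-- The new cursor position. (Machines never move left of cell `0`, see below.) -/
def Move.apply : Move → ℕ → ℕ
  | left, i => i - 1
  | stay, i => i
  | right, i => i + 1

/-- The symbol in cell `i` (cells are numbered from `0`) of the tape `x ⊥ ⊥ ⋯`. -/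
def tapeRead {Λ : Type u} (x : List (TapeSym Λ)) (i : ℕ) : TapeSym Λ := x.getD i TapeSym.blank

/-- Write `b` into cell `i` of the tape `x ⊥ ⊥ ⋯`; if the cell lies beyond `x`, then `x` is first
extended by blanks, so that the length of a tape counts all the cells ever used. -/
def tapeWrite {Λ : Type u} (x : List (TapeSym Λ)) (i : ℕ) (b : TapeSym Λ) : List (TapeSym Λ) :=
  (x ++ List.replicate (i + 1 - x.length) TapeSym.blank).set i b

/-- The tape contents `▷ w`. -/
def inputTape {Λ : Type u} (w : List Λ) : List (TapeSym Λ) := TapeSym.marker :: w.map TapeSym.letter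

/-- The logarithm used in the `O(log n)` bounds; adding `1` makes the bound meaningful for all `n`,
including `n = 0` and `n = 1`. -/
def logBound (n : ℕ) : ℕ := Nat.log 2 n + 1

/-! ### Alternating Turing machines with output -/

/-- Alternating Turing machines with output (ATO) whose alphabet consists of the letters `Λ`, the
blank and the left marker. A transition `(s, d, d', b, z)` gives the new state, the moves of the
input and the working cursor, the symbol written on the working tape, and the string appended to
the labelling tape. -/
structure ATO (Λ : Type u) where
  State : Type
  finite_state : Finite State
  init : State
  accept : State
  reject : State
  existential : Set State
  universal : Set State
  labeling : Set State
  disjoint : Disjoint existential universal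
  partition : existential ∪ universal = {accept, reject}ᶜ
  init_labeling : init ∈ labeling
  δ : State → TapeSym Λ → TapeSym Λ → Finset (State × Move × Move × TapeSym Λ × List (TapeSym Λ))
  /-- There are no transitions from the accepting and the rejecting state. -/
  δ_accept : ∀ α β, δ accept α β = ∅
  δ_reject : ∀ α β, δ reject α β = ∅
  /-- The input cursor does not move left of the marker. -/
  δ_input : ∀ s β, ∀ t ∈ δ s TapeSym.marker β, t.2.1 ≠ Move.left
  /-- The working cursor does not move left of the marker. -/
  δ_work : ∀ s α, ∀ t ∈ δ s α TapeSym.marker, t.2.2.1 ≠ Move.left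
  /-- The marker is never overwritten, and never written elsewhere. -/
  δ_marker : ∀ s α β, ∀ t ∈ δ s α β, (t.2.2.2.1 = TapeSym.marker ↔ β = TapeSym.marker)

namespace ATO

variable {Λ : Type u} (M : ATO Λ)

/-- Configurations `(s, x, y, z, h_x, h_y)`; the cursor positions are counted from `0`. -/
structure Config where
  state : M.State
  input : List (TapeSym Λ)
  work : List (TapeSym Λ)
  label : List (TapeSym Λ)
  inputPos : ℕ
  workPos : ℕ

/-- The initial configuration on input `w`. -/
def initial (w : List Λ) : M.Config where
  state := M.init
  input := inputTape w
  work := [TapeSym.marker]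
  label := []
  inputPos := 0
  workPos := 0

open Classical in
/-- The configuration entered from `C` by a given transition. The labelling tape is erased when a
labelling state is left. -/
noncomputable def move (C : M.Config)
    (t : M.State × Move × Move × TapeSym Λ × List (TapeSym Λ)) : M.Config where
  state := t.1
  input := C.input
  work := tapeWrite C.work C.workPos t.2.2.2.1
  label := if C.state ∈ M.labeling then t.2.2.2.2 else C.label ++ t.2.2.2.2
  inputPos := t.2.1.apply C.inputPos
  workPos := t.2.2.1.apply C.workPos

/-- The set `{C₁, …, Cₙ}` of the configurations that `M` may enter from `C` in one step. -/
def next (C : M.Config) : Set M.Config :=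
  {C' | ∃ t ∈ M.δ C.state (tapeRead C.input C.inputPos) (tapeRead C.work C.workPos),
    C' = M.move C t}

/-- `M.IsRun T`: every leaf of `T` is an accepting or a rejecting configuration; an existential
node has exactly one child, labelled with one of its successors; a universal node with successors
`C₁, …, Cₙ`, `n > 0`, has exactly `n` children, labelled with `C₁, …, Cₙ`. -/
inductive IsRun : LTree M.Config → Prop
  | halt (C : M.Config) : C.state = M.accept ∨ C.state = M.reject → IsRun (.node C [])
  | existential (C : M.Config) (t : LTree M.Config) :
      C.state ∈ M.existential → t.root ∈ M.next C → IsRun t → IsRun (.node C [t])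
  | universal (C : M.Config) (ts : List (LTree M.Config)) :
      C.state ∈ M.universal → ts ≠ [] → (ts.map LTree.root).Nodup →
      (∀ C', C' ∈ ts.map LTree.root ↔ C' ∈ M.next C) → (∀ t ∈ ts, IsRun t) →
      IsRun (.node C ts)

/-- `T` is a computation of `M` on input `w`. -/
def IsComputation (w : List Λ) (T : LTree M.Config) : Prop :=
  T.root = M.initial w ∧ M.IsRun T

/-- All leaves are labelled with accepting configurations. -/
def IsAccepting (T : LTree M.Config) : Prop :=
  ∀ C ∈ T.leaves, C.state = M.accept

open Classical in
mutual
/-- Keep the nodes of a tree with a labelling configuration, labelled with the contents of the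
labelling tape; `v` becomes a child of `u` if `u` reaches `v` through non-labelling nodes only. The
result is a single tree if the root is labelling. -/
noncomputable def outputForest : LTree M.Config → List (LTree (List (TapeSym Λ)))
  | .node C ts =>
      if C.state ∈ M.labeling then [.node C.label (outputForestList ts)] else outputForestList ts
/-- The same for a forest. -/
noncomputable def outputForestList : List (LTree M.Config) → List (LTree (List (TapeSym Λ)))
  | [] => []
  | t :: ts => outputForest t ++ outputForestList ts
end

/-- The valid outputs of `M` on input `w`, i.e. the outputs of the accepting computations of `M` on
`w`, as trees up to isomorphism. -/
def validOutputs (w : List Λ) : Set (UTree (List (TapeSym Λ))) :=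
  {O | ∃ T : LTree M.Config, M.IsComputation w T ∧ M.IsAccepting T ∧
    ∃ O' : LTree (List (TapeSym Λ)), M.outputForest T = [O'] ∧ O = O'.toUTree}

/-- The number of distinct valid outputs of `M` on `w` (a priori possibly infinite). -/
noncomputable def span (w : List Λ) : ℕ∞ := (M.validOutputs w).encard

open Classical in
/-- Well-behaved ATOs: computations have polynomial size, the working and the labelling tape use
logarithmic space, and the number of universal nodes on labelled-free paths is bounded. -/
def WellBehaved : Prop :=
  ∃ (pol : Polynomial ℕ) (c k : ℕ), ∀ (w : List Λ) (T : LTree M.Config), M.IsComputation w T →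
    T.size ≤ c * pol.eval w.length ∧
    (∀ C ∈ T.nodes, C.work.length ≤ c * logBound w.length ∧
      C.label.length ≤ c * logBound w.length) ∧
    (∀ p : List M.Config, T.IsPath p → (∀ C ∈ p, C.state ∉ M.labeling) →
      p.countP (fun C => decide (C.state ∈ M.universal)) ≤ k)

end ATO

/-- The class `SpanTL`, restricted to the functions on the strings over the alphabet `Λ`. -/
def SpanTL (Λ : Type u) : Set (List Λ → ℕ) :=
  {f | ∃ M : ATO Λ, M.WellBehaved ∧ ∀ w, M.span w = (f w : ℕ∞)}

/-! ### Logspace computable functions -/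

/-- Deterministic Turing machines with a read-only two-way input tape, a read-write working tape
over the letters `Work`, the blank and the left marker, and a write-only one-way output tape. A
transition gives the new state, the moves of the input and the working cursor, the symbol written on
the working tape and at most one letter to append to the output; the machine halts where
there is no transition. The input cursor stays between the marker and the first blank. -/
structure Transducer (Λ₁ : Type u) (Λ₂ : Type v) where
  State : Type
  finite_state : Finite State
  Work : Type
  finite_work : Finite Work
  init : State
  δ : State → TapeSym Λ₁ → TapeSym Work → Option (State × Move × Move × TapeSym Work × Option Λ₂)
  δ_input_left : ∀ s β, ∀ t ∈ δ s TapeSym.marker β, t.2.1 ≠ Move.left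
  δ_input_right : ∀ s β, ∀ t ∈ δ s TapeSym.blank β, t.2.1 ≠ Move.right
  δ_work : ∀ s α, ∀ t ∈ δ s α TapeSym.marker, t.2.2.1 ≠ Move.left
  δ_marker : ∀ s α β, ∀ t ∈ δ s α β, (t.2.2.2.1 = TapeSym.marker ↔ β = TapeSym.marker)

namespace Transducer

variable {Λ₁ : Type u} {Λ₂ : Type v} (N : Transducer Λ₁ Λ₂)

/-- Configurations (without the input, which does not change). -/
structure Config where
  state : N.State
  work : List (TapeSym N.Work)
  output : List Λ₂
  inputPos : ℕ
  workPos : ℕ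

/-- The initial configuration. -/
def initial : N.Config where
  state := N.init
  work := [TapeSym.marker]
  output := []
  inputPos := 0
  workPos := 0

/-- One step on input `w`; `none` if the machine has halted. -/
def step (w : List Λ₁) (C : N.Config) : Option N.Config :=
  (N.δ C.state (tapeRead (inputTape w) C.inputPos) (tapeRead C.work C.workPos)).map fun t =>
    { state := t.1
      work := tapeWrite C.work C.workPos t.2.2.2.1
      output := C.output ++ t.2.2.2.2.toList
      inputPos := t.2.1.apply C.inputPos
      workPos := t.2.2.1.apply C.workPos }

/-- `C` is reached in finitely many steps on input `w`. -/
def Reaches (w : List Λ₁) (C : N.Config) : Prop :=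
  Relation.ReflTransGen (fun C₁ C₂ => N.step w C₁ = some C₂) N.initial C

end Transducer

/-- `h` is logspace computable: some deterministic machine halts on every input `w` with output
`h w`, and uses `O(log |w|)` cells of its working tape. -/
def LogspaceComputable {Λ₁ : Type u} {Λ₂ : Type v} (h : List Λ₁ → List Λ₂) : Prop :=
  ∃ N : Transducer Λ₁ Λ₂,
    (∀ w, ∃ C, N.Reaches w C ∧ N.step w C = none ∧ C.output = h w) ∧
    ∃ c : ℕ, ∀ w C, N.Reaches w C → C.work.length ≤ c * logBound w.length

-- Counting, relabelling and isomorphism of trees.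

namespace LTree

variable {L : Type u} {L' : Type v}

-- Let `M` be a machine for `g` and `N` a transducer for `h`. The word `h w` is too long to be
-- stored, but each of its letters can be recomputed. The composed machine keeps the position of the
-- input cursor of `M` as a binary number; whenever `M` reads its input, `N` is run from its start
-- and letters are discarded until the wanted one appears. The physical input cursor is thereby free
-- to serve as the cursor of `N`.
--
-- Outputs of accepting computations are counted, so the recomputation must not alter the output
-- trees. It is deterministic and takes place in existential, non-labelling states, hence only
-- inserts unary paths into computation trees. A non-halting node of `M` becomes a node with the
-- same labelling status, a deterministic path, one branching node of the same type as the original,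
-- and a deterministic path above each child. Since the children of a universal node are the set of
-- its successors, the successors on both sides have to correspond bijectively. `ATO.Simulation`
-- axiomatizes this situation; `exists_run` and `exists_run_of_run` transport runs in both
-- directions, and `span_eq` deduces that the numbers of valid outputs agree. Labels are translated
-- by an injective block code, so distinct outputs stay distinct.
--
-- The working alphabet may contain a single letter besides the blank and the marker. All data are
-- therefore kept in eight interleaved binary counters on one working tape. A tape with a cursor is
-- a pair of numbers in a fixed base, one for each side of the cursor, and simulating it amounts to
-- appending and removing last digits. The main facts about these programs are `cexec_writeMove`,
-- `cexec_produce` and `cexec_fetch`.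
--
-- No running times are computed. A deterministic segment that ends where its step relation has no
-- successor cannot repeat a configuration, so its length is at most the number of configurations in
-- logarithmic space, which is polynomial. The same argument bounds the length of `h w`. The
-- correspondence of runs is proved with some size bound at each configuration; the bound `A *
-- logBound w.length` enters only in `wellBehaved_machine`, after a run of the composed machine has
-- been traced back to a run of `M`, whose well-behavedness then applies.
--
-- Two degenerate cases give constant functions, realized by `ATO.chooser`: the alphabet `Λ₁` may be
-- empty, which leaves no letter to write bits with, or `M` may halt in its initial state.

theorem nodesList_eq (ts : List (LTree L)) : nodesList ts = ts.flatMap nodes := by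
  induction ts with
  | nil => simp [nodesList]
  | cons t ts ih => simp [nodesList, ih]

theorem leavesList_eq (ts : List (LTree L)) : leavesList ts = ts.flatMap leaves := by
  induction ts with
  | nil => simp [leavesList]
  | cons t ts ih => simp [leavesList, ih]

theorem nodes_node (a : L) (ts : List (LTree L)) : (node a ts).nodes = a :: ts.flatMap nodes := by
  rw [nodes, nodesList_eq]

theorem leaves_node (a : L) (ts : List (LTree L)) (h : ts ≠ []) :
    (node a ts).leaves = ts.flatMap leaves := by
  cases ts with
  | nil => exact absurd rfl h
  | cons t ts => rw [leaves, leavesList_eq, List.flatMap_cons]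

theorem size_node (a : L) (ts : List (LTree L)) :
    (node a ts).size = 1 + (ts.map size).sum := by
  rw [size, nodes_node, List.length_cons, List.length_flatMap, add_comm]
  rfl

mutual
/-- Relabel the nodes of a tree. -/
def map (f : L → L') : LTree L → LTree L'
  | node a ts => node (f a) (mapList f ts)
/-- Relabel the nodes of a forest. -/
def mapList (f : L → L') : List (LTree L) → List (LTree L')
  | [] => []
  | t :: ts => map f t :: mapList f ts
end

theorem mapList_eq (f : L → L') (ts : List (LTree L)) : mapList f ts = ts.map (map f) := by
  induction ts with
  | nil => simp [mapList]
  | cons t ts ih => simp [mapList, ih]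

mutual
theorem Iso.map (f : L → L') : ∀ {t u : LTree L}, Iso t u → Iso (t.map f) (u.map f)
  | _, _, .node a ts us h => Iso.node (f a) _ _ (IsoList.map f h)
theorem IsoList.map (f : L → L') :
    ∀ {ts us : List (LTree L)}, IsoList ts us → IsoList (mapList f ts) (mapList f us)
  | _, _, .nil => IsoList.nil
  | _, _, .cons _ _ _ _ h hs => IsoList.cons _ _ _ _ (Iso.map f h) (IsoList.map f hs)
  | _, _, .swap _ _ _ => IsoList.swap _ _ _
  | _, _, .trans _ _ _ h k => IsoList.trans _ _ _ (IsoList.map f h) (IsoList.map f k)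
end

mutual
theorem map_leftInverse {f : L → L'} {g : L' → L} (h : Function.LeftInverse g f) :
    ∀ t : LTree L, (t.map f).map g = t
  | .node a ts => by rw [map, map, h a, mapList_leftInverse h ts]
theorem mapList_leftInverse {f : L → L'} {g : L' → L} (h : Function.LeftInverse g f) :
    ∀ ts : List (LTree L), mapList g (mapList f ts) = ts
  | [] => rfl
  | t :: ts => by rw [mapList, mapList, map_leftInverse h t, mapList_leftInverse h ts]
end

mutual
-- Isomorphism only reorders siblings, so the multiset of labels is an invariant; it tells the
-- outputs of `chooser` apart.
theorem Iso.nodes_perm : ∀ {t u : LTree L}, Iso t u → t.nodes.Perm u.nodes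
  | _, _, .node a ts us h => by
    rw [nodes, nodes]
    exact (IsoList.nodes_perm h).cons a
theorem IsoList.nodes_perm :
    ∀ {ts us : List (LTree L)}, IsoList ts us → (nodesList ts).Perm (nodesList us)
  | _, _, .nil => List.Perm.refl _
  | _, _, .cons _ _ _ _ h hs => by
    rw [nodesList, nodesList]
    exact (Iso.nodes_perm h).append (IsoList.nodes_perm hs)
  | _, _, .swap t u ts => by
    simp only [nodesList, ← List.append_assoc]
    exact List.perm_append_comm.append_right _
  | _, _, .trans _ _ _ h k => (IsoList.nodes_perm h).trans (IsoList.nodes_perm k)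
end

theorem root_mem_nodes (t : LTree L) : t.root ∈ t.nodes := by
  cases t with
  | node a ts => simp [nodes, root]

end LTree

namespace UTree

/-- Relabel the nodes of an unordered tree. -/
def map {L : Type u} {L' : Type v} (f : L → L') : UTree L → UTree L' :=
  Quotient.map' (LTree.map f) fun _ _ h => LTree.Iso.map f h

/-- A left inverse of `f` relabels an isomorphism of the images back to one of the original trees.
-/
theorem map_injective {L : Type u} {L' : Type v} {f : L → L'} (hf : Function.Injective f) :
    Function.Injective (map f) := by
  intro x y
  induction x using Quotient.inductionOn with | _ t
  induction y using Quotient.inductionOn with | _ u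
  intro h
  -- `Function.invFun` needs an inhabited type; the root of a tree provides a label.
  rcases isEmpty_or_nonempty L with hL | hL
  · exact (hL.false t.root).elim
  have h' : LTree.Iso (t.map f) (u.map f) := Quotient.exact h
  have := h'.map (Function.invFun f)
  rw [LTree.map_leftInverse (Function.leftInverse_invFun hf),
    LTree.map_leftInverse (Function.leftInverse_invFun hf)] at this
  exact Quotient.sound this

end UTree

-- Output forests, and a machine with a prescribed constant span.

namespace ATO

variable {Λ : Type u} (M : ATO Λ)

theorem outputForestList_eq (ts : List (LTree M.Config)) :
    M.outputForestList ts = ts.flatMap M.outputForest := by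
  induction ts with
  | nil => simp [outputForestList]
  | cons t ts ih => simp [outputForestList, ih]

theorem outputForest_labeling {C : M.Config} (h : C.state ∈ M.labeling)
    (ts : List (LTree M.Config)) :
    M.outputForest (.node C ts) = [.node C.label (ts.flatMap M.outputForest)] := by
  rw [outputForest, if_pos h, outputForestList_eq]

theorem outputForest_not_labeling {C : M.Config} (h : C.state ∉ M.labeling)
    (ts : List (LTree M.Config)) :
    M.outputForest (.node C ts) = ts.flatMap M.outputForest := by
  rw [outputForest, if_neg h, outputForestList_eq]

theorem halt_of_not {s : M.State} (h1 : s ∉ M.existential) (h2 : s ∉ M.universal) :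
    s = M.accept ∨ s = M.reject := by
  by_contra h
  have : s ∈ M.existential ∪ M.universal := by
    rw [M.partition]; simpa using h
  exact this.elim h1 h2

theorem not_halt_of_existential {s : M.State} (h : s ∈ M.existential) :
    s ≠ M.accept ∧ s ≠ M.reject := by
  have : s ∈ M.existential ∪ M.universal := Or.inl h
  rw [M.partition] at this
  simpa using this

theorem not_halt_of_universal {s : M.State} (h : s ∈ M.universal) :
    s ≠ M.accept ∧ s ≠ M.reject := by
  have : s ∈ M.existential ∪ M.universal := Or.inr h
  rw [M.partition] at this
  simpa using this

/-- The transitions of `chooser` below. -/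
def chooserStep (β : TapeSym Λ) :
    ℕ ↪ Bool × Move × Move × TapeSym Λ × List (TapeSym Λ) where
  toFun i := (true, .stay, .stay, β, List.replicate i .blank)
  inj' i j h := by simpa using h

theorem mem_chooserStep {β : TapeSym Λ} {m : ℕ} {b : Bool}
    {t : Bool × Move × Move × TapeSym Λ × List (TapeSym Λ)}
    (h : t ∈ if b then ∅ else (Finset.range m).map (chooserStep β)) :
    ∃ i, t = (true, .stay, .stay, β, List.replicate i .blank) := by
  cases b
  · obtain ⟨i, -, rfl⟩ := Finset.mem_map.1 h
    exact ⟨i, rfl⟩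
  · simp at h

/-- The machine that, in a single existential step, writes one of `m` labels. -/
noncomputable def chooser (Λ : Type u) (m : ℕ) : ATO Λ where
  State := Bool
  finite_state := inferInstance
  init := false
  accept := true
  reject := true
  existential := {false}
  universal := ∅
  labeling := Set.univ
  disjoint := by simp
  partition := by ext b; cases b <;> simp
  init_labeling := trivial
  δ s _ β := if s then ∅ else (Finset.range m).map (chooserStep β)
  δ_accept := by simp
  δ_reject := by simp
  δ_input := by intro s β t h; obtain ⟨i, rfl⟩ := mem_chooserStep h; simp
  δ_work := by intro s β t h; obtain ⟨i, rfl⟩ := mem_chooserStep h; simp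
  δ_marker := by intro s α β t h; obtain ⟨i, rfl⟩ := mem_chooserStep h; simp

/-- The computation of `chooser` that chooses the `i`-th label. -/
noncomputable def chooserTree (Λ : Type u) (m : ℕ) (w : List Λ) (i : ℕ) :
    LTree (chooser Λ m).Config :=
  .node ((chooser Λ m).initial w) [.node ((chooser Λ m).move ((chooser Λ m).initial w)
    (true, Move.stay, Move.stay, TapeSym.marker, List.replicate i TapeSym.blank)) []]

theorem chooser_next (m : ℕ) (w : List Λ) (C : (chooser Λ m).Config) :
    C ∈ (chooser Λ m).next ((chooser Λ m).initial w) ↔ ∃ i < m,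
      C = (chooser Λ m).move ((chooser Λ m).initial w)
        (true, Move.stay, Move.stay, TapeSym.marker, List.replicate i TapeSym.blank) := by
  constructor
  · rintro ⟨t, ht, rfl⟩
    obtain ⟨i, hi, rfl⟩ := Finset.mem_map.1 ht
    exact ⟨i, Finset.mem_range.1 hi, rfl⟩
  · rintro ⟨i, hi, rfl⟩
    exact ⟨_, Finset.mem_map.2 ⟨i, Finset.mem_range.2 hi, rfl⟩, rfl⟩

/-- The state `false` is existential and `true` halts, so a run is a root with a single leaf,
determined by the chosen index. -/
theorem chooser_isComputation (m : ℕ) (w : List Λ) (T : LTree (chooser Λ m).Config) :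
    (chooser Λ m).IsComputation w T ↔ ∃ i < m, T = chooserTree Λ m w i := by
  constructor
  · rintro ⟨h1, h2⟩
    cases h2 with
    | halt C h =>
      simp only [LTree.root] at h1
      subst h1
      simp [chooser, initial] at h
    | universal C ts h => exact h.elim
    | existential C t h ht hr =>
      simp only [LTree.root] at h1
      subst h1
      obtain ⟨i, hi, h⟩ := (chooser_next m w _).1 ht
      refine ⟨i, hi, ?_⟩
      cases hr with
      | halt C' h' =>
        simp only [LTree.root] at h
        rw [h]; rfl
      | universal C ts h' => exact h'.elim
      | existential C' t h' =>
        simp only [LTree.root] at h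
        subst h
        exact Bool.noConfusion (show true = false from h')
  · rintro ⟨i, hi, rfl⟩
    refine ⟨rfl, .existential _ _ rfl ((chooser_next m w _).2 ⟨i, hi, rfl⟩) (.halt _ (Or.inl rfl))⟩

theorem chooserTree_output (m : ℕ) (w : List Λ) (i : ℕ) :
    (chooser Λ m).outputForest (chooserTree Λ m w i) =
      [.node [] [.node (List.replicate i TapeSym.blank) []]] := by
  have h : ∀ s, s ∈ (chooser Λ m).labeling := fun s => trivial
  rw [chooserTree, outputForest_labeling _ (h _), List.flatMap_cons, outputForest_labeling _ (h _)]
  simp [move, h, initial]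

theorem chooser_span (m : ℕ) (w : List Λ) : (chooser Λ m).span w = m := by
  have : (chooser Λ m).validOutputs w = (fun i : ℕ => (LTree.node ([] : List (TapeSym Λ))
      [LTree.node (List.replicate i TapeSym.blank) []]).toUTree) '' (Finset.range m : Set ℕ) := by
    ext O
    constructor
    · rintro ⟨T, hT, -, O', h, rfl⟩
      obtain ⟨i, hi, rfl⟩ := (chooser_isComputation m w T).1 hT
      rw [chooserTree_output] at h
      simp only [List.cons.injEq, and_true] at h
      exact ⟨i, by simpa using hi, by rw [← h]⟩
    · rintro ⟨i, hi, rfl⟩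
      refine ⟨_, (chooser_isComputation m w _).2 ⟨i, by simpa using hi, rfl⟩, ?_, _,
        chooserTree_output m w i, rfl⟩
      intro C hC
      simp [chooserTree, LTree.leaves, LTree.leavesList] at hC
      subst hC
      rfl
  rw [span, this, Function.Injective.encard_image, Set.encard_coe_eq_coe_finsetCard,
    Finset.card_range]
  intro i j h
  -- The labels of the output are the empty word and `i` blanks, so their multiset determines `i`.
  have h' := LTree.Iso.nodes_perm (Quotient.exact h)
  simpa [LTree.nodes, LTree.nodesList] using h'

theorem chooser_wellBehaved (m : ℕ) : (chooser Λ m).WellBehaved := by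
  -- There are two nodes, a working tape of length one, and labels shorter than `m`; `m + 2` bounds
  -- all of these.
  refine ⟨1, m + 2, 0, fun w T hT => ?_⟩
  obtain ⟨i, hi, rfl⟩ := (chooser_isComputation m w T).1 hT
  refine ⟨?_, ?_, ?_⟩
  · simp [chooserTree, LTree.size, LTree.nodes, LTree.nodesList]
  · intro C hC
    have hl : 1 ≤ logBound w.length := by simp [logBound]
    have : m + 2 ≤ (m + 2) * logBound w.length := Nat.le_mul_of_pos_right _ hl
    simp [chooserTree, LTree.nodes, LTree.nodesList] at hC
    rcases hC with rfl | rfl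
    · simp [initial]; omega
    · have h : ∀ s, s ∈ (chooser Λ m).labeling := fun s => trivial
      simp [move, initial, tapeWrite, h]; omega
  · intro p _ _
    refine (List.countP_eq_zero.2 fun C _ h => ?_).le
    exact (@of_decide_eq_true _ (_) h : C.state ∈ (chooser Λ m).universal)

end ATO

/-- Constant functions are in `SpanTL`. -/
theorem const_mem_SpanTL {Λ : Type u} (m : ℕ) : (fun _ => m) ∈ SpanTL Λ :=
  ⟨ATO.chooser Λ m, ATO.chooser_wellBehaved m, ATO.chooser_span m⟩

/-! ### Deterministic programs on one working tape -/

/-- A deterministic program with a control set `Loc`. A step reads the scanned symbols of the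
input and the working tape, and either goes to another control location or exits with a value. -/
structure Prog (Λ : Type u) (ε : Type) where
  Loc : Type
  finite_loc : Finite Loc
  entry : Loc
  step : Loc → TapeSym Λ → TapeSym Λ → (Loc ⊕ ε) × Move × Move × TapeSym Λ
  step_input : ∀ l β, (step l TapeSym.marker β).2.1 ≠ Move.left
  step_work : ∀ l α, (step l α TapeSym.marker).2.2.1 ≠ Move.left
  step_marker : ∀ l α β, (step l α β).2.2.2 = TapeSym.marker ↔ β = TapeSym.marker

/-- Contents of the working tape, and the positions of the two cursors. -/
structure Mem (Λ : Type u) where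
  tape : ℕ → TapeSym Λ
  ip : ℕ
  wp : ℕ

namespace Prog

variable {Λ : Type u} {ε δ : Type}

open Classical in
/-- The program with a single step. Illegal cursor moves are suppressed, and so are illegal
operations on the marker. -/
noncomputable def act (f : TapeSym Λ → TapeSym Λ → ε × Move × Move × TapeSym Λ) : Prog Λ ε where
  Loc := Unit
  finite_loc := inferInstance
  entry := ()
  step _ α β := (.inr (f α β).1,
    if α = .marker ∧ (f α β).2.1 = .left then .stay else (f α β).2.1,
    if β = .marker ∧ (f α β).2.2.1 = .left then .stay else (f α β).2.2.1,
    if β = .marker then .marker else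
      if (f α β).2.2.2 = .marker then .blank else (f α β).2.2.2)
  step_input l β := by
    by_cases h : (f .marker β).2.1 = .left <;> simp [h]
  step_work l α := by
    by_cases h : (f α .marker).2.2.1 = .left <;> simp [h]
  step_marker l α β := by
    by_cases h : β = .marker
    · simp [h]
    · by_cases h' : (f α β).2.2.2 = .marker <;> simp [h, h']

/-- Sequential composition. -/
def bind [Finite ε] (p : Prog Λ ε) (f : ε → Prog Λ δ) : Prog Λ δ where
  Loc := p.Loc ⊕ (Σ e, (f e).Loc)
  finite_loc := by
    have := p.finite_loc
    have := fun e => (f e).finite_loc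
    infer_instance
  entry := .inl p.entry
  step
    | .inl l, α, β => ((p.step l α β).1.elim (fun l' => .inl (.inl l'))
        (fun e => .inl (.inr ⟨e, (f e).entry⟩)), (p.step l α β).2)
    | .inr ⟨e, l⟩, α, β => (((f e).step l α β).1.elim (fun l' => .inl (.inr ⟨e, l'⟩)) .inr,
        ((f e).step l α β).2)
  step_input
    | .inl l => p.step_input l
    | .inr ⟨e, l⟩ => (f e).step_input l
  step_work
    | .inl l => p.step_work l
    | .inr ⟨e, l⟩ => (f e).step_work l
  step_marker
    | .inl l => p.step_marker l
    | .inr ⟨e, l⟩ => (f e).step_marker l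

/-- Iteration: `body e` is repeated with a new value as long as it exits on the left. -/
def iter [Finite ε] (body : ε → Prog Λ (ε ⊕ δ)) (e₀ : ε) : Prog Λ δ where
  Loc := Σ e, (body e).Loc
  finite_loc := by
    have := fun e => (body e).finite_loc
    infer_instance
  entry := ⟨e₀, (body e₀).entry⟩
  step := fun ⟨e, l⟩ α β => (((body e).step l α β).1.elim (fun l' => .inl ⟨e, l'⟩)
    (fun r => r.elim (fun e' => .inl ⟨e', (body e').entry⟩) .inr), ((body e).step l α β).2)
  step_input := fun ⟨e, l⟩ => (body e).step_input l
  step_work := fun ⟨e, l⟩ => (body e).step_work l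
  step_marker := fun ⟨e, l⟩ => (body e).step_marker l

/-- The memory after a step with the given moves that writes `b`. -/
def upd (m : Mem Λ) (r : Move × Move × TapeSym Λ) : Mem Λ where
  tape := Function.update m.tape m.wp r.2.2
  ip := r.1.apply m.ip
  wp := r.2.1.apply m.wp

/-- One step on the input tape `x`, from a memory with cursor positions bounded by `I` and `S`. -/
def Step (x : ℕ → TapeSym Λ) (I S : ℕ) (p : Prog Λ ε) (a b : (p.Loc ⊕ ε) × Mem Λ) : Prop :=
  a.2.ip ≤ I ∧ a.2.wp ≤ S ∧ ∃ l, a.1 = .inl l ∧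
    b = ((p.step l (x a.2.ip) (a.2.tape a.2.wp)).1,
      upd a.2 (p.step l (x a.2.ip) (a.2.tape a.2.wp)).2)

/-- Started with memory `m`, the program exits with value `e` and memory `m'`; before that the
cursor positions are bounded by `I` and `S`. -/
def Exec (x : ℕ → TapeSym Λ) (I S : ℕ) (p : Prog Λ ε) (m : Mem Λ) (e : ε) (m' : Mem Λ) : Prop :=
  Relation.ReflTransGen (Step x I S p) (.inl p.entry, m) (.inr e, m')

variable {x : ℕ → TapeSym Λ} {I S : ℕ}

/-- Both executions are lifted along embeddings of the control sets. The first embedding sends the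
exit with value `e` to the entry of `f e`, where the second execution starts. -/
theorem exec_bind [Finite ε] {p : Prog Λ ε} {f : ε → Prog Λ δ} {m m' m'' : Mem Λ} {e : ε} {d : δ}
    (h1 : Exec x I S p m e m') (h2 : Exec x I S (f e) m' d m'') :
    Exec x I S (p.bind f) m d m'' := by
  have h1' := h1.lift (p := Step x I S (p.bind f))
    (fun a => (a.1.elim (fun l' => .inl (.inl l'))
        (fun e => .inl (.inr ⟨e, (f e).entry⟩)), a.2)) (by
      rintro ⟨_, ma⟩ b ⟨h1, h2, l, rfl, rfl⟩
      exact ⟨h1, h2, .inl l, rfl, rfl⟩)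
  have h2' := h2.lift (p := Step x I S (p.bind f))
    (fun a => (a.1.elim (fun l' => .inl (.inr ⟨e, l'⟩)) .inr, a.2)) (by
      rintro ⟨_, ma⟩ b ⟨h1, h2, l, rfl, rfl⟩
      exact ⟨h1, h2, .inr ⟨e, l⟩, rfl, rfl⟩)
  exact h1'.trans h2'

/-- The initial value `e₀` affects only the entry of the loop, not its steps. Rounds that start from
different values are therefore steps of one program and can be concatenated. -/
theorem exec_iter_aux [Finite ε] {body : ε → Prog Λ (ε ⊕ δ)} {m m' : Mem Λ} (e₀ e : ε)
    {r : ε ⊕ δ} (h : Exec x I S (body e) m r m') :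
    Relation.ReflTransGen (Step x I S (iter body e₀)) (.inl ⟨e, (body e).entry⟩, m)
      (r.elim (fun e' => .inl ⟨e', (body e').entry⟩) .inr, m') :=
  h.lift (p := Step x I S (iter body e₀))
    (fun a => (a.1.elim (fun l' => .inl ⟨e, l'⟩)
    (fun r => r.elim (fun e' => .inl ⟨e', (body e').entry⟩) .inr), a.2)) (by
      rintro ⟨_, ma⟩ b ⟨h1, h2, l, rfl, rfl⟩
      exact ⟨h1, h2, ⟨e, l⟩, rfl, rfl⟩)

theorem exec_iter_exit [Finite ε] {body : ε → Prog Λ (ε ⊕ δ)} {m m' : Mem Λ} {e : ε} {d : δ}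
    (h : Exec x I S (body e) m (.inr d) m') : Exec x I S (iter body e) m d m' :=
  exec_iter_aux e e h

theorem exec_iter_next [Finite ε] {body : ε → Prog Λ (ε ⊕ δ)} {m m' m'' : Mem Λ} {e e' : ε} {d : δ}
    (h : Exec x I S (body e) m (.inl e') m') (h' : Exec x I S (iter body e') m' d m'') :
    Exec x I S (iter body e) m d m'' :=
  (exec_iter_aux e e h).trans h'

/-- The hypotheses say that the step is legal, so that none of the corrections built into `act`
takes effect. -/
theorem exec_act {f : TapeSym Λ → TapeSym Λ → ε × Move × Move × TapeSym Λ} {m : Mem Λ}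
    (hI : m.ip ≤ I) (hS : m.wp ≤ S)
    (h1 : x m.ip = .marker → (f (x m.ip) (m.tape m.wp)).2.1 ≠ .left)
    (h2 : m.tape m.wp = .marker → (f (x m.ip) (m.tape m.wp)).2.2.1 ≠ .left)
    (h3 : (f (x m.ip) (m.tape m.wp)).2.2.2 = .marker ↔ m.tape m.wp = .marker) :
    Exec x I S (act f) m (f (x m.ip) (m.tape m.wp)).1
      (upd m (f (x m.ip) (m.tape m.wp)).2) := by
  refine .single ⟨hI, hS, (), rfl, ?_⟩
  refine Prod.ext rfl (congrArg (upd m) ?_)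
  refine Prod.ext ?_ (Prod.ext ?_ ?_)
  · exact (if_neg fun h => h1 h.1 h.2).symm
  · exact (if_neg fun h => h2 h.1 h.2).symm
  · by_cases h : m.tape m.wp = .marker
    · exact (h3.2 h).trans (if_pos h).symm
    · exact ((if_neg h).trans (if_neg fun h' => h (h3.1 h'))).symm

/-- Exit at once. -/
noncomputable def ret (e : ε) : Prog Λ ε := act fun _ β => (e, .stay, .stay, β)

theorem exec_ret {e : ε} {m : Mem Λ} (hI : m.ip ≤ I) (hS : m.wp ≤ S) :
    Exec x I S (ret e) m e m := by
  have := exec_act (x := x) (I := I) (S := S) (m := m)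
    (f := fun _ β => (e, .stay, .stay, β)) hI hS (by simp) (by simp) (by simp)
  simp only [upd, Move.apply, Function.update_eq_self] at this
  exact this

/-- Move the working cursor `n` cells to the right. -/
noncomputable def right : ℕ → Prog Λ Unit
  | 0 => ret ()
  | n + 1 => bind (act fun _ β => ((), .stay, .right, β)) fun _ => right n

theorem exec_right (n : ℕ) {t : ℕ → TapeSym Λ} {ip wp : ℕ} (hI : ip ≤ I) (hS : wp + n ≤ S) :
    Exec x I S (right n) ⟨t, ip, wp⟩ () ⟨t, ip, wp + n⟩ := by
  induction n generalizing wp with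
  | zero => exact exec_ret hI hS
  | succ n ih =>
    have := exec_act (x := x) (I := I) (S := S) (m := ⟨t, ip, wp⟩)
      (f := fun _ β => ((), .stay, .right, β)) hI (by simp; omega) (by simp) (by simp) (by simp)
    simp only [upd, Move.apply, Function.update_eq_self] at this
    refine exec_bind this ?_
    rw [← add_assoc, add_right_comm]
    exact ih (by omega)

/-- Move the working cursor `n` cells to the left. -/
noncomputable def left : ℕ → Prog Λ Unit
  | 0 => ret ()
  | n + 1 => bind (act fun _ β => ((), .stay, .left, β)) fun _ => left n

theorem exec_left (n : ℕ) {t : ℕ → TapeSym Λ} {ip wp : ℕ} (hI : ip ≤ I) (hS : wp + n ≤ S)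
    (ht : ∀ i, t (i + 1) ≠ .marker) :
    Exec x I S (left n) ⟨t, ip, wp + n⟩ () ⟨t, ip, wp⟩ := by
  induction n generalizing wp with
  | zero => exact exec_ret hI hS
  | succ n ih =>
    have := exec_act (x := x) (I := I) (S := S) (m := ⟨t, ip, wp + (n + 1)⟩)
      (f := fun _ β => ((), .stay, .left, β)) hI hS (by simp)
      (by simp [← add_assoc, ht]) (by simp)
    simp only [upd, Move.apply, Function.update_eq_self] at this
    exact exec_bind this (ih (by omega))

open Classical in
/-- Move the working cursor back to the marker. -/
noncomputable def rewind : Prog Λ Unit :=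
  iter (fun _ : Unit => act fun _ β =>
    if β = .marker then (.inr (), .stay, .stay, β) else (.inl (), .stay, .left, β)) ()

theorem exec_rewind {t : ℕ → TapeSym Λ} {ip wp : ℕ} (hI : ip ≤ I) (hS : wp ≤ S)
    (h0 : t 0 = .marker) (ht : ∀ i, t (i + 1) ≠ .marker) :
    Exec x I S rewind ⟨t, ip, wp⟩ () ⟨t, ip, 0⟩ := by
  classical
  have key : ∀ wp ≤ S, _ := fun wp (hS : wp ≤ S) => exec_act (x := x) (I := I) (S := S)
    (m := ⟨t, ip, wp⟩) (f := fun _ β =>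
      if β = .marker then ((.inr () : Unit ⊕ Unit), .stay, .stay, β) else (.inl (), .stay, .left, β))
    hI hS (by dsimp only; split_ifs <;> simp) (by dsimp only; split_ifs <;> simp_all)
    (by dsimp only; split_ifs <;> simp)
  induction wp with
  | zero =>
    have := key 0 hS
    have e : Function.update t 0 .marker = t := by rw [← h0, Function.update_eq_self]
    simp only [h0, if_true, upd, Move.apply, e] at this
    exact exec_iter_exit this
  | succ n ih =>
    have := key (n + 1) hS
    simp only [if_neg (ht n), upd, Move.apply, Function.update_eq_self] at this
    exact exec_iter_next this (ih (by omega))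

open Classical in
/-- Move the input cursor back to the marker. -/
noncomputable def rewindInput : Prog Λ Unit :=
  iter (fun _ : Unit => act fun α β =>
    if α = .marker then (.inr (), .stay, .stay, β) else (.inl (), .left, .stay, β)) ()

theorem exec_rewindInput {t : ℕ → TapeSym Λ} {ip wp : ℕ} (hI : ip ≤ I) (hS : wp ≤ S)
    (h0 : x 0 = .marker) (hx : ∀ i, x (i + 1) ≠ .marker) :
    Exec x I S rewindInput ⟨t, ip, wp⟩ () ⟨t, 0, wp⟩ := by
  classical
  have key : ∀ ip ≤ I, _ := fun ip (hI : ip ≤ I) => exec_act (x := x) (I := I) (S := S)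
    (m := ⟨t, ip, wp⟩) (f := fun α β =>
      if α = .marker then ((.inr () : Unit ⊕ Unit), .stay, .stay, β) else (.inl (), .left, .stay, β))
    hI hS (by dsimp only; split_ifs <;> simp_all) (by dsimp only; split_ifs <;> simp)
    (by dsimp only; split_ifs <;> simp)
  induction ip with
  | zero =>
    have := key 0 hI
    simp only [h0, if_true, upd, Move.apply, Function.update_eq_self] at this
    exact exec_iter_exit this
  | succ n ih =>
    have := key (n + 1) hI
    simp only [if_neg (hx n), upd, Move.apply, Function.update_eq_self] at this
    exact exec_iter_next this (ih (by omega))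

open Classical in
/-- Read the input symbol. -/
noncomputable def readInput (f : TapeSym Λ → ε) : Prog Λ ε :=
  act fun α β => (f α, .stay, .stay, β)

theorem exec_readInput {f : TapeSym Λ → ε} {m : Mem Λ} (hI : m.ip ≤ I) (hS : m.wp ≤ S) :
    Exec x I S (readInput f) m (f (x m.ip)) m := by
  have := exec_act (x := x) (I := I) (S := S) (m := m)
    (f := fun α β => (f α, .stay, .stay, β)) hI hS (by simp) (by simp) (by simp)
  simp only [upd, Function.update_eq_self] at this
  exact this

/-- Move the input cursor. -/
noncomputable def moveInput (d : Move) : Prog Λ Unit :=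
  act fun _ β => ((), d, .stay, β)

theorem exec_moveInput {d : Move} {m : Mem Λ} (hI : m.ip ≤ I) (hS : m.wp ≤ S)
    (h : x m.ip = .marker → d ≠ .left) :
    Exec x I S (moveInput d) m () ⟨m.tape, d.apply m.ip, m.wp⟩ := by
  have := exec_act (x := x) (I := I) (S := S) (m := m)
    (f := fun _ β => ((), d, .stay, β)) hI hS h (by simp) (by simp)
  simp only [upd, Function.update_eq_self] at this
  exact this

end Prog

/-! ### Binary counters on the working tape -/

/-- Isolates bit `j` of a number with low part `c` and high part `u`: changing this bit changes no
other one. All later bit manipulations have this shape. -/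
theorem testBit_two_pow_mul_bit_add {j c : ℕ} (hc : c < 2 ^ j) (u : ℕ) (b : Bool) (i : ℕ) :
    (2 ^ j * (2 * u + b.toNat) + c).testBit i =
      if i = j then b else (2 ^ j * (2 * u) + c).testBit i := by
  rw [Nat.testBit_two_pow_mul_add _ hc, Nat.testBit_two_pow_mul_add _ hc]
  rcases lt_trichotomy i j with h | h | h
  · simp [h, h.ne]
  · subst h; cases b <;> simp
  · obtain ⟨k, rfl⟩ := Nat.exists_eq_add_of_lt h
    have e1 : j + k + 1 - j = k + 1 := by omega
    have e2 : (2 * u + b.toNat) / 2 = u := by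
      cases b
      · simp
      · simp; omega
    have e3 : 2 * u / 2 = u := by omega
    rw [if_neg (by omega), if_neg (by omega), if_neg (by omega), e1, Nat.testBit_succ, e2,
      Nat.testBit_succ, e3]

/-- A binary digit as a tape symbol. -/
def bitSym {Λ : Type u} (a : Λ) (b : Bool) : TapeSym Λ := if b then .letter a else .blank

/-- The working tape that stores the eight numbers `v 0, …, v 7` in binary, interleaved. -/
def ctape {Λ : Type u} (a : Λ) (v : ℕ → ℕ) : ℕ → TapeSym Λ
  | 0 => .marker
  | n + 1 => bitSym a ((v (n % 8)).testBit (n / 8))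

section

variable {Λ : Type u} {a : Λ} {v : ℕ → ℕ}

theorem bitSym_ne_marker (b : Bool) : bitSym a b ≠ .marker := by cases b <;> simp [bitSym]

theorem ctape_succ_ne (i : ℕ) : ctape a v (i + 1) ≠ .marker := bitSym_ne_marker _

theorem ctape_cell {r : ℕ} (hr : r < 8) (j : ℕ) :
    ctape a v (8 * j + r + 1) = bitSym a ((v r).testBit j) := by
  have h1 : (8 * j + r) % 8 = r := by omega
  have h2 : (8 * j + r) / 8 = j := by omega
  rw [ctape, h1, h2]

/-- The tracks occupy disjoint residue classes modulo `8`, so one cell carries one bit of one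
counter; the offset `1` skips the marker. -/
theorem update_ctape {r : ℕ} (hr : r < 8) (j x : ℕ) (b : Bool)
    (h : ∀ i, x.testBit i = if i = j then b else (v r).testBit i) :
    Function.update (ctape a v) (8 * j + r + 1) (bitSym a b) =
      ctape a (Function.update v r x) := by
  funext n
  cases n with
  | zero => rw [Function.update_of_ne (by omega)]; rfl
  | succ n =>
    by_cases hn : n = 8 * j + r
    · subst hn
      rw [Function.update_self, ctape_cell hr, Function.update_self, h, if_pos rfl]
    · rw [Function.update_of_ne (by omega), ctape, ctape]
      by_cases hr' : n % 8 = r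
      · rw [hr', Function.update_self, h, if_neg (by omega)]
      · rw [Function.update_of_ne hr']

theorem update_ctape_bit {r : ℕ} (hr : r < 8) {j c : ℕ} (hc : c < 2 ^ j) (u : ℕ) (b b' : Bool) :
    Function.update (ctape a (Function.update v r (2 ^ j * (2 * u + b.toNat) + c)))
      (8 * j + r + 1) (bitSym a b') =
      ctape a (Function.update v r (2 ^ j * (2 * u + b'.toNat) + c)) := by
  rw [update_ctape hr j (2 ^ j * (2 * u + b'.toNat) + c), Function.update_idem]
  intro i
  rw [Function.update_self, testBit_two_pow_mul_bit_add hc, testBit_two_pow_mul_bit_add hc u b]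
  split_ifs <;> rfl

end

-- Increment, decrement and zero test for a single counter.

namespace Prog

variable {Λ : Type u} (a : Λ)

open Classical in
/-- Invert the scanned bit and return its old value. -/
noncomputable def flipBit : Prog Λ Bool :=
  act fun _ β => (decide (β = .letter a), .stay, .stay, bitSym a (!decide (β = .letter a)))

open Classical in
/-- Return the scanned bit. -/
noncomputable def getBit : Prog Λ Bool :=
  act fun _ β => (decide (β = .letter a), .stay, .stay, β)

/-- Invert the bits of a counter from the scanned bit on, as long as they are equal to `c`, and
the first bit that differs from `c`. -/
noncomputable def carry (c : Bool) : Prog Λ Unit :=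
  iter (fun _ : Unit => bind (flipBit a) fun b =>
    if b = c then bind (right 8) fun _ => ret (.inl ()) else ret (.inr ())) ()

/-- Write the bit `1`. -/
noncomputable def setBit : Prog Λ Unit := act fun _ _ => ((), .stay, .stay, .letter a)

/-- Increment counter `r`. -/
noncomputable def inc (r : ℕ) : Prog Λ Unit :=
  bind (right (r + 1)) fun _ => bind (carry a true) fun _ => bind (left r) fun _ =>
    bind (setBit a) fun _ => rewind

/-- Test whether counter `r` is nonzero, and leave the working cursor somewhere. -/
noncomputable def search (r : ℕ) : Prog Λ Bool :=
  iter (fun _ : Unit => bind (getBit a) fun b =>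
    if b then bind (right r) fun _ => bind (getBit a) fun b' =>
      if b' then ret (.inr true) else bind (right (8 - r)) fun _ => ret (.inl ())
    else ret (.inr false)) ()

/-- Decrement counter `r`, unless it is zero; tell whether it was nonzero. -/
noncomputable def dec (r : ℕ) : Prog Λ Bool :=
  bind (right 1) fun _ => bind (search a r) fun b => bind rewind fun _ =>
    if b then bind (right (r + 1)) fun _ => bind (carry a false) fun _ => bind rewind fun _ =>
      ret true
    else ret false

variable {a} {x : ℕ → TapeSym Λ} {I S : ℕ} {v : ℕ → ℕ}

theorem exec_flipBit {r : ℕ} (hr : r < 8) {j c u : ℕ} (hc : c < 2 ^ j) (b : Bool) {ip : ℕ}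
    (hI : ip ≤ I) (hS : 8 * j + r + 1 ≤ S) :
    Exec x I S (flipBit a)
      ⟨ctape a (Function.update v r (2 ^ j * (2 * u + b.toNat) + c)), ip, 8 * j + r + 1⟩ b
      ⟨ctape a (Function.update v r (2 ^ j * (2 * u + (!b).toNat) + c)), ip, 8 * j + r + 1⟩ := by
  classical
  have hb : (decide (ctape a (Function.update v r (2 ^ j * (2 * u + b.toNat) + c))
      (8 * j + r + 1) = .letter a)) = b := by
    rw [ctape_cell hr, Function.update_self, testBit_two_pow_mul_bit_add hc]
    cases b <;> simp [bitSym]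
  have := exec_act (x := x) (I := I) (S := S) (m :=
    ⟨ctape a (Function.update v r (2 ^ j * (2 * u + b.toNat) + c)), ip, 8 * j + r + 1⟩)
    (f := fun _ β => (decide (β = .letter a), .stay, .stay, bitSym a (!decide (β = .letter a))))
    hI hS (by simp) (by simp) (by simp [ctape_succ_ne, bitSym_ne_marker])
  simp only [upd, hb, update_ctape_bit hr hc] at this
  exact this

theorem exec_getBit {r : ℕ} (hr : r < 8) {j : ℕ} {ip : ℕ}
    (hI : ip ≤ I) (hS : 8 * j + r + 1 ≤ S) :
    Exec x I S (getBit a) ⟨ctape a v, ip, 8 * j + r + 1⟩ ((v r).testBit j)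
      ⟨ctape a v, ip, 8 * j + r + 1⟩ := by
  classical
  have hb : (decide (ctape a v (8 * j + r + 1) = .letter a)) = (v r).testBit j := by
    rw [ctape_cell hr]
    cases (v r).testBit j <;> simp [bitSym]
  have := exec_act (x := x) (I := I) (S := S) (m := ⟨ctape a v, ip, 8 * j + r + 1⟩)
    (f := fun _ β => (decide (β = .letter a), .stay, .stay, β)) hI hS (by simp) (by simp) (by simp)
  simp only [upd, hb, Function.update_eq_self] at this
  exact this

/-- On arrival at bit `j` the lower bits have been flipped to zero, so the remaining task is to
increment the high part `u`. An even `u` stops the carry; an odd one passes it on to half of `u`.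
The set bit `j'` is recorded because `cexec_inc` must know how far the number has grown. -/
theorem exec_carry_true {r : ℕ} (hr : r < 8) {β ip : ℕ} (hI : ip ≤ I) (hS : 8 * β + 16 ≤ S) (u j : ℕ)
    (hβ : 2 ^ j * (u + 1) ≤ 2 ^ β) :
    ∃ j', 2 ^ j' ≤ 2 ^ j * (u + 1) ∧ (2 ^ j * (u + 1)).testBit j' = true ∧ Exec x I S (carry a true)
      ⟨ctape a (Function.update v r (2 ^ j * u)), ip, 8 * j + r + 1⟩ ()
      ⟨ctape a (Function.update v r (2 ^ j * (u + 1))), ip, 8 * j' + r + 1⟩ := by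
  induction u using Nat.strong_induction_on generalizing j with
  | _ u ih =>
    have hj : j ≤ β := (Nat.pow_le_pow_iff_right (by norm_num : 1 < 2)).1
      (le_trans (Nat.le_mul_of_pos_right _ (by omega)) hβ)
    have key := fun u' b => exec_flipBit (a := a) (x := x) (I := I) (S := S) (v := v) hr
      (j := j) (c := 0) (u := u') (Nat.two_pow_pos j) b hI (by omega)
    rcases Nat.even_or_odd' u with ⟨u', rfl | rfl⟩
    · have hb := testBit_two_pow_mul_bit_add (Nat.two_pow_pos j) u' true j
      rw [if_pos rfl] at hb
      refine ⟨j, Nat.le_mul_of_pos_right _ (by omega), hb, ?_⟩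
      have h := key u' false
      simp only [Bool.toNat_false, add_zero, Bool.not_false, Bool.toNat_true] at h
      exact exec_iter_exit (exec_bind h (by rw [if_neg (by simp)]; exact exec_ret hI (by simp; omega)))
    · have e : 2 ^ (j + 1) * (u' + 1) = 2 ^ j * (2 * u' + 1 + 1) := by rw [pow_succ]; ring
      obtain ⟨j', h1, hb, h2⟩ := ih u' (by omega) (j + 1) (by rw [e]; exact hβ)
      rw [e] at h1 hb h2
      refine ⟨j', h1, hb, ?_⟩
      have h := key u' true
      simp only [Bool.toNat_false, add_zero, Bool.not_true, Bool.toNat_true] at h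
      refine exec_iter_next (e' := ()) (exec_bind h ?_) h2
      rw [if_pos rfl, show 8 * (j + 1) + r + 1 = 8 * j + r + 1 + 8 by ring,
        show 2 ^ (j + 1) * u' = 2 ^ j * (2 * u') by rw [pow_succ]; ring]
      exact exec_bind (exec_right 8 hI (by omega)) (exec_ret hI (by simp; omega))

/-- The mirror image for borrowing: the bits below `j` have become ones, hence the summand `2 ^ j -
1`. Positivity of `u` ensures that a one is met. -/
theorem exec_carry_false {r : ℕ} (hr : r < 8) {β ip : ℕ} (hI : ip ≤ I) (hS : 8 * β + 16 ≤ S)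
    (u j : ℕ) (hu : 0 < u) (hβ : 2 ^ j * u ≤ 2 ^ β) :
    ∃ j' ≤ β, Exec x I S (carry a false)
      ⟨ctape a (Function.update v r (2 ^ j * u + (2 ^ j - 1))), ip, 8 * j + r + 1⟩ ()
      ⟨ctape a (Function.update v r (2 ^ j * u - 1)), ip, 8 * j' + r + 1⟩ := by
  induction u using Nat.strong_induction_on generalizing j with
  | _ u ih =>
    have hj : j ≤ β := (Nat.pow_le_pow_iff_right (by norm_num : 1 < 2)).1
      (le_trans (Nat.le_mul_of_pos_right _ (by omega)) hβ)
    have h2j := Nat.two_pow_pos j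
    have key := fun u' b => exec_flipBit (a := a) (x := x) (I := I) (S := S) (v := v) hr
      (j := j) (c := 2 ^ j - 1) (u := u') (by omega) b hI (by omega)
    rcases Nat.even_or_odd' u with ⟨u', rfl | rfl⟩
    · have e : 2 ^ (j + 1) * u' = 2 ^ j * (2 * u') := by rw [pow_succ]; ring
      obtain ⟨j', h1, h2⟩ := ih u' (by omega) (j + 1) (by omega) (by rw [e]; exact hβ)
      rw [e] at h2
      refine ⟨j', h1, ?_⟩
      have h := key u' false
      simp only [Bool.toNat_false, add_zero, Bool.not_false, Bool.toNat_true] at h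
      refine exec_iter_next (e' := ()) (exec_bind h ?_) h2
      rw [if_pos rfl, show 8 * (j + 1) + r + 1 = 8 * j + r + 1 + 8 by ring,
        show 2 ^ j * (2 * u') + (2 ^ (j + 1) - 1) = 2 ^ j * (2 * u' + 1) + (2 ^ j - 1) by
          rw [pow_succ, mul_add]; omega]
      exact exec_bind (exec_right 8 hI (by omega)) (exec_ret hI (by simp; omega))
    · refine ⟨j, hj, ?_⟩
      have h := key u' true
      simp only [Bool.toNat_false, add_zero, Bool.not_true, Bool.toNat_true] at h
      rw [show 2 ^ j * (2 * u' + 1) - 1 = 2 ^ j * (2 * u') + (2 ^ j - 1) by rw [mul_add]; omega]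
      exact exec_iter_exit (exec_bind h (by rw [if_neg (by simp)]; exact exec_ret hI (by simp; omega)))

/-- Track `0` holds `2 ^ m - 1`, that is, `m` ones followed by zeros, and so marks where the search
may stop. The factor `2 ^ j` of `v r` records that the first `j` bits were found to be zero. -/
theorem exec_search {r m : ℕ} (hr : r < 8) {β ip : ℕ} (hI : ip ≤ I) (hS : 8 * β + 16 ≤ S)
    (hm : m ≤ β) (h0 : v 0 = 2 ^ m - 1) (hv : v r < 2 ^ m) (k j u : ℕ) (hk : j + k = m)
    (hu : v r = 2 ^ j * u) :
    ∃ j' ≤ 8 * β + 16, Exec x I S (search a r) ⟨ctape a v, ip, 8 * j + 1⟩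
      (decide (v r ≠ 0)) ⟨ctape a v, ip, j'⟩ := by
  induction k generalizing j u with
  | zero =>
    obtain rfl : j = m := by omega
    -- All `m` bits have been inspected, and `v r < 2 ^ m` leaves no room for a higher one.
    have : u = 0 := by
      by_contra h
      have : 2 ^ j ≤ 2 ^ j * u := Nat.le_mul_of_pos_right _ (by omega)
      omega
    have h := exec_getBit (a := a) (x := x) (I := I) (S := S) (v := v) (r := 0) (by omega) (j := j)
      hI (by omega)
    rw [h0, Nat.testBit_two_pow_sub_one, decide_eq_false (by omega)] at h
    refine ⟨8 * j + 1, by omega, exec_iter_exit (exec_bind h ?_)⟩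
    rw [hu, this, if_neg (by simp)]
    exact exec_ret hI (by simp; omega)
  | succ k ih =>
    have h := exec_getBit (a := a) (x := x) (I := I) (S := S) (v := v) (r := 0) (by omega) (j := j)
      hI (by omega)
    rw [h0, Nat.testBit_two_pow_sub_one, decide_eq_true (by omega)] at h
    have h' := exec_getBit (a := a) (x := x) (I := I) (S := S) (v := v) hr (j := j)
      hI (by omega)
    have hR := exec_right (x := x) (I := I) (S := S) r (t := ctape a v) (wp := 8 * j + 1)
      hI (by omega)
    rw [add_right_comm] at hR
    have e : (v r).testBit j = u.testBit 0 := by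
      have := Nat.testBit_two_pow_mul_add u (Nat.two_pow_pos j) j
      rw [hu]; simpa using this
    rcases Nat.even_or_odd' u with ⟨u', rfl | rfl⟩
    · have e' : (v r).testBit j = false := by rw [e]; simp
      rw [e'] at h'
      obtain ⟨j', h1, h2⟩ := ih (j + 1) u' (by omega) (by rw [hu, pow_succ]; ring)
      refine ⟨j', h1, exec_iter_next (e' := ()) (exec_bind h ?_) h2⟩
      rw [if_pos rfl]
      refine exec_bind hR (exec_bind h' ?_)
      rw [if_neg (by simp)]
      have hR' := exec_right (x := x) (I := I) (S := S) (8 - r) (t := ctape a v)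
        (wp := 8 * j + r + 1) hI (by omega)
      rw [show 8 * j + r + 1 + (8 - r) = 8 * (j + 1) + 1 by omega] at hR'
      exact exec_bind hR' (exec_ret hI (by simp; omega))
    · have e' : (v r).testBit j = true := by rw [e]; simp
      rw [e'] at h'
      refine ⟨8 * j + r + 1, by omega, exec_iter_exit (exec_bind h ?_)⟩
      rw [if_pos rfl]
      refine exec_bind hR (exec_bind h' ?_)
      rw [if_pos rfl, decide_eq_true (by rw [hu]; simp)]
      exact exec_ret hI (by simp; omega)

theorem exec_setBit {t : ℕ → TapeSym Λ} {ip wp : ℕ} (hI : ip ≤ I) (hS : wp ≤ S)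
    (ht : t wp ≠ .marker) :
    Exec x I S (setBit a) ⟨t, ip, wp⟩ () ⟨Function.update t wp (.letter a), ip, wp⟩ :=
  exec_act (x := x) (I := I) (S := S) (m := ⟨t, ip, wp⟩)
    (f := fun _ _ => ((), .stay, .stay, .letter a)) hI hS (by simp) (by simp) (by simp [ht])

/-- Execution of a program on counters `v 1, …, v 7` below `2 ^ β`; between such executions the
working cursor rests on the marker. -/
def CExec {ε : Type} (a : Λ) (x : ℕ → TapeSym Λ) (I β : ℕ) (p : Prog Λ ε) (v : ℕ → ℕ) (ip : ℕ)
    (e : ε) (v' : ℕ → ℕ) (ip' : ℕ) : Prop :=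
  ∀ m ≤ β, (∀ r, v r < 2 ^ m) → ∃ m' ≤ β, (∀ r, v' r < 2 ^ m') ∧
    Exec x I (8 * β + 16) p ⟨ctape a (Function.update v 0 (2 ^ m - 1)), ip, 0⟩ e
      ⟨ctape a (Function.update v' 0 (2 ^ m' - 1)), ip', 0⟩

variable {ε δ : Type} {β ip ip' ip'' : ℕ} {v' v'' : ℕ → ℕ}

theorem cexec_bind [Finite ε] {p : Prog Λ ε} {f : ε → Prog Λ δ} {e : ε} {d : δ}
    (h1 : CExec a x I β p v ip e v' ip') (h2 : CExec a x I β (f e) v' ip' d v'' ip'') :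
    CExec a x I β (p.bind f) v ip d v'' ip'' := by
  intro m hm hv
  obtain ⟨m', hm', hv', h⟩ := h1 m hm hv
  obtain ⟨m'', hm'', hv'', h'⟩ := h2 m' hm' hv'
  exact ⟨m'', hm'', hv'', exec_bind h h'⟩

theorem cexec_iter_exit [Finite ε] {body : ε → Prog Λ (ε ⊕ δ)} {e : ε} {d : δ}
    (h : CExec a x I β (body e) v ip (.inr d) v' ip') :
    CExec a x I β (iter body e) v ip d v' ip' := by
  intro m hm hv
  obtain ⟨m', hm', hv', h⟩ := h m hm hv
  exact ⟨m', hm', hv', exec_iter_exit h⟩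

theorem cexec_iter_next [Finite ε] {body : ε → Prog Λ (ε ⊕ δ)} {e e' : ε} {d : δ}
    (h1 : CExec a x I β (body e) v ip (.inl e') v' ip')
    (h2 : CExec a x I β (iter body e') v' ip' d v'' ip'') :
    CExec a x I β (iter body e) v ip d v'' ip'' := by
  intro m hm hv
  obtain ⟨m', hm', hv', h⟩ := h1 m hm hv
  obtain ⟨m'', hm'', hv'', h'⟩ := h2 m' hm' hv'
  exact ⟨m'', hm'', hv'', exec_iter_next h h'⟩

theorem cexec_of_exec {p : Prog Λ ε} {e : ε}
    (h : ∀ t : ℕ → TapeSym Λ, Exec x I (8 * β + 16) p ⟨t, ip, 0⟩ e ⟨t, ip', 0⟩) :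
    CExec a x I β p v ip e v ip' :=
  fun m hm hv => ⟨m, hm, hv, h _⟩

theorem cexec_ret {e : ε} (hI : ip ≤ I) : CExec a x I β (ret e) v ip e v ip :=
  cexec_of_exec fun _ => exec_ret hI (Nat.zero_le _)

theorem cexec_rewindInput (hI : ip ≤ I) (h0 : x 0 = .marker) (hx : ∀ i, x (i + 1) ≠ .marker) :
    CExec a x I β rewindInput v ip () v 0 :=
  cexec_of_exec fun _ => exec_rewindInput hI (Nat.zero_le _) h0 hx

theorem cexec_readInput {f : TapeSym Λ → ε} (hI : ip ≤ I) :
    CExec a x I β (readInput f) v ip (f (x ip)) v ip :=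
  cexec_of_exec fun _ => exec_readInput hI (Nat.zero_le _)

theorem cexec_moveInput {d : Move} (hI : ip ≤ I) (h : x ip = .marker → d ≠ .left) :
    CExec a x I β (moveInput d) v ip () v (d.apply ip) :=
  cexec_of_exec fun _ => exec_moveInput hI (Nat.zero_le _) h

/-- The carry stops at some bit `j`. Setting bit `j` of track `0` keeps that track a block of ones
long enough for the new value. -/
theorem cexec_inc {r : ℕ} (hr : 0 < r) (hr' : r < 8) (hI : ip ≤ I) (hβ : v r + 1 < 2 ^ β) :
    CExec a x I β (inc a r) v ip () (Function.update v r (v r + 1)) ip := by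
  intro m hm hv
  have h1 := exec_right (x := x) (I := I) (S := 8 * β + 16) (r + 1)
    (t := ctape a (Function.update v 0 (2 ^ m - 1))) (wp := 0) hI (by omega)
  obtain ⟨j, hj, hb, h2⟩ := exec_carry_true (a := a) (x := x) (I := I) (S := 8 * β + 16)
    (v := Function.update v 0 (2 ^ m - 1)) hr' hI le_rfl (v r) 0 (by simp; omega)
  rw [pow_zero, one_mul, one_mul] at h2
  rw [pow_zero, one_mul] at hj hb
  have hjm : j ≤ m := (Nat.pow_le_pow_iff_right (by norm_num : 1 < 2)).1 (hj.trans (hv r))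
  have hjβ : j < β := (Nat.pow_lt_pow_iff_right (by norm_num : 1 < 2)).1 (hj.trans_lt hβ)
  have e1 : Function.update (Function.update v 0 (2 ^ m - 1)) r (v r) =
      Function.update v 0 (2 ^ m - 1) := by
    conv_lhs => rw [← Function.update_of_ne hr.ne' (2 ^ m - 1) v, Function.update_eq_self]
  have e2 : 0 + (r + 1) = 8 * 0 + r + 1 := by omega
  rw [e1, ← e2] at h2
  have h3 := exec_left (x := x) (I := I) (S := 8 * β + 16) r
    (t := ctape a (Function.update (Function.update v 0 (2 ^ m - 1)) r (v r + 1)))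
    (wp := 8 * j + 1) hI (by omega) (fun i => ctape_succ_ne i)
  rw [add_right_comm] at h3
  have h4 := exec_setBit (x := x) (I := I) (S := 8 * β + 16) (a := a)
    (t := ctape a (Function.update (Function.update v 0 (2 ^ m - 1)) r (v r + 1)))
    (wp := 8 * j + 1) hI (by omega) (ctape_succ_ne _)
  -- Since `j ≤ m`, the new one either lies inside the block of ones or extends it by one cell,
  -- without a gap.
  have e3 : Function.update (ctape a (Function.update (Function.update v 0 (2 ^ m - 1)) r
      (v r + 1))) (8 * j + 1) (.letter a) = ctape a (Function.update
        (Function.update v r (v r + 1)) 0 (2 ^ (max m (j + 1)) - 1)) := by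
    have := update_ctape (a := a) (v := Function.update (Function.update v 0 (2 ^ m - 1)) r
      (v r + 1)) (r := 0) (by omega) j (2 ^ (max m (j + 1)) - 1) true (by
        intro i
        rw [Nat.testBit_two_pow_sub_one, Function.update_of_ne hr.ne, Function.update_self,
          Nat.testBit_two_pow_sub_one]
        by_cases h : i = j
        · simp [h]
        · rw [if_neg h]
          congr 1
          simp only [eq_iff_iff]
          omega)
    refine this.trans ?_
    rw [Function.update_comm hr.ne', Function.update_idem, Function.update_comm hr.ne]
  rw [e3] at h4
  refine ⟨max m (j + 1), by omega, fun r' => ?_, exec_bind h1 (exec_bind h2 (exec_bind h3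
    (exec_bind h4 (exec_rewind hI (by omega) rfl fun i => ctape_succ_ne i))))⟩
  have hmm : 2 ^ m ≤ 2 ^ max m (j + 1) := Nat.pow_le_pow_right (by norm_num) (le_max_left _ _)
  by_cases h : r' = r
  · subst h
    rw [Function.update_self]
    rcases (Nat.succ_le_iff.2 (hv r')).lt_or_eq with h | h
    · exact lt_of_lt_of_le h hmm
    -- The counter outgrows `m` bits only by reaching `2 ^ m`. Its only set bit is then `m`, so `j =
    -- m` and track `0` has grown along.
    · have hk : v r' + 1 = 2 ^ m := h
      rw [hk, Nat.testBit_two_pow, decide_eq_true_eq] at hb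
      rw [hk]
      exact Nat.pow_lt_pow_right (by norm_num) (by omega)
  · rw [Function.update_of_ne h]
    exact (hv r').trans_le hmm

/-- Zero is tested first because the borrow would never stop on it. The bound `m` is kept, as the
value does not grow. -/
theorem cexec_dec {r : ℕ} (hr : 0 < r) (hr' : r < 8) (hI : ip ≤ I) :
    CExec a x I β (dec a r) v ip (decide (v r ≠ 0)) (Function.update v r (v r - 1)) ip := by
  intro m hm hv
  have e1 : Function.update (Function.update v 0 (2 ^ m - 1)) r (v r) =
      Function.update v 0 (2 ^ m - 1) := by
    conv_lhs => rw [← Function.update_of_ne hr.ne' (2 ^ m - 1) v, Function.update_eq_self]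
  have hvr : Function.update v 0 (2 ^ m - 1) r = v r := Function.update_of_ne hr.ne' _ _
  have h1 := exec_right (x := x) (I := I) (S := 8 * β + 16) 1
    (t := ctape a (Function.update v 0 (2 ^ m - 1))) (wp := 0) hI (by omega)
  obtain ⟨j, hj, h2⟩ := exec_search (a := a) (x := x) (I := I) (S := 8 * β + 16) (r := r) (m := m)
    (v := Function.update v 0 (2 ^ m - 1)) hr' hI le_rfl hm (Function.update_self ..)
    (by rw [hvr]; exact hv r) m 0 (v r) (by omega) (by rw [hvr]; simp)
  rw [hvr] at h2
  have h3 := exec_rewind (x := x) (I := I) (S := 8 * β + 16)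
    (t := ctape a (Function.update v 0 (2 ^ m - 1))) hI hj rfl fun i => ctape_succ_ne i
  refine ⟨m, hm, fun r' => ?_, exec_bind h1 (exec_bind h2 (exec_bind h3 ?_))⟩
  · by_cases h : r' = r
    · subst h
      rw [Function.update_self]
      exact (Nat.sub_le _ _).trans_lt (hv r')
    · rw [Function.update_of_ne h]
      exact hv r'
  by_cases h0 : v r = 0
  · rw [decide_eq_false (by simpa using h0), if_neg (by simp)]
    have e : Function.update v r (v r - 1) = v := by
      conv_rhs => rw [← Function.update_eq_self r v]
      rw [h0]
    rw [e]
    exact exec_ret hI (Nat.zero_le _)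
  · rw [decide_eq_true h0, if_pos rfl]
    have h4 := exec_right (x := x) (I := I) (S := 8 * β + 16) (r + 1)
      (t := ctape a (Function.update v 0 (2 ^ m - 1))) (wp := 0) hI (by omega)
    obtain ⟨j', hj', h5⟩ := exec_carry_false (a := a) (x := x) (I := I) (S := 8 * β + 16)
      (v := Function.update v 0 (2 ^ m - 1)) hr' hI le_rfl (v r) 0 (by omega) (by
        rw [pow_zero, one_mul]
        exact (hv r).le.trans (Nat.pow_le_pow_right (by norm_num) hm))
    rw [pow_zero, one_mul, Nat.sub_self, add_zero, e1, show 8 * 0 + r + 1 = 0 + (r + 1) by omega,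
      Function.update_comm hr.ne] at h5
    exact exec_bind h4 (exec_bind h5 (exec_bind (exec_rewind hI (by omega) rfl
      fun i => ctape_succ_ne i) (exec_ret hI (Nat.zero_le _))))

end Prog

/-! ### Arithmetic on the counters -/

namespace Prog

variable {Λ : Type u} (a : Λ)

/-- Run `body` as often as counter `r` can be decremented. -/
noncomputable def whileDec (r : ℕ) (body : Prog Λ Unit) : Prog Λ Unit :=
  iter (fun _ : Unit => bind (dec a r) fun b =>
    if b then bind body fun _ => ret (.inl ()) else ret (.inr ())) ()

/-- Add `k` to counter `r`. -/
noncomputable def incN (r : ℕ) : ℕ → Prog Λ Unit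
  | 0 => ret ()
  | k + 1 => bind (inc a r) fun _ => incN r k

/-- Add `k` times counter `r` to counter `s`, and set counter `r` to zero. -/
noncomputable def transfer (r s k : ℕ) : Prog Λ Unit := whileDec a r (incN a s k)

/-- Add counter `r` to counter `s`; `t` is an auxiliary counter. -/
noncomputable def copy (r s t : ℕ) : Prog Λ Unit :=
  bind (whileDec a r (bind (inc a s) fun _ => inc a t)) fun _ => transfer a t r 1

/-- Append the digit `c` to the number in counter `r`, in base `k + 1`; counter `t` is auxiliary. -/
noncomputable def push (k t r c : ℕ) : Prog Λ Unit :=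
  bind (transfer a r t (k + 1)) fun _ => bind (transfer a t r 1) fun _ => incN a r c

/-- Division by `k + 1`: the remainder is returned, and the quotient is added to counter `t`. -/
noncomputable def divide (k t r : ℕ) (d : Fin (k + 1)) : Prog Λ (Fin (k + 1)) :=
  iter (fun d : Fin (k + 1) => bind (dec a r) fun b =>
    if b then
      if h : d.val + 1 < k + 1 then ret (.inl ⟨d.val + 1, h⟩)
      else bind (inc a t) fun _ => ret (.inl 0)
    else ret (.inr d)) d

/-- Remove the last digit of the number in counter `r`, in base `k + 1`, and return it. -/
noncomputable def pop (k t r : ℕ) : Prog Λ (Fin (k + 1)) :=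
  bind (divide a k t r 0) fun d => bind (transfer a t r 1) fun _ => ret d

variable {a} {x : ℕ → TapeSym Λ} {I β : ℕ} {v : ℕ → ℕ} {ip : ℕ} {r s t : ℕ}

/-- The family `g` is the loop invariant, indexed by the number of rounds still to come. The body
starts after the decrement, with `n` already in counter `r`. -/
theorem cexec_whileDec {body : Prog Λ Unit} (hr : 0 < r) (hr' : r < 8) (hI : ip ≤ I) (N : ℕ)
    (g : ℕ → ℕ → ℕ) (hg : ∀ n ≤ N, g n r = n)
    (hb : ∀ n < N, CExec a x I β body (Function.update (g (n + 1)) r n) ip () (g n) ip) :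
    CExec a x I β (whileDec a r body) (g N) ip () (g 0) ip := by
  induction N with
  | zero =>
    have := cexec_dec (a := a) (x := x) (β := β) (v := g 0) hr hr' hI
    rw [hg 0 le_rfl, decide_eq_false (by simp), show Function.update (g 0) r (0 - 1) = g 0 by
      conv_rhs => rw [← Function.update_eq_self r (g 0), hg 0 le_rfl]] at this
    exact cexec_iter_exit (cexec_bind this (by rw [if_neg (by simp)]; exact cexec_ret hI))
  | succ N ih =>
    have := cexec_dec (a := a) (x := x) (β := β) (v := g (N + 1)) hr hr' hI
    rw [hg (N + 1) le_rfl, decide_eq_true (by simp), Nat.add_sub_cancel] at this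
    refine cexec_iter_next (e' := ()) (cexec_bind this ?_)
      (ih (fun n hn => hg n (by omega)) fun n hn => hb n (by omega))
    rw [if_pos rfl]
    exact cexec_bind (hb N (by omega)) (cexec_ret hI)

theorem cexec_incN (hr : 0 < r) (hr' : r < 8) (hI : ip ≤ I) (k : ℕ) (hβ : v r + k < 2 ^ β) :
    CExec a x I β (incN a r k) v ip () (Function.update v r (v r + k)) ip := by
  induction k generalizing v with
  | zero => rw [add_zero, Function.update_eq_self]; exact cexec_ret hI
  | succ k ih =>
    have h := ih (v := Function.update v r (v r + 1)) (by rw [Function.update_self]; omega)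
    rw [Function.update_self, Function.update_idem, add_assoc, add_comm 1 k] at h
    exact cexec_bind (cexec_inc hr hr' hI (by omega)) h

theorem cexec_transfer (hr : 0 < r) (hr' : r < 8) (hs : 0 < s) (hs' : s < 8) (hrs : r ≠ s)
    (hI : ip ≤ I) (k : ℕ) (hβ : v s + k * v r < 2 ^ β) :
    CExec a x I β (transfer a r s k) v ip ()
      (Function.update (Function.update v r 0) s (v s + k * v r)) ip := by
  -- With `n` left in counter `r`, there have been `v r - n` rounds, each adding `k` to counter `s`.
  have := cexec_whileDec (a := a) (x := x) (β := β) (body := incN a s k) hr hr' hI (v r)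
    (fun n => Function.update (Function.update v r n) s (v s + k * (v r - n)))
    (fun n _ => by rw [Function.update_of_ne hrs, Function.update_self]) (fun n hn => ?_)
  · simp only [Nat.sub_self, mul_zero, add_zero, Nat.sub_zero, Function.update_eq_self] at this
    exact this
  · have h := cexec_incN (a := a) (x := x) (β := β) (ip := ip) (I := I) (v := Function.update
      (Function.update (Function.update v r (n + 1)) s (v s + k * (v r - (n + 1)))) r n) hs hs' hI k
    have e : v s + k * (v r - (n + 1)) + k = v s + k * (v r - n) := by
      obtain ⟨d, hd⟩ := Nat.exists_eq_add_of_lt hn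
      rw [hd, show n + d + 1 - (n + 1) = d by omega, show n + d + 1 - n = d + 1 by omega]
      ring
    rw [Function.update_of_ne hrs.symm, Function.update_self, e] at h
    convert h ?_ using 1
    · rw [Function.update_comm hrs.symm, Function.update_idem, Function.update_idem]
    · exact lt_of_le_of_lt (by gcongr; omega) hβ

/-- Counting down destroys counter `r`, so a second copy is made in `t` and moved back. -/
theorem cexec_copy (hr : 0 < r) (hr' : r < 8) (hs : 0 < s) (hs' : s < 8) (ht : 0 < t) (ht' : t < 8)
    (hrs : r ≠ s) (hrt : r ≠ t) (hst : s ≠ t) (hI : ip ≤ I) (hs0 : v s = 0) (ht0 : v t = 0)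
    (hβ : v r < 2 ^ β) :
    CExec a x I β (copy a r s t) v ip () (Function.update v s (v r)) ip := by
  have h1 := cexec_whileDec (a := a) (x := x) (β := β) (body := bind (inc a s) fun _ => inc a t)
    hr hr' hI (v r) (fun n => Function.update (Function.update (Function.update v r n) s (v r - n))
      t (v r - n))
    (fun n _ => by rw [Function.update_of_ne hrt, Function.update_of_ne hrs, Function.update_self])
    (fun n hn => ?_)
  · refine cexec_bind (e := ()) (ip' := ip)
      (v' := Function.update (Function.update (Function.update v r 0) s (v r)) t (v r)) ?_ ?_
    · convert h1 using 1
      funext n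
      by_cases hn : n = r <;> by_cases hn' : n = s <;> by_cases hn'' : n = t <;> simp_all
      simp
    · convert cexec_transfer ht ht' hr hr' hrt.symm hI 1 ?_ using 1
      · funext n
        by_cases hn : n = r <;> by_cases hn' : n = s <;> by_cases hn'' : n = t <;>
          simp_all
      · simpa [hrt, hrs] using hβ
  · refine cexec_bind (cexec_inc hs hs' hI ?_) ?_
    · simp [hrs.symm, hst]; omega
    · convert cexec_inc ht ht' hI ?_ using 1
      · funext n'
        by_cases hn : n' = r <;> by_cases hn' : n' = s <;> by_cases hn'' : n' = t <;>
          simp_all <;> omega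
      · simp [hrt.symm, hst.symm]; omega

theorem cexec_clear (hr : 0 < r) (hr' : r < 8) (hI : ip ≤ I) :
    CExec a x I β (whileDec a r (ret ())) v ip () (Function.update v r 0) ip := by
  have := cexec_whileDec (a := a) (x := x) (β := β) (body := ret ()) hr hr' hI (v r)
    (fun n => Function.update v r n) (fun n _ => by rw [Function.update_self]) (fun n hn => by
      simp only [Function.update_idem]; exact cexec_ret hI)
  simpa using this

/-- The old digits move up when the first transfer multiplies by `k + 1`; after the transfer back
the last digit is free for `c`. -/
theorem cexec_push (hr : 0 < r) (hr' : r < 8) (ht : 0 < t) (ht' : t < 8) (hrt : r ≠ t)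
    (hI : ip ≤ I) (ht0 : v t = 0) (k c : ℕ) (hβ : (k + 1) * v r + c < 2 ^ β) :
    CExec a x I β (push a k t r c) v ip () (Function.update v r ((k + 1) * v r + c)) ip := by
  refine cexec_bind (cexec_transfer hr hr' ht ht' hrt hI _ (by omega)) (cexec_bind
    (cexec_transfer ht ht' hr hr' hrt.symm hI 1 ?_) ?_)
  · simp [hrt, ht0]; omega
  · convert cexec_incN hr hr' hI c ?_ using 1
    · funext n
      by_cases hn : n = r <;> by_cases hn' : n = t <;>
          simp_all
    · simp [hrt, ht0]; omega

/-- The remainder is held in the finite control and runs cyclically; each wraparound contributes one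
to the quotient. Allowing an arbitrary initial remainder `d` makes the induction on the dividend
work. -/
theorem cexec_divide (hr : 0 < r) (hr' : r < 8) (ht : 0 < t) (ht' : t < 8) (hrt : r ≠ t)
    (hI : ip ≤ I) (k : ℕ) (d : Fin (k + 1)) (hβ : v t + (v r + d) < 2 ^ β) :
    CExec a x I β (divide a k t r d) v ip ⟨(v r + d) % (k + 1), Nat.mod_lt _ (Nat.succ_pos k)⟩
      (Function.update (Function.update v r 0) t (v t + (v r + d) / (k + 1))) ip := by
  obtain ⟨N, hN⟩ : ∃ N, v r = N := ⟨_, rfl⟩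
  induction N generalizing v d with
  | zero =>
    have := cexec_dec (a := a) (x := x) (β := β) (v := v) hr hr' hI
    rw [hN, decide_eq_false (by simp)] at this
    refine cexec_iter_exit (cexec_bind this ?_)
    rw [if_neg (by simp)]
    have e1 : (⟨(v r + d) % (k + 1), Nat.mod_lt _ (Nat.succ_pos k)⟩ : Fin (k + 1)) = d :=
      Fin.ext (by simp [hN, Nat.mod_eq_of_lt d.2])
    have e2 : Function.update (Function.update v r 0) t (v t + (v r + d) / (k + 1)) =
        Function.update v r (0 - 1) := by
      rw [hN, Nat.zero_add, Nat.div_eq_of_lt d.2]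
      funext n
      by_cases hn : n = r <;> by_cases hn' : n = t <;> simp_all
    rw [e1, e2]
    exact cexec_ret hI
  | succ N ih =>
    have := cexec_dec (a := a) (x := x) (β := β) (v := v) hr hr' hI
    rw [hN, decide_eq_true (by simp), Nat.add_sub_cancel] at this
    by_cases hd : d.val + 1 < k + 1
    · have h := ih (v := Function.update v r N) ⟨d.val + 1, hd⟩ (by
        simp [hrt.symm]; omega) (Function.update_self ..)
      refine cexec_iter_next (e' := ⟨d.val + 1, hd⟩) (v' := Function.update v r N) (ip' := ip)
        (cexec_bind this ?_) ?_
      · rw [if_pos rfl, dif_pos hd]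
        exact cexec_ret hI
      · convert h using 1
        · rfl
        · simp [hN, add_assoc, add_comm 1]
        · simp [hrt.symm, hN, add_assoc, add_comm 1]
    -- The remainder is maximal: one more unit resets it and carries into counter `t`.
    · have hdk : d.val = k := by omega
      have h := ih (v := Function.update (Function.update v r N) t (v t + 1)) 0 (by
        simp [hrt]; omega)
        (by simp [hrt])
      refine cexec_iter_next (e' := 0) (ip' := ip)
        (v' := Function.update (Function.update v r N) t (v t + 1)) (cexec_bind this ?_) ?_
      · rw [if_pos rfl, dif_neg hd]
        refine cexec_bind (cexec_inc ht ht' hI ?_) ?_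
        · simp [hrt.symm]; omega
        · rw [Function.update_of_ne hrt.symm]
          exact cexec_ret hI
      · have e : N + 1 + k = N + (k + 1) := by ring
        convert h using 1
        · rfl
        · simp [hN, hdk, e, hrt]
        · funext n
          by_cases hn : n = r <;> by_cases hn' : n = t <;>
            simp_all
          omega

theorem cexec_pop (hr : 0 < r) (hr' : r < 8) (ht : 0 < t) (ht' : t < 8) (hrt : r ≠ t)
    (hI : ip ≤ I) (ht0 : v t = 0) (k q : ℕ) (d : Fin (k + 1)) (hq : v r = (k + 1) * q + d)
    (hβ : v r < 2 ^ β) :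
    CExec a x I β (pop a k t r) v ip d (Function.update v r q) ip := by
  have h := cexec_divide (a := a) (x := x) (β := β) (v := v) hr hr' ht ht' hrt hI k 0 (by
    simpa [ht0] using hβ)
  have e1 : (v r + (0 : Fin (k + 1)).val) % (k + 1) = d := by
    simp [hq, Nat.mod_eq_of_lt d.2]
  have e2 : (v r + (0 : Fin (k + 1)).val) / (k + 1) = q := by
    simp [hq, Nat.mul_add_div, Nat.div_eq_of_lt d.2]
  simp only [e1, e2, ht0, Nat.zero_add] at h
  have hqv : q ≤ v r := by rw [hq]; nlinarith [Nat.zero_le (k * q), d.val.zero_le]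
  refine cexec_bind h (cexec_bind (cexec_transfer ht ht' hr hr' hrt.symm hI 1 ?_) ?_)
  · simp [hrt]; omega
  · convert cexec_ret hI using 1
    funext n
    by_cases hn : n = r <;> by_cases hn' : n = t <;>
      simp_all

end Prog

/-! ### Tapes as pairs of numbers -/

section Tape

variable {A : Type u}

theorem length_tapeWrite (y : List (TapeSym A)) (p : ℕ) (b : TapeSym A) :
    (tapeWrite y p b).length = max y.length (p + 1) := by
  simp [tapeWrite]; omega

theorem tapeRead_tapeWrite (y : List (TapeSym A)) (p : ℕ) (b : TapeSym A) (q : ℕ) :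
    tapeRead (tapeWrite y p b) q = if q = p then b else tapeRead y q := by
  unfold tapeRead tapeWrite
  rw [List.getD_eq_getElem?_getD, List.getD_eq_getElem?_getD, List.getElem?_set]
  by_cases h : q = p
  · subst h
    rw [if_pos rfl, if_pos rfl, if_pos (by simp; omega)]
    rfl
  · rw [if_neg (Ne.symm h), if_neg h]
    by_cases hq : q < y.length
    · rw [List.getElem?_append_left hq]
    · rw [List.getElem?_append_right (by omega), List.getElem?_eq_none (by omega : y.length ≤ q)]
      by_cases hq' : q - y.length < p + 1 - y.length
      · simp [hq']
      · simp [hq']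

theorem tapeRead_tapeWrite_eq (y : List (TapeSym A)) (p : ℕ) (b : TapeSym A) :
    tapeRead (tapeWrite y p b) = Function.update (tapeRead y) p b := by
  funext q
  rw [tapeRead_tapeWrite, Function.update_apply]

theorem tapeRead_tapeWrite_zero {y : List (TapeSym A)} {p : ℕ} {b : TapeSym A}
    (h : tapeRead y 0 = .marker) (hb : b = .marker ↔ tapeRead y p = .marker) :
    tapeRead (tapeWrite y p b) 0 = .marker := by
  rw [tapeRead_tapeWrite]
  split_ifs with h0
  · exact hb.2 (h0 ▸ h)
  · exact h

theorem tapeRead_inputTape_zero (w : List A) : tapeRead (inputTape w) 0 = .marker := rfl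

theorem tapeRead_inputTape_succ (w : List A) (i : ℕ) :
    tapeRead (inputTape w) (i + 1) = (w.map TapeSym.letter).getD i .blank := rfl

theorem tapeRead_inputTape_succ_ne (w : List A) (i : ℕ) :
    tapeRead (inputTape w) (i + 1) ≠ .marker := by
  rw [tapeRead_inputTape_succ, List.getD_eq_getElem?_getD, List.getElem?_map]
  cases w[i]? <;> simp

theorem tapeRead_inputTape_blank (w : List A) (i : ℕ) (h : w.length < i) :
    tapeRead (inputTape w) i = .blank := by
  obtain ⟨j, rfl⟩ := Nat.exists_eq_succ_of_ne_zero (by omega : i ≠ 0)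
  rw [tapeRead_inputTape_succ, List.getD_eq_default]
  simp; omega

variable {k : ℕ} (code : TapeSym A → Fin (k + 1))

/-- The cells from `p` on as a number in base `k + 1`, cell `p` being the last digit. -/
def rnum (y : List (TapeSym A)) (p : ℕ) : ℕ :=
  Nat.ofDigits (k + 1) ((y.drop p).map fun s => (code s : ℕ))

/-- The cells before `p` as a number in base `k + 1`, cell `p - 1` being the last digit. -/
def lnum (y : List (TapeSym A)) : ℕ → ℕ
  | 0 => 0
  | p + 1 => (k + 1) * lnum y p + code (tapeRead y p)

variable {code}

/-- Because the blank has code `0`, the cells beyond the end of the tape are leading zeros. The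
recursion thus holds at every position, and no tape length has to be stored. -/
theorem rnum_eq (h0 : code .blank = 0) (y : List (TapeSym A)) (p : ℕ) :
    rnum code y p = (k + 1) * rnum code y (p + 1) + code (tapeRead y p) := by
  unfold rnum tapeRead
  by_cases h : p < y.length
  · rw [List.drop_eq_getElem_cons h, List.map_cons, Nat.ofDigits_cons, add_comm,
      List.getD_eq_getElem _ _ h]
  · rw [List.drop_eq_nil_of_le (by omega), List.drop_eq_nil_of_le (by omega),
      List.getD_eq_default _ _ (by omega), h0]
    simp

/-- Writing changes cell `p` and pads at most up to it, so nothing to its right is affected. -/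
theorem rnum_tapeWrite (y : List (TapeSym A)) (p : ℕ) (b : TapeSym A) :
    rnum code (tapeWrite y p b) (p + 1) = rnum code y (p + 1) := by
  unfold rnum
  congr 2
  rw [tapeWrite, List.drop_set_of_lt (by omega)]
  by_cases h : p < y.length
  · rw [show p + 1 - y.length = 0 by omega]; simp
  · rw [List.drop_eq_nil_of_le (by simp; omega), List.drop_eq_nil_of_le (by omega)]

theorem lnum_congr {y z : List (TapeSym A)} {p : ℕ} (h : ∀ q < p, tapeRead y q = tapeRead z q) :
    lnum code y p = lnum code z p := by
  induction p with
  | zero => rfl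
  | succ p ih => rw [lnum, lnum, ih fun q hq => h q (by omega), h p (by omega)]

theorem lnum_tapeWrite (y : List (TapeSym A)) (p : ℕ) (b : TapeSym A) :
    lnum code (tapeWrite y p b) p = lnum code y p :=
  lnum_congr fun q hq => by rw [tapeRead_tapeWrite, if_neg (by omega)]

theorem digit_lt_pow {n a e : ℕ} (h : a < (k + 1) ^ e) (hn : n < k + 1) :
    (k + 1) * a + n < (k + 1) ^ (e + 1) := by
  have : (k + 1) * (a + 1) ≤ (k + 1) * (k + 1) ^ e := Nat.mul_le_mul_left _ h
  rw [pow_succ']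
  rw [mul_add] at this
  omega

theorem lnum_lt (y : List (TapeSym A)) (p : ℕ) : lnum code y p < (k + 1) ^ p := by
  induction p with
  | zero => simp [lnum]
  | succ p ih => exact digit_lt_pow ih (Fin.is_lt _)

theorem rnum_lt (y : List (TapeSym A)) (p : ℕ) : rnum code y p < (k + 1) ^ (y.length - p) := by
  rw [← List.length_drop, rnum]
  induction y.drop p with
  | nil => simp
  | cons s l ih =>
    rw [List.map_cons, Nat.ofDigits_cons, add_comm]
    exact digit_lt_pow ih (Fin.is_lt _)

end Tape

-- Reading, writing and moving on a tape stored in two counters.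

namespace Prog

variable {Λ : Type u} (a : Λ)

/-- On the tape with left part in counter `l` and right part in counter `r`, write the digit `c`
and move the cursor. -/
noncomputable def writeMove (k t l r c : ℕ) (d : Move) : Prog Λ Unit :=
  bind (pop a k t r) fun _ => bind (push a k t r c) fun _ =>
    match d with
    | .stay => ret ()
    | .right => bind (pop a k t r) fun e => push a k t l e
    | .left => bind (pop a k t l) fun e => push a k t r e

/-- Return the last digit of counter `r`. -/
noncomputable def peek (k t r : ℕ) : Prog Λ (Fin (k + 1)) :=
  bind (pop a k t r) fun d => bind (push a k t r d) fun _ => ret d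

variable {a} {x : ℕ → TapeSym Λ} {I β : ℕ} {v : ℕ → ℕ} {ip : ℕ} {l r t : ℕ}

variable {A : Type v} {k : ℕ} {code : TapeSym A → Fin (k + 1)}

theorem cexec_peek (h0 : code .blank = 0) (hr : 0 < r) (hr' : r < 8) (ht : 0 < t) (ht' : t < 8)
    (hrt : r ≠ t) (hI : ip ≤ I) (ht0 : v t = 0) (y : List (TapeSym A)) (p : ℕ)
    (hy : v r = rnum code y p) (hβ : (k + 1) ^ y.length ≤ 2 ^ β) :
    CExec a x I β (peek a k t r) v ip (code (tapeRead y p)) v ip := by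
  have hv : v r < 2 ^ β := by
    rw [hy]
    exact (rnum_lt y p).trans_le ((Nat.pow_le_pow_right (by omega) (Nat.sub_le _ _)).trans hβ)
  have hq := hy.trans (rnum_eq h0 y p)
  refine cexec_bind (cexec_pop hr hr' ht ht' hrt hI ht0 k _ _ hq hv) (cexec_bind
    (cexec_push hr hr' ht ht' hrt hI (by simp [hrt.symm, ht0]) k _ ?_) ?_)
  · rw [Function.update_self, ← hq]; exact hv
  · rw [Function.update_self, ← hq, Function.update_idem, Function.update_eq_self]
    exact cexec_ret hI

/-- The scanned cell is the last digit of the right part and is replaced by a pop and a push. A move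
then shifts one digit between the two parts. Every intermediate number has at most `max y.length (p
+ 1)` digits, the length of the tape after the write. -/
theorem cexec_writeMove (h0 : code .blank = 0) (hl : 0 < l) (hl' : l < 8) (hr : 0 < r) (hr' : r < 8)
    (ht : 0 < t) (ht' : t < 8) (hlr : l ≠ r) (hlt : l ≠ t) (hrt : r ≠ t) (hI : ip ≤ I)
    (ht0 : v t = 0) (y : List (TapeSym A)) (p : ℕ) (hyl : v l = lnum code y p)
    (hyr : v r = rnum code y p) (hβ : (k + 1) ^ (max y.length (p + 1)) ≤ 2 ^ β)
    (c : TapeSym A) (d : Move) (hd : d = .left → 0 < p) :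
    CExec a x I β (writeMove a k t l r (code c) d) v ip ()
      (Function.update (Function.update v l (lnum code (tapeWrite y p c) (d.apply p))) r
        (rnum code (tapeWrite y p c) (d.apply p))) ip := by
  set z := tapeWrite y p c with hz
  have hB : ∀ {n e : ℕ}, n < (k + 1) ^ e → e ≤ max y.length (p + 1) → n < 2 ^ β := fun h h' =>
    h.trans_le ((Nat.pow_le_pow_right (by omega) h').trans hβ)
  have hzl : z.length = max y.length (p + 1) := length_tapeWrite ..
  have hzr : rnum code z p = (k + 1) * rnum code y (p + 1) + code c := by
    rw [rnum_eq h0, rnum_tapeWrite, tapeRead_tapeWrite, if_pos rfl]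
  have hzl' : lnum code z p = lnum code y p := lnum_tapeWrite ..
  have hq := hyr.trans (rnum_eq h0 y p)
  have hv : v r < 2 ^ β := by rw [hyr]; exact hB (rnum_lt y p) (by omega)
  have hv' : rnum code z p < 2 ^ β := hB (rnum_lt z p) (by omega)
  refine cexec_bind (v' := Function.update v r (rnum code y (p + 1)))
    (cexec_pop hr hr' ht ht' hrt hI ht0 k _ _ hq hv) (cexec_bind (e := ()) (ip' := ip)
      (v' := Function.update v r (rnum code z p)) ?_ ?_)
  · convert cexec_push (v := Function.update v r (rnum code y (p + 1))) hr hr' ht ht' hrt hI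
      (by simp [hrt.symm, ht0]) k (code c) ?_ using 1
    · rw [Function.update_self, hzr, Function.update_idem]
    · rw [Function.update_self, ← hzr]; exact hv'
  · cases d with
    | stay =>
      simp only [Move.apply]
      rw [hzl', ← hyl, Function.update_eq_self]
      exact cexec_ret hI
    | right =>
      simp only [Move.apply]
      have e : lnum code z (p + 1) = (k + 1) * v l + code c := by
        rw [lnum, hzl', hyl, tapeRead_tapeWrite, if_pos rfl]
      refine cexec_bind (v' := Function.update v r (rnum code y (p + 1))) (ip' := ip) (e := code c)
        ?_ ?_
      · convert cexec_pop (v := Function.update v r (rnum code z p)) hr hr' ht ht' hrt hI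
          (by simp [hrt.symm, ht0]) k (rnum code y (p + 1))
          (code c) (by rw [Function.update_self, hzr]) (by rwa [Function.update_self]) using 1
        rw [Function.update_idem]
      · convert cexec_push (v := Function.update v r (rnum code y (p + 1))) hl hl' ht ht' hlt hI
          (by simp [hrt.symm, ht0]) k (code c) ?_ using 1
        · rw [Function.update_of_ne hlr, ← e, rnum_tapeWrite, Function.update_comm hlr]
        · rw [Function.update_of_ne hlr, ← e]
          exact hB (lnum_lt z _) (by omega)
    | left =>
      obtain ⟨p, rfl⟩ := Nat.exists_eq_succ_of_ne_zero (hd rfl).ne'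
      simp only [Move.apply, Nat.succ_eq_add_one, Nat.add_sub_cancel] at *
      have e : rnum code z p = (k + 1) * rnum code z (p + 1) + code (tapeRead y p) := by
        rw [rnum_eq h0, tapeRead_tapeWrite, if_neg (by omega)]
      have e' : lnum code z p = lnum code y p :=
        lnum_congr fun q hq => by rw [tapeRead_tapeWrite, if_neg (by omega)]
      refine cexec_bind (v' := Function.update (Function.update v r (rnum code z (p + 1))) l
        (lnum code y p)) (ip' := ip) (e := code (tapeRead y p)) ?_ ?_
      · refine cexec_pop hl hl' ht ht' hlt hI (by simp [hrt.symm, ht0]) k _ _ ?_ ?_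
        · rw [Function.update_of_ne hlr, hyl]; rfl
        · rw [Function.update_of_ne hlr, hyl]; exact hB (lnum_lt y _) (by omega)
      · convert cexec_push (v := Function.update (Function.update v r (rnum code z (p + 1))) l
          (lnum code y p)) hr hr' ht ht' hrt hI (by simp [hrt.symm, hlt.symm, ht0]) k
          (code (tapeRead y p)) ?_ using 1
        · rw [Function.update_of_ne hlr.symm, Function.update_self, ← e, e',
            Function.update_comm hlr, Function.update_comm hlr, Function.update_idem]
        · rw [Function.update_of_ne hlr.symm, Function.update_self, ← e]
          exact hB (rnum_lt z _) (by omega)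

end Prog

/-! ### Recomputing a letter of the output of a transducer -/

instance : Finite Move :=
  Finite.of_injective (fun d : Move => match d with
    | .left => (0 : Fin 3)
    | .stay => 1
    | .right => 2) (by intro a b; cases a <;> cases b <;> simp)

namespace Transducer

variable {Λ₁ : Type u} {Λ₂ : Type v} (N : Transducer Λ₁ Λ₂) {w : List Λ₁}

/-- The rules about the marker and the final blank confine the cursors. This makes the
configurations of `N` countable in terms of the tape length and limits the digits needed to store
its tape. -/
theorem reaches_invariant {C : N.Config} (h : N.Reaches w C) :
    tapeRead C.work 0 = .marker ∧ C.workPos ≤ C.work.length ∧ C.inputPos ≤ w.length + 1 := by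
  induction h with
  | refl => exact ⟨rfl, Nat.zero_le _, Nat.zero_le _⟩
  | @tail X _ _ h ih =>
    obtain ⟨h1, h2, h3⟩ := ih
    obtain ⟨t, ht, rfl⟩ := Option.map_eq_some_iff.1 h
    refine ⟨tapeRead_tapeWrite_zero h1 (N.δ_marker _ _ _ t ht), ?_, ?_⟩
    · simp only [length_tapeWrite]
      cases t.2.2.1
      · simp [Move.apply]; omega
      · simp [Move.apply]
      · simp [Move.apply]
    · simp only
      cases hd : t.2.1
      · simp [Move.apply]; omega
      · simpa [Move.apply] using h3
      · simp only [Move.apply]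
        by_contra hcon
        -- Leaving the allowed range would require a step to the right from the first blank.
        have hb := tapeRead_inputTape_blank w X.inputPos (by omega)
        exact N.δ_input_right _ _ t (hb ▸ ht) hd

end Transducer

/-- The counters `1, …, 6` with the given values. -/
def regs (i j ml mr nl nr : ℕ) : ℕ → ℕ
  | 1 => i
  | 2 => j
  | 3 => ml
  | 4 => mr
  | 5 => nl
  | 6 => nr
  | _ => 0

section

variable (i j ml mr nl nr y : ℕ)

theorem update_regs_one : Function.update (regs i j ml mr nl nr) 1 y = regs y j ml mr nl nr := by
  funext r; rcases r with _ | _ | _ | _ | _ | _ | _ | _ <;> rfl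

theorem update_regs_two : Function.update (regs i j ml mr nl nr) 2 y = regs i y ml mr nl nr := by
  funext r; rcases r with _ | _ | _ | _ | _ | _ | _ | _ <;> rfl

theorem update_regs_three : Function.update (regs i j ml mr nl nr) 3 y = regs i j y mr nl nr := by
  funext r; rcases r with _ | _ | _ | _ | _ | _ | _ | _ <;> rfl

theorem update_regs_four : Function.update (regs i j ml mr nl nr) 4 y = regs i j ml y nl nr := by
  funext r; rcases r with _ | _ | _ | _ | _ | _ | _ | _ <;> rfl

theorem update_regs_five : Function.update (regs i j ml mr nl nr) 5 y = regs i j ml mr y nr := by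
  funext r; rcases r with _ | _ | _ | _ | _ | _ | _ | _ <;> rfl

theorem update_regs_six : Function.update (regs i j ml mr nl nr) 6 y = regs i j ml mr nl y := by
  funext r; rcases r with _ | _ | _ | _ | _ | _ | _ | _ <;> rfl

end

namespace Prog

variable {Λ₁ : Type u} {Λ₂ : Type v} (a : Λ₁) (N : Transducer Λ₁ Λ₂) {kN kM : ℕ}
  (codeN : TapeSym N.Work → Fin (kN + 1)) (decN : Fin (kN + 1) → TapeSym N.Work)
  (codeM : TapeSym Λ₂ → Fin (kM + 1))

/-- The last part of `produceStep` below. -/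
noncomputable def produceCount (q : N.State) : Option (Fin (kM + 1)) →
    Prog Λ₁ (N.State ⊕ Fin (kM + 1))
  | none => ret (.inl q)
  | some s => bind (dec a 2) fun b => if b then ret (.inl q) else ret (.inr s)

/-- The part of `produceStep` below that executes a transition. -/
noncomputable def produceExec :
    Option (N.State × Move × Move × Fin (kN + 1) × Option (Fin (kM + 1))) →
    Prog Λ₁ (N.State ⊕ Fin (kM + 1))
  | none => ret (.inr (codeM .blank))
  | some t => bind (writeMove a kN 7 5 6 t.2.2.2.1 t.2.2.1) fun _ =>
      bind (moveInput t.2.1) fun _ => produceCount a N t.1 t.2.2.2.2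

/-- Simulate a step of the transducer. If it produces a letter and counter `2` is zero, then return
this letter. -/
noncomputable def produceStep (q : N.State) : Prog Λ₁ (N.State ⊕ Fin (kM + 1)) :=
  have := N.finite_state
  bind (peek a kN 7 6) fun c => bind (readInput fun α => (N.δ q α (decN c)).map fun t =>
    (t.1, t.2.1, t.2.2.1, codeN t.2.2.2.1, t.2.2.2.2.map fun o => codeM (.letter o)))
    (produceExec a N codeM)

/-- Simulate the transducer until it has produced as many further letters as counter `2` tells, and
return the letter produced next. -/
noncomputable def produce (q : N.State) : Prog Λ₁ (Fin (kM + 1)) :=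
  have := N.finite_state
  iter (produceStep a N codeN decN codeM) q

/-- Return the symbols scanned by the simulated machine: the letter of the output of the transducer
whose position is in counter `1`, and the last digit of counter `4`. -/
noncomputable def fetch : Prog Λ₁ (Fin (kM + 1) × Fin (kM + 1)) :=
  bind (copy a 1 2 7) fun _ => bind (dec a 2) fun b =>
    bind (if b then bind (incN a 6 (codeN .marker)) fun _ => produce a N codeN decN codeM N.init
      else ret (codeM .marker)) fun α =>
    bind (whileDec a 2 (ret ())) fun _ => bind (whileDec a 5 (ret ())) fun _ =>
    bind (whileDec a 6 (ret ())) fun _ => bind rewindInput fun _ =>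
    bind (peek a kM 7 4) fun β => ret (α, β)

variable {a N codeN decN codeM} {β I : ℕ} {w : List Λ₁}

/-- Backward induction from the halting configuration: `rest` is what `N` will still output from
`X`. A produced letter is either the requested one or uses up one unit of `j`. If `N` halts first,
the request points beyond the output and is answered by the blank. The final values of the counters
for `N` do not matter and are quantified away. -/
theorem cexec_produce (hN0 : codeN .blank = 0) (hdec : ∀ s, decN (codeN s) = s)
    (hI : w.length + 1 ≤ I)
    (hβ : ∀ C, N.Reaches w C → (kN + 1) ^ (C.work.length + 1) ≤ 2 ^ β) {Cf : N.Config}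
    (hf : N.step w Cf = none) (i ml mr : ℕ) {X : N.Config}
    (hX : Relation.ReflTransGen (fun C₁ C₂ => N.step w C₁ = some C₂) X Cf)
    (hXr : N.Reaches w X) :
    ∃ rest, Cf.output = X.output ++ rest ∧ ∀ j, ∃ j' nl' nr' ip', ip' ≤ I ∧
      CExec a (tapeRead (inputTape w)) I β (produce a N codeN decN codeM X.state)
        (regs i j ml mr (lnum codeN X.work X.workPos) (rnum codeN X.work X.workPos)) X.inputPos
        (codeM ((rest.map TapeSym.letter).getD j .blank)) (regs i j' ml mr nl' nr') ip' := by
  have := N.finite_state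
  have key : ∀ X : N.Config, N.Reaches w X → X.inputPos ≤ I ∧ ∀ j,
      CExec a (tapeRead (inputTape w)) I β (peek a kN 7 6)
        (regs i j ml mr (lnum codeN X.work X.workPos) (rnum codeN X.work X.workPos)) X.inputPos
        (codeN (tapeRead X.work X.workPos))
        (regs i j ml mr (lnum codeN X.work X.workPos) (rnum codeN X.work X.workPos))
        X.inputPos := by
    intro X hX
    obtain ⟨h1, h2, h3⟩ := N.reaches_invariant hX
    refine ⟨by omega, fun j => ?_⟩
    exact cexec_peek hN0 (by omega) (by omega) (by omega) (by omega) (by omega) (by omega) rfl _ _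
      rfl ((Nat.pow_le_pow_right (by omega) (by omega)).trans (hβ X hX))
  induction hX using Relation.ReflTransGen.head_induction_on with
  | refl =>
    refine ⟨[], by simp, fun j => ⟨j, lnum codeN Cf.work Cf.workPos,
      rnum codeN Cf.work Cf.workPos, Cf.inputPos, (key _ hXr).1,
      cexec_iter_exit (cexec_bind ((key _ hXr).2 j) (cexec_bind (cexec_readInput (key _ hXr).1) ?_))⟩⟩
    rw [hdec]
    have : N.δ Cf.state (tapeRead (inputTape w) Cf.inputPos) (tapeRead Cf.work Cf.workPos) = none :=
      Option.map_eq_none_iff.1 hf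
    rw [this]
    exact cexec_ret (key _ hXr).1
  | @head X Y hstep _ ih =>
    have hY : N.Reaches w Y := hXr.tail hstep
    obtain ⟨rest, h1, h2⟩ := ih hY
    obtain ⟨t, ht, hYt⟩ := Option.map_eq_some_iff.1 hstep
    obtain ⟨hm, hpos, hip⟩ := N.reaches_invariant hXr
    have hd' : t.2.2.1 = .left → 0 < X.workPos := by
      intro h
      by_contra h0
      rw [show X.workPos = 0 by omega, hm] at ht
      exact N.δ_work _ _ t ht h
    have hd : tapeRead (inputTape w) X.inputPos = .marker → t.2.1 ≠ .left := by
      intro h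
      rw [h] at ht
      exact N.δ_input_left _ _ t ht
    have hYI := (key _ hY).1
    -- the part of the body that is common to all cases
    have hwm : ∀ j, CExec a (tapeRead (inputTape w)) I β
        (writeMove a kN 7 5 6 (codeN t.2.2.2.1) t.2.2.1)
        (regs i j ml mr (lnum codeN X.work X.workPos) (rnum codeN X.work X.workPos)) X.inputPos ()
        (regs i j ml mr (lnum codeN Y.work Y.workPos) (rnum codeN Y.work Y.workPos))
        X.inputPos := by
      intro j
      have := cexec_writeMove (a := a) (x := tapeRead (inputTape w)) (I := I) (β := β)
        (ip := X.inputPos) (code := codeN) (l := 5) (r := 6) (t := 7)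
        (v := regs i j ml mr (lnum codeN X.work X.workPos) (rnum codeN X.work X.workPos)) hN0
        (by omega) (by omega) (by omega) (by omega) (by omega) (by omega) (by omega) (by omega)
        (by omega) (by omega) rfl X.work X.workPos rfl rfl
        ((Nat.pow_le_pow_right (by omega) (by omega)).trans (hβ X hXr)) t.2.2.2.1 t.2.2.1 hd'
      rw [update_regs_five, update_regs_six] at this
      rw [← hYt]
      exact this
    have hmi : ∀ v, CExec a (tapeRead (inputTape w)) I β (moveInput t.2.1) v X.inputPos () v
        Y.inputPos := by
      intro v
      rw [← hYt]
      exact cexec_moveInput (by omega) hd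
    have hst : Y.state = t.1 := by rw [← hYt]
    have hout : Y.output = X.output ++ t.2.2.2.2.toList := by rw [← hYt]
    have hread := fun v => cexec_readInput (a := a) (β := β) (v := v)
      (x := tapeRead (inputTape w)) (f := fun α =>
      (N.δ X.state α (decN (codeN (tapeRead X.work X.workPos)))).map fun t =>
      (t.1, t.2.1, t.2.2.1, codeN t.2.2.2.1, t.2.2.2.2.map fun o => codeM (.letter o)))
      (key _ hXr).1
    rw [hdec, ht, Option.map_some] at hread
    have hbody : ∀ {j r v'}, CExec a (tapeRead (inputTape w)) I β
        (produceCount a N Y.state (t.2.2.2.2.map fun o => codeM (.letter o)))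
        (regs i j ml mr (lnum codeN Y.work Y.workPos) (rnum codeN Y.work Y.workPos)) Y.inputPos r v'
          Y.inputPos →
        CExec a (tapeRead (inputTape w)) I β (produceStep a N codeN decN codeM X.state)
        (regs i j ml mr (lnum codeN X.work X.workPos) (rnum codeN X.work X.workPos)) X.inputPos r v'
          Y.inputPos := by
      intro j r v' h
      refine cexec_bind ((key _ hXr).2 j) ?_
      rw [hdec]
      refine cexec_bind (hread _) (cexec_bind (hwm j) (cexec_bind (hmi _) ?_))
      rw [← hst]
      exact h
    cases ho : t.2.2.2.2 with
    | none =>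
      rw [ho] at hout hbody
      refine ⟨rest, by simpa [hout] using h1, fun j => ?_⟩
      obtain ⟨j', nl', nr', ip', h3, h4⟩ := h2 j
      exact ⟨j', nl', nr', ip', h3, cexec_iter_next (hbody (cexec_ret hYI)) h4⟩
    | some o =>
      rw [ho] at hout hbody
      refine ⟨o :: rest, by simpa [hout] using h1, fun j => ?_⟩
      have hdecr := cexec_dec (a := a) (x := tapeRead (inputTape w)) (I := I) (β := β)
        (ip := Y.inputPos) (r := 2)
        (v := regs i j ml mr (lnum codeN Y.work Y.workPos) (rnum codeN Y.work Y.workPos))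
        (by omega) (by omega) hYI
      rw [update_regs_two] at hdecr
      cases j with
      | zero =>
        exact ⟨0 - 1, lnum codeN Y.work Y.workPos, rnum codeN Y.work Y.workPos, Y.inputPos, hYI,
          cexec_iter_exit (hbody (cexec_bind hdecr (cexec_ret hYI)))⟩
      | succ j =>
        obtain ⟨j', nl', nr', ip', h3, h4⟩ := h2 j
        exact ⟨j', nl', nr', ip', h3, cexec_iter_next (hbody (cexec_bind hdecr (cexec_ret hYI))) h4⟩

/-- Cell `i > 0` of the input of `M` holds letter number `i - 1`, whence the decrement of the copied
position. All scratch counters and the input cursor are reset, so that the representation survives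
and the next fetch starts from the same situation. -/
theorem cexec_fetch (hN0 : codeN .blank = 0) (hdec : ∀ s, decN (codeN s) = s)
    (hM0 : codeM .blank = 0) (hI : w.length + 1 ≤ I)
    (hβ : ∀ C, N.Reaches w C → (kN + 1) ^ (C.work.length + 1) ≤ 2 ^ β) {Cf : N.Config}
    (hf : N.step w Cf = none) (hCf : N.Reaches w Cf)
    (i ml : ℕ) (y : List (TapeSym Λ₂)) (p : ℕ) (hi : i < 2 ^ β) (hy : (kM + 1) ^ y.length ≤ 2 ^ β) :
    CExec a (tapeRead (inputTape w)) I β (fetch a N codeN decN codeM)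
      (regs i 0 ml (rnum codeM y p) 0 0) 0
      (codeM (tapeRead (inputTape Cf.output) i), codeM (tapeRead y p))
      (regs i 0 ml (rnum codeM y p) 0 0) 0 := by
  have h1 := cexec_copy (a := a) (x := tapeRead (inputTape w)) (I := I) (β := β) (ip := 0)
    (r := 1) (s := 2) (t := 7) (v := regs i 0 ml (rnum codeM y p) 0 0) (by omega) (by omega)
    (by omega) (by omega) (by omega) (by omega) (by omega) (by omega) (by omega) (by omega) rfl rfl
    hi
  rw [update_regs_two] at h1
  have h2 := cexec_dec (a := a) (x := tapeRead (inputTape w)) (I := I) (β := β) (ip := 0)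
    (r := 2) (v := regs i i ml (rnum codeM y p) 0 0) (by omega) (by omega) (by omega)
  rw [update_regs_two] at h2
  refine cexec_bind h1 (cexec_bind h2 ?_)
  -- Both ways of obtaining the input symbol may leave arbitrary values in counters `2`, `5`, `6`
  -- and any admissible cursor position; the cleanup handles them uniformly.
  suffices hsuf : ∃ j' nl' nr' ip', ip' ≤ I ∧ CExec a (tapeRead (inputTape w)) I β
      (if (decide (regs i i ml (rnum codeM y p) 0 0 2 ≠ 0)) then
        bind (incN a 6 (codeN .marker)) fun _ => produce a N codeN decN codeM N.init
      else ret (codeM .marker)) (regs i (i - 1) ml (rnum codeM y p) 0 0) 0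
      (codeM (tapeRead (inputTape Cf.output) i)) (regs i j' ml (rnum codeM y p) nl' nr') ip' by
    obtain ⟨j', nl', nr', ip', hip, h3⟩ := hsuf
    have h4 := cexec_clear (a := a) (x := tapeRead (inputTape w)) (I := I) (β := β) (ip := ip')
      (r := 2) (v := regs i j' ml (rnum codeM y p) nl' nr') (by omega) (by omega) hip
    have h5 := cexec_clear (a := a) (x := tapeRead (inputTape w)) (I := I) (β := β) (ip := ip')
      (r := 5) (v := regs i 0 ml (rnum codeM y p) nl' nr') (by omega) (by omega) hip
    have h6 := cexec_clear (a := a) (x := tapeRead (inputTape w)) (I := I) (β := β) (ip := ip')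
      (r := 6) (v := regs i 0 ml (rnum codeM y p) 0 nr') (by omega) (by omega) hip
    rw [update_regs_two] at h4
    rw [update_regs_five] at h5
    rw [update_regs_six] at h6
    refine cexec_bind h3 (cexec_bind h4 (cexec_bind h5 (cexec_bind h6 (cexec_bind
      (cexec_rewindInput hip rfl (tapeRead_inputTape_succ_ne w)) (cexec_bind
      (cexec_peek (v := regs i 0 ml (rnum codeM y p) 0 0) hM0 (by omega) (by omega) (by omega)
        (by omega) (by omega) (by omega) rfl y p rfl hy) (cexec_ret (by omega)))))))
  cases i with
  -- Cell `0` of the input tape is the marker, and `N` need not be run.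
  | zero => exact ⟨0, 0, 0, 0, by omega, cexec_ret (by omega)⟩
  | succ j =>
    have hm := hβ N.initial .refl
    have h3 := cexec_incN (a := a) (x := tapeRead (inputTape w)) (I := I) (β := β) (ip := 0)
      (r := 6) (v := regs (j + 1) j ml (rnum codeM y p) 0 0) (by omega) (by omega) (by omega)
      (codeN .marker) (by
        simp only [regs, Nat.zero_add]
        refine (codeN .marker).2.trans_le (le_trans ?_ hm)
        exact Nat.le_self_pow (by omega) _)
    rw [update_regs_six] at h3
    obtain ⟨rest, hr, h4⟩ := cexec_produce (a := a) (I := I) (β := β) (codeM := codeM) hN0 hdec hI hβ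
      hf (j + 1) ml (rnum codeM y p) hCf .refl
    obtain ⟨j', nl', nr', ip', hip, h5⟩ := h4 j
    refine ⟨j', nl', nr', ip', hip, cexec_bind h3 ?_⟩
    rw [tapeRead_inputTape_succ, hr]
    -- The initial tape of `N` is the marker alone, under the cursor: a one-digit right part and an
    -- empty left part.
    have e : rnum codeN N.initial.work N.initial.workPos =
        regs (j + 1) j ml (rnum codeM y p) 0 0 6 + codeN .marker := by
      simp [rnum, Transducer.initial, regs]
    rw [e] at h5
    exact h5

end Prog

/-! ### Sequences of deterministic steps -/

/-- `Trace r l x y`: there are steps of `r` from `x` to `y`, and `l` lists the elements before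
`y`. -/
inductive Trace {α : Type u} (r : α → α → Prop) : List α → α → α → Prop
  | nil (x : α) : Trace r [] x x
  | cons {x y z : α} {l : List α} : r x y → Trace r l y z → Trace r (x :: l) x z

namespace Trace

variable {α : Type u} {r : α → α → Prop}

theorem append {l l' : List α} {x y z : α} (h : Trace r l x y) (h' : Trace r l' y z) :
    Trace r (l ++ l') x z := by
  induction h with
  | nil => exact h'
  | cons h _ ih => exact .cons h (ih h')

/-- Determinism, plus the fact that both end points are stuck, forces the traces to coincide. This
later allows bounds obtained for one trace to be used for another. -/
theorem unique (hr : ∀ x y z, r x y → r x z → y = z) {l l' : List α} {x y y' : α}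
    (h : Trace r l x y) (h' : Trace r l' x y') (hy : ∀ z, ¬ r y z) (hy' : ∀ z, ¬ r y' z) :
    l = l' ∧ y = y' := by
  induction h generalizing l' with
  | nil =>
    cases h' with
    | nil => exact ⟨rfl, rfl⟩
    | cons h _ => exact (hy _ h).elim
  | cons h _ ih =>
    cases h' with
    | nil => exact (hy' _ h).elim
    | cons h1 h2 =>
      obtain rfl := hr _ _ _ h h1
      obtain ⟨rfl, rfl⟩ := ih h2 hy
      exact ⟨rfl, rfl⟩

theorem exists_suffix {l : List α} {x y z : α} (h : Trace r l x y) (hz : z ∈ l) :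
    ∃ l', Trace r l' z y ∧ l'.length ≤ l.length := by
  induction h with
  | nil => simp at hz
  | cons h h' ih =>
    rcases List.mem_cons.1 hz with rfl | hz
    · exact ⟨_, .cons h h', le_rfl⟩
    · obtain ⟨l', h1, h2⟩ := ih hz
      exact ⟨l', h1, by simp; omega⟩

theorem nodup (hr : ∀ x y z, r x y → r x z → y = z) {l : List α} {x y : α}
    (h : Trace r l x y) (hy : ∀ z, ¬ r y z) : l.Nodup := by
  induction h with
  | nil => exact List.nodup_nil
  | cons h h' ih =>
    refine List.nodup_cons.2 ⟨fun hm => ?_, ih hy⟩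
    -- A second visit to the same point would give a shorter trace from it to the same stuck end
    -- point, against uniqueness.
    obtain ⟨l', h1, h2⟩ := h'.exists_suffix hm
    have := (unique hr h1 (.cons h h') hy hy).1
    rw [this, List.length_cons] at h2
    omega

theorem forall_mem {l : List α} {x y : α} {P : α → Prop} (hP : ∀ x y, r x y → P x)
    (h : Trace r l x y) : ∀ z ∈ l, P z := by
  induction h with
  | nil => simp
  | cons h _ ih => exact List.forall_mem_cons.2 ⟨hP _ _ h, ih⟩

theorem map {γ : Type v} {s : γ → γ → Prop} (f : α → γ) (hf : ∀ x y, r x y → s (f x) (f y))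
    {l : List α} {x y : α} (h : Trace r l x y) : Trace s (l.map f) (f x) (f y) := by
  induction h with
  | nil => exact .nil _
  | cons h _ ih => exact .cons (hf _ _ h) ih

end Trace

-- Trees below a path.

namespace LTree

variable {L : Type u}

/-- Put a path above a tree. -/
def wrap (l : List L) (t : LTree L) : LTree L := l.foldr (fun a t => node a [t]) t

theorem wrap_cons (a : L) (l : List L) (t : LTree L) : wrap (a :: l) t = node a [wrap l t] := rfl

theorem nodes_wrap (l : List L) (t : LTree L) : (wrap l t).nodes = l ++ t.nodes := by
  induction l with
  | nil => rfl
  | cons a l ih => simp [wrap_cons, nodes_node, ih]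

theorem size_wrap (l : List L) (t : LTree L) : (wrap l t).size = l.length + t.size := by
  simp [size, nodes_wrap]

theorem leaves_wrap (l : List L) (t : LTree L) : (wrap l t).leaves = t.leaves := by
  induction l with
  | nil => rfl
  | cons a l ih => simp [wrap_cons, leaves_node, ih]

end LTree

-- Deterministic segments of runs, and paths without labelling nodes.

namespace ATO

variable {Λ : Type u} (M : ATO Λ)

/-- A deterministic step in a configuration without output. -/
def Det (C D : M.Config) : Prop :=
  C.state ∈ M.existential ∧ C.state ∉ M.labeling ∧ M.next C = {D}

variable {M}

theorem outputForest_wrap {l : List M.Config} (hl : ∀ C ∈ l, C.state ∉ M.labeling)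
    (t : LTree M.Config) : M.outputForest (.wrap l t) = M.outputForest t := by
  induction l with
  | nil => rfl
  | cons C l ih =>
    rw [LTree.wrap_cons, outputForest_not_labeling _ (hl C (by simp)), List.flatMap_singleton,
      ih fun C hC => hl C (by simp [hC])]

theorem not_universal_of_existential {s : M.State} (h : s ∈ M.existential) : s ∉ M.universal :=
  fun h' => (Set.disjoint_left.1 M.disjoint) h h'

theorem IsRun.exists_child {T : LTree M.Config} (hT : M.IsRun T) {D : M.Config}
    (h : T.root.state ∈ M.existential) (hD : M.next T.root = {D}) :
    ∃ t, T = .node T.root [t] ∧ M.IsRun t ∧ t.root = D := by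
  cases hT with
  | halt C h' =>
    have := M.not_halt_of_existential h
    exact (h'.elim this.1 this.2).elim
  | existential C t _ ht hr =>
    rw [show M.next C = {D} from hD] at ht
    exact ⟨t, rfl, hr, ht⟩
  | universal C ts h' => exact (not_universal_of_existential h h').elim

/-- Along a deterministic segment a run has no choice, so the segment can be stripped off. -/
theorem IsRun.exists_wrap {l : List M.Config} {D E : M.Config} (h : Trace M.Det l D E)
    {T : LTree M.Config} (hT : M.IsRun T) (hD : T.root = D) :
    ∃ t, T = .wrap l t ∧ M.IsRun t ∧ t.root = E := by
  induction h generalizing T with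
  | nil => exact ⟨T, rfl, hT, hD⟩
  | cons h _ ih =>
    subst hD
    obtain ⟨t, h1, h2, h3⟩ := hT.exists_child h.1 h.2.2
    obtain ⟨u, rfl, h5, h6⟩ := ih h2 h3
    exact ⟨u, h1, h5, h6⟩

theorem IsRun.wrap {l : List M.Config} {D E : M.Config} (h : Trace M.Det l D E)
    {t : LTree M.Config} (ht : M.IsRun t) (hE : t.root = E) :
    M.IsRun (.wrap l t) ∧ (LTree.wrap l t).root = D := by
  induction h with
  | nil => exact ⟨ht, hE⟩
  | cons h _ ih =>
    obtain ⟨h1, h2⟩ := ih hE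
    refine ⟨.existential _ _ h.1 ?_ h1, rfl⟩
    rw [h.2.2]
    exact h2

/-! ### Universal nodes on paths -/

open Classical in
variable (M) in
/-- Paths from the root without labelling nodes have at most `k` universal nodes. -/
def RootBound (k : ℕ) (T : LTree M.Config) : Prop :=
  ∀ p : List M.Config, T.RootPath p → (∀ C ∈ p, C.state ∉ M.labeling) →
    p.countP (fun C => decide (C.state ∈ M.universal)) ≤ k

open Classical in
variable (M) in
/-- Paths without labelling nodes have at most `k` universal nodes. -/
def PathBound (k : ℕ) (T : LTree M.Config) : Prop :=
  ∀ p : List M.Config, T.IsPath p → (∀ C ∈ p, C.state ∉ M.labeling) →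
    p.countP (fun C => decide (C.state ∈ M.universal)) ≤ k

variable {k : ℕ} {C : M.Config} {ts : List (LTree M.Config)}

theorem rootBound_labeling (h : C.state ∈ M.labeling) : M.RootBound k (.node C ts) := by
  intro p hp hl
  cases hp with
  | single => exact (hl C (by simp) h).elim
  | cons => exact (hl C (by simp) h).elim

theorem rootBound_node (h : C.state ∉ M.universal) (hts : ∀ t ∈ ts, M.RootBound k t) :
    M.RootBound k (.node C ts) := by
  intro p hp hl
  cases hp with
  | single => simp [h]
  | cons _ _ t p ht hp =>
    rw [List.countP_cons_of_neg (by simpa using h)]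
    exact hts t ht p hp fun D hD => hl D (by simp [hD])

theorem rootBound_node_succ (hts : ∀ t ∈ ts, M.RootBound k t) :
    M.RootBound (k + 1) (.node C ts) := by
  intro p hp hl
  cases hp with
  | single => rw [List.countP_cons]; simp; split_ifs <;> omega
  | cons _ _ t p ht hp =>
    rw [List.countP_cons]
    have := hts t ht p hp fun D hD => hl D (by simp [hD])
    split_ifs <;> omega

theorem RootBound.child (h : M.RootBound k (.node C ts)) (hC : C.state ∉ M.labeling) :
    ∀ t ∈ ts, M.RootBound k t := by
  intro t ht p hp hl
  have := h (C :: p) (.cons C ts t p ht hp) (List.forall_mem_cons.2 ⟨hC, hl⟩)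
  rw [List.countP_cons] at this
  omega

/-- The path consisting of the root alone already contains a universal node; hence `k` is positive
and the children have one less to spend. -/
theorem RootBound.child_universal (h : M.RootBound k (.node C ts)) (hC : C.state ∉ M.labeling)
    (hC' : C.state ∈ M.universal) : ∃ k', k = k' + 1 ∧ ∀ t ∈ ts, M.RootBound k' t := by
  have h0 := h [C] (.single C ts) (by simpa using hC)
  rw [List.countP_cons_of_pos (by simpa using hC')] at h0
  obtain ⟨k', rfl⟩ := Nat.exists_eq_add_of_le' (show 1 ≤ k by omega)
  refine ⟨k', rfl, fun t ht p hp hl => ?_⟩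
  have := h (C :: p) (.cons C ts t p ht hp) (List.forall_mem_cons.2 ⟨hC, hl⟩)
  rw [List.countP_cons_of_pos (by simpa using hC')] at this
  omega

theorem PathBound.rootBound {T : LTree M.Config} (h : M.PathBound k T) : M.RootBound k T :=
  fun p hp => h p (.here T p hp)

theorem PathBound.child (h : M.PathBound k (.node C ts)) : ∀ t ∈ ts, M.PathBound k t :=
  fun t ht p hp => h p (.inside C ts t p ht hp)

theorem pathBound_node (h : M.RootBound k (.node C ts)) (hts : ∀ t ∈ ts, M.PathBound k t) :
    M.PathBound k (.node C ts) := by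
  intro p hp hl
  cases hp with
  | here _ _ hp => exact h p hp hl
  | inside _ _ t p ht hp => exact hts t ht p hp hl

theorem RootBound.wrap {l : List M.Config} (hl : ∀ C ∈ l, C.state ∉ M.universal)
    {t : LTree M.Config} (h : M.RootBound k t) : M.RootBound k (.wrap l t) := by
  induction l with
  | nil => exact h
  | cons C l ih =>
    exact rootBound_node (hl C (by simp)) (List.forall_mem_singleton.2
      (ih fun C hC => hl C (by simp [hC])))

theorem PathBound.wrap {l : List M.Config} (hl : ∀ C ∈ l, C.state ∉ M.universal)
    {t : LTree M.Config} (h : M.PathBound k t) : M.PathBound k (.wrap l t) := by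
  induction l with
  | nil => exact h
  | cons C l ih =>
    have ih := ih fun C hC => hl C (by simp [hC])
    exact pathBound_node (rootBound_node (hl C (by simp))
      (List.forall_mem_singleton.2 ih.rootBound)) (List.forall_mem_singleton.2 ih)

end ATO

/-! ### Simulations between alternating machines -/

namespace ATO

variable {Λ₁ : Type u} {Λ₂ : Type v}

/-- `M'` simulates `M`: a step of `M` from `C` is simulated from `D` by deterministic steps, one
step that branches as `M` does, and further deterministic steps. The relation `R β C D` tells that
`D` represents `C` and that `D` has size at most `β`. Under the assumption `Q β` on the
configurations of `M` the intermediate configurations satisfy `B β`, and there are at most `K β` of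
them. -/
structure Simulation (M : ATO Λ₂) (M' : ATO Λ₁) (enc : List (TapeSym Λ₂) → List (TapeSym Λ₁))
    (R : ℕ → M.Config → M'.Config → Prop) (Q : ℕ → M.Config → Prop) (B : ℕ → M'.Config → Prop)
    (K : ℕ → ℕ) : Prop where
  labeling : ∀ {β C D}, R β C D → (D.state ∈ M'.labeling ↔ C.state ∈ M.labeling)
  label : ∀ {β C D}, R β C D → C.state ∈ M.labeling → D.label = enc C.label
  accept : ∀ {β C D}, R β C D → (D.state = M'.accept ↔ C.state = M.accept)
  reject : ∀ {β C D}, R β C D → (D.state = M'.reject ↔ C.state = M.reject)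
  bound : ∀ {β C D}, R β C D → Q β C → B β D
  step : ∀ {C D}, (∃ β, R β C D) → C.state ≠ M.accept → C.state ≠ M.reject →
    ∃ D₁ l E, ∃ Z : M.Config → M'.Config → Prop,
      D.state ∈ M'.existential ∧ M'.next D = {D₁} ∧ Trace M'.Det l D₁ E ∧
      E.state ∉ M'.labeling ∧ (E.state ∈ M'.existential ↔ C.state ∈ M.existential) ∧
      (E.state ∈ M'.universal ↔ C.state ∈ M.universal) ∧
      (∀ β, R β C D → Q β C → (∀ X ∈ l, B β X) ∧ B β E ∧ l.length ≤ K β) ∧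
      (∀ C₁ C₂ D', Z C₁ D' → Z C₂ D' → C₁ = C₂) ∧ (∀ C' D₁ D₂, Z C' D₁ → Z C' D₂ → D₁ = D₂) ∧
      (∀ C' ∈ M.next C, ∃ D', Z C' D') ∧ (∀ D' ∈ M'.next E, ∃ C', Z C' D') ∧
      ∀ C' D₂, Z C' D₂ → C' ∈ M.next C ∧ D₂ ∈ M'.next E ∧ ∃ l' D', Trace M'.Det l' D₂ D' ∧
        (∃ β, R β C' D') ∧ ∀ β, R β C D → Q β C → Q β C' →
          R β C' D' ∧ l'.length ≤ K β ∧ ∀ X ∈ l', B β X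

namespace Simulation

variable {M : ATO Λ₂} {M' : ATO Λ₁} {enc : List (TapeSym Λ₂) → List (TapeSym Λ₁)}
    {R : ℕ → M.Config → M'.Config → Prop} {Q : ℕ → M.Config → Prop} {B : ℕ → M'.Config → Prop}
    {K : ℕ → ℕ}

variable (enc R Q B K) in
/-- The facts that relate a run of `M` and the run of `M'` that simulates it. -/
structure Match (T : LTree M.Config) (T' : LTree M'.Config) : Prop where
  accepting : M'.IsAccepting T' ↔ M.IsAccepting T
  output : M'.outputForest T' = (M.outputForest T).map (LTree.map enc)
  bound : ∀ β, R β T.root T'.root → (∀ C ∈ T.nodes, Q β C) →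
    (∀ D ∈ T'.nodes, B β D) ∧ T'.size + K β ≤ (2 * K β + 2) * T.size
  rootBound : ∀ k, M.RootBound k T → M'.RootBound k T'
  pathBound : ∀ k, M.PathBound k T → M'.PathBound (k + 1) T'

variable (enc R Q B K) in
/-- The facts about the subtrees below a branching node. -/
def ChildMatch (C : M.Config) (D : M'.Config) (T : LTree M.Config) (T' : LTree M'.Config) : Prop :=
  ∃ l U, T' = .wrap l U ∧ Match enc R Q B K T U ∧ (∃ E, Trace M'.Det l E U.root) ∧
    ∀ β, R β C D → Q β C → Q β T.root →
      R β T.root U.root ∧ l.length ≤ K β ∧ ∀ X ∈ l, B β X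

theorem forall_mem_of_forall₂ {α : Type u} {γ : Type v} {P : α → γ → Prop} {p : α → Prop}
    {q : γ → Prop} (hpq : ∀ x y, P x y → p x → q y) {l : List α} {l' : List γ}
    (h : List.Forall₂ P l l') (hp : ∀ x ∈ l, p x) : ∀ y ∈ l', q y := by
  induction h with
  | nil => simp
  | cons h _ ih =>
    rw [List.forall_mem_cons] at hp ⊢
    exact ⟨hpq _ _ h hp.1, ih hp.2⟩

/-- Distinct successors must have distinct partners, because a universal node has one child for each
successor, without repetition. -/
theorem nodup_of_forall₂ {α : Type u} {γ : Type v} {P : α → γ → Prop}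
    (hP : ∀ x x' y, P x y → P x' y → x = x') {l : List α} {l' : List γ}
    (h : List.Forall₂ P l l') (hl : l.Nodup) : l'.Nodup := by
  induction h with
  | nil => simp
  | cons h h' ih =>
    rename_i x y l l'
    rw [List.nodup_cons] at hl ⊢
    refine ⟨fun hy => ?_, ih hl.2⟩
    exact forall_mem_of_forall₂ (p := (· ∈ l)) (q := (· ≠ y))
      (fun x' y' hp hx' hy' => hl.1 (hP _ _ _ h (hy' ▸ hp) ▸ hx')) h' (fun _ hx => hx) y hy rfl

theorem exists_forall₂ {α : Type u} {γ : Type v} {P : α → γ → Prop} {l : List α}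
    (h : ∀ x ∈ l, ∃ y, P x y) : ∃ l' : List γ, List.Forall₂ P l l' := by
  induction l with
  | nil => exact ⟨[], .nil⟩
  | cons x l ih =>
    rw [List.forall_mem_cons] at h
    obtain ⟨y, hy⟩ := h.1
    obtain ⟨l', hl'⟩ := ih h.2
    exact ⟨y :: l', .cons hy hl'⟩

theorem det_not_labeling {l : List M'.Config} {D E : M'.Config} (h : Trace M'.Det l D E) :
    ∀ X ∈ l, X.state ∉ M'.labeling := h.forall_mem fun _ _ h => h.2.1

theorem det_not_universal {l : List M'.Config} {D E : M'.Config} (h : Trace M'.Det l D E) :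
    ∀ X ∈ l, X.state ∉ M'.universal :=
  h.forall_mem fun _ _ h => not_universal_of_existential h.1

theorem isAccepting_node {C : M.Config} {ts : List (LTree M.Config)} (h : ts ≠ []) :
    M.IsAccepting (.node C ts) ↔ ∀ t ∈ ts, M.IsAccepting t := by
  simp only [IsAccepting, LTree.leaves_node _ _ h, List.mem_flatMap]
  exact ⟨fun h t ht C hC => h C ⟨t, ht, hC⟩, fun h C ⟨t, ht, hC⟩ => h t ht C hC⟩

theorem isAccepting_wrap {l : List M.Config} {t : LTree M.Config} :
    M.IsAccepting (.wrap l t) ↔ M.IsAccepting t := by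
  simp only [IsAccepting, LTree.leaves_wrap]

theorem match_halt (S : Simulation M M' enc R Q B K) {C : M.Config} {D : M'.Config}
    (hR : ∃ β, R β C D) (hC : C.state = M.accept ∨ C.state = M.reject) :
    Match enc R Q B K (.node C []) (.node D []) := by
  obtain ⟨β₀, hR⟩ := hR
  have hD : D.state = M'.accept ∨ D.state = M'.reject := by
    rwa [S.accept hR, S.reject hR]
  have hu : D.state ∉ M'.universal := fun h =>
    hD.elim (M'.not_halt_of_universal h).1 (M'.not_halt_of_universal h).2
  have hrb : ∀ k, M'.RootBound k (.node D []) := fun k => rootBound_node hu (by simp)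
  refine ⟨?_, ?_, ?_, fun k _ => hrb k, fun k _ => pathBound_node (hrb _) (by simp)⟩
  · simpa [IsAccepting, LTree.leaves] using S.accept hR
  · by_cases h : C.state ∈ M.labeling
    · rw [outputForest_labeling _ h, outputForest_labeling _ ((S.labeling hR).2 h), S.label hR h]
      simp [LTree.map, LTree.mapList]
    · rw [outputForest_not_labeling _ h, outputForest_not_labeling _ (mt (S.labeling hR).1 h)]
      simp
  · intro β hR hQ
    simp only [LTree.nodes_node, List.flatMap_nil, List.mem_singleton, forall_eq,
      LTree.size_node, List.map_nil, List.sum_nil] at *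
    exact ⟨S.bound hR hQ, by omega⟩

/-- The inductive step on trees, common to both directions of the transport. Only `D` and the images
of labelling descendants contribute to the output, and the order of children is kept, so the output
forests agree as lists. -/
theorem match_node (S : Simulation M M' enc R Q B K) {C : M.Config} {D D₁ E : M'.Config}
    {l : List M'.Config} (hR : ∃ β, R β C D) (hl : Trace M'.Det l D₁ E)
    (hDu : D.state ∈ M'.existential) (hE : E.state ∉ M'.labeling)
    (hEu : E.state ∈ M'.universal ↔ C.state ∈ M.universal)
    (hB : ∀ β, R β C D → Q β C → (∀ X ∈ l, B β X) ∧ B β E ∧ l.length ≤ K β)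
    {ts : List (LTree M.Config)} {ts' : List (LTree M'.Config)} (hts : ts ≠ [])
    (h : List.Forall₂ (ChildMatch enc R Q B K C D) ts ts') :
    Match enc R Q B K (.node C ts) (.node D [.wrap l (.node E ts')]) := by
  obtain ⟨β₀, hR⟩ := hR
  have hts' : ts' ≠ [] := by rintro rfl; cases h; exact hts rfl
  have hDu' := not_universal_of_existential hDu
  have hlu := det_not_universal hl
  have hroot : ∀ k t t', ChildMatch enc R Q B K C D t t' → M.RootBound k t →
      M'.RootBound k t' := by
    rintro k t t' ⟨l', U, rfl, hm, ⟨E', hE'⟩, -⟩ ht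
    exact (hm.rootBound k ht).wrap (det_not_universal hE')
  have hpath : ∀ k t t', ChildMatch enc R Q B K C D t t' → M.PathBound k t →
      M'.PathBound (k + 1) t' := by
    rintro k t t' ⟨l', U, rfl, hm, ⟨E', hE'⟩, -⟩ ht
    exact (hm.pathBound k ht).wrap (det_not_universal hE')
  have hrb : ∀ k, M.RootBound k (.node C ts) →
      M'.RootBound k (.node D [.wrap l (.node E ts')]) := by
    intro k hk
    -- A labelling root admits no label-free path from the root. Otherwise, of the nodes above the
    -- children, only `E` can be universal, and it takes the place of `C` in the count.
    by_cases hlab : C.state ∈ M.labeling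
    · exact rootBound_labeling ((S.labeling hR).2 hlab)
    refine rootBound_node hDu' (List.forall_mem_singleton.2 (RootBound.wrap hlu ?_))
    by_cases hu : C.state ∈ M.universal
    · obtain ⟨k', rfl, hk'⟩ := hk.child_universal hlab hu
      exact rootBound_node_succ (forall_mem_of_forall₂ (hroot k') h hk')
    · exact rootBound_node (mt hEu.1 hu) (forall_mem_of_forall₂ (hroot k) h (hk.child hlab))
  refine ⟨?_, ?_, ?_, hrb, ?_⟩
  · rw [isAccepting_node (by simp), List.forall_mem_singleton, isAccepting_wrap,
      isAccepting_node hts', isAccepting_node hts]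
    constructor
    · refine forall_mem_of_forall₂ (P := fun t' t => ChildMatch enc R Q B K C D t t') ?_ h.flip
      rintro t' t ⟨l', U, rfl, hm, -⟩ ht
      rw [← hm.accepting]; rwa [isAccepting_wrap] at ht
    · refine forall_mem_of_forall₂ ?_ h
      rintro t t' ⟨l', U, rfl, hm, -⟩ ht
      rw [isAccepting_wrap]; exact hm.accepting.2 ht
  · have hout : ts'.flatMap M'.outputForest =
        (ts.flatMap M.outputForest).map (LTree.map enc) := by
      clear hts hts' hrb
      induction h with
      | nil => rfl
      | cons h _ ih =>
        obtain ⟨l', U, rfl, hm, ⟨E', hE'⟩, -⟩ := h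
        rw [List.flatMap_cons, List.flatMap_cons, List.map_append, ih,
          outputForest_wrap (det_not_labeling hE'), hm.output]
    have hin : [LTree.wrap l (.node E ts')].flatMap M'.outputForest =
        (ts.flatMap M.outputForest).map (LTree.map enc) := by
      rw [List.flatMap_singleton, outputForest_wrap (det_not_labeling hl),
        outputForest_not_labeling _ hE, hout]
    by_cases hlab : C.state ∈ M.labeling
    · rw [outputForest_labeling _ hlab, outputForest_labeling _ ((S.labeling hR).2 hlab), hin,
        S.label hR hlab, List.map_singleton, LTree.map, LTree.mapList_eq]
    · rw [outputForest_not_labeling _ hlab, outputForest_not_labeling _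
        (mt (S.labeling hR).1 hlab), hin]
  · intro β hRβ hQ
    change R β C D at hRβ
    simp only [LTree.nodes_node, List.forall_mem_cons, List.forall_mem_flatMap] at hQ
    obtain ⟨hQC, hQ⟩ := hQ
    obtain ⟨hBl, hBE, hK⟩ := hB β hRβ hQC
    -- The surplus `K β` in the size bound for `U` pays for the segment `l'` above it.
    have hch : (∀ t' ∈ ts', ∀ X ∈ t'.nodes, B β X) ∧
        (ts'.map LTree.size).sum ≤ (2 * K β + 2) * (ts.map LTree.size).sum := by
      clear hts hts' hrb
      induction h with
      | nil => simp
      | cons h _ ih =>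
        rw [List.forall_mem_cons] at hQ
        obtain ⟨h1, h2⟩ := ih hQ.2
        obtain ⟨l', U, rfl, hm, -, hb⟩ := h
        obtain ⟨h3, h4, h5⟩ := hb β hRβ hQC (hQ.1 _ (LTree.root_mem_nodes _))
        obtain ⟨h6, h7⟩ := hm.bound β h3 hQ.1
        refine ⟨List.forall_mem_cons.2 ⟨?_, h1⟩, ?_⟩
        · rw [LTree.nodes_wrap]
          exact List.forall_mem_append.2 ⟨h5, h6⟩
        · simp only [List.map_cons, List.sum_cons, LTree.size_wrap, mul_add] at *
          omega
    refine ⟨?_, ?_⟩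
    · simp only [LTree.nodes_node, List.flatMap_singleton, LTree.nodes_wrap, List.forall_mem_cons,
        List.forall_mem_append, List.forall_mem_flatMap]
      exact ⟨S.bound hRβ hQC, hBl, hBE, hch.1⟩
    -- The nodes `D`, `E` and the segment `l` cost at most `K β + 2`; with the surplus `K β` to be
    -- kept for the parent this is `2 * K β + 2`.
    · simp only [LTree.size_node, LTree.size_wrap, List.map_singleton, List.sum_singleton, mul_add]
      have := hch.2
      omega
  · intro k hk
    have hch := forall_mem_of_forall₂ (hpath k) h hk.child
    -- The loss of one in the path bound: `E` is non-labelling even if `C` is labelling, so a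
    -- label-free path may start at a universal `E` whose original did not count.
    have hEk : M'.RootBound (k + 1) (.node E ts') :=
      rootBound_node_succ (forall_mem_of_forall₂ (hroot k) h fun t ht => (hk.child t ht).rootBound)
    have := (pathBound_node hEk hch).wrap hlu
    exact pathBound_node (rootBound_node hDu' (List.forall_mem_singleton.2 this.rootBound))
      (List.forall_mem_singleton.2 this)

/-- A run of `M` is simulated by a run of `M'`. -/
theorem exists_run (S : Simulation M M' enc R Q B K) {T : LTree M.Config} (hT : M.IsRun T) :
    ∀ D, (∃ β, R β T.root D) → ∃ T', M'.IsRun T' ∧ T'.root = D ∧ Match enc R Q B K T T' := by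
  induction hT with
  | halt C hC =>
    intro D hR
    refine ⟨_, .halt D ?_, rfl, S.match_halt hR hC⟩
    obtain ⟨β, hR⟩ := hR
    rwa [S.accept hR, S.reject hR]
  | existential C t hC ht hr ih =>
    intro D hR
    have hn := M.not_halt_of_existential hC
    obtain ⟨D₁, l, E, Z, h1, h2, h3, h4, h5, h6, h7, h8, h9, h10, h11, h12⟩ := S.step hR hn.1 hn.2
    obtain ⟨D₂, hZ⟩ := h10 _ ht
    obtain ⟨-, hD₂, l', D', h13, h14, h15⟩ := h12 _ _ hZ
    obtain ⟨U, hU, rfl, hm⟩ := ih D' h14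
    obtain ⟨hw, hw'⟩ := hU.wrap h13 rfl
    have hrun : M'.IsRun (.node E [.wrap l' U]) :=
      .existential E _ (h5.2 hC) (hw' ▸ hD₂) hw
    obtain ⟨hv, hv'⟩ := hrun.wrap h3 rfl
    refine ⟨_, .existential D _ h1 ?_ hv, rfl, S.match_node hR h3 h1 h4 h6 h7 (by simp)
      (.cons ⟨l', U, rfl, hm, ⟨_, h13⟩, h15⟩ .nil)⟩
    rw [h2, hv']
    rfl
  | universal C ts hC hts hnd hnext hr ih =>
    intro D hR
    have hn := M.not_halt_of_universal hC
    obtain ⟨D₁, l, E, Z, h1, h2, h3, h4, h5, h6, h7, h8, h9, h10, h11, h12⟩ := S.step hR hn.1 hn.2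
    have hex : ∀ t ∈ ts, ∃ t', Z t.root t'.root ∧ M'.IsRun t' ∧
        ChildMatch enc R Q B K C D t t' := by
      intro t ht
      obtain ⟨D₂, hZ⟩ := h10 _ ((hnext _).1 (List.mem_map_of_mem ht))
      obtain ⟨-, hD₂, l', D', h13, h14, h15⟩ := h12 _ _ hZ
      obtain ⟨U, hU, rfl, hm⟩ := ih t ht D' h14
      obtain ⟨hw, hw'⟩ := hU.wrap h13 rfl
      exact ⟨_, hw' ▸ hZ, hw, l', U, rfl, hm, ⟨_, h13⟩, h15⟩
    obtain ⟨ts', hts'⟩ := exists_forall₂ hex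
    have hZ : List.Forall₂ Z (ts.map LTree.root) (ts'.map LTree.root) := by
      rw [List.forall₂_map_left_iff, List.forall₂_map_right_iff]
      exact hts'.imp fun _ _ h => h.1
    have hrun : M'.IsRun (.node E ts') := by
      refine .universal E ts' (h6.2 hC) ?_ (nodup_of_forall₂ h8 hZ hnd) (fun D' => ⟨fun hD' => ?_,
        fun hD' => ?_⟩) ?_
      · rintro rfl; cases hts'; exact hts rfl
      · exact forall_mem_of_forall₂ (P := Z) (p := fun _ => True) (fun _ _ h _ => (h12 _ _ h).2.1) hZ
          (by simp) _ hD'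
      · obtain ⟨C', hC'⟩ := h11 _ hD'
        -- If `D'` were missing, then, `Z` being functional, no tree in `ts` could have its partner
        -- `C'` as root.
        by_contra hcon
        refine forall_mem_of_forall₂ (P := fun d c => Z c d) (p := (· ∈ ts'.map LTree.root))
          (q := (· ≠ C')) (fun d c h hd hc => ?_) hZ.flip (fun _ h => h) C'
          ((hnext _).2 (h12 _ _ hC').1) rfl
        rw [hc] at h
        exact hcon (h9 _ _ _ h hC' ▸ hd)
      · exact forall_mem_of_forall₂ (p := fun _ => True) (fun _ _ h _ => h.2.1) hts' (by simp)
    obtain ⟨hv, hv'⟩ := hrun.wrap h3 rfl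
    refine ⟨_, .existential D _ h1 ?_ hv, rfl, S.match_node hR h3 h1 h4 h6 h7 hts
      (hts'.imp fun _ _ h => h.2.2)⟩
    rw [h2, hv']
    rfl

/-- Every run of `M'` simulates a run of `M`. -/
theorem exists_run_of_run (S : Simulation M M' enc R Q B K) (n : ℕ) :
    ∀ T' : LTree M'.Config, T'.size ≤ n → M'.IsRun T' → ∀ C, (∃ β, R β C T'.root) →
      ∃ T, M.IsRun T ∧ T.root = C ∧ Match enc R Q B K T T' := by
  induction n with
  | zero =>
    intro T' hT'
    cases T' with
    | node a ts => rw [LTree.size_node] at hT'; omega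
  | succ n ih =>
    intro T' hsize hT' C hR
    by_cases hC : C.state = M.accept ∨ C.state = M.reject
    · refine ⟨.node C [], .halt C hC, rfl, ?_⟩
      have hD : T'.root.state = M'.accept ∨ T'.root.state = M'.reject := by
        obtain ⟨β, hR⟩ := hR
        rwa [S.accept hR, S.reject hR]
      cases hT' with
      | halt D _ => exact S.match_halt hR hC
      | existential D t h =>
        exact (hD.elim (M'.not_halt_of_existential h).1 (M'.not_halt_of_existential h).2).elim
      | universal D ts h =>
        exact (hD.elim (M'.not_halt_of_universal h).1 (M'.not_halt_of_universal h).2).elim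
    push Not at hC
    obtain ⟨D₁, l, E, Z, h1, h2, h3, h4, h5, h6, h7, h8, h9, h10, h11, h12⟩ := S.step hR hC.1 hC.2
    obtain ⟨t, ht, htr, rfl⟩ := hT'.exists_child h1 h2
    -- The recursive calls concern subtrees far below the root, after both deterministic segments;
    -- hence the induction on size.
    obtain ⟨u, rfl, hu, hE⟩ := htr.exists_wrap h3 rfl
    generalize T'.root = D at *
    subst ht
    rw [LTree.size_node, List.map_singleton, List.sum_singleton, LTree.size_wrap] at hsize
    have hchild : ∀ t', t'.size < n → M'.IsRun t' → t'.root ∈ M'.next E → ∃ t, Z t.root t'.root ∧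
        M.IsRun t ∧ ChildMatch enc R Q B K C D t t' := by
      intro t' hs ht' hroot
      obtain ⟨C', hZ⟩ := h11 _ hroot
      obtain ⟨-, -, l', D', h13, h14, h15⟩ := h12 _ _ hZ
      obtain ⟨U, rfl, hU, rfl⟩ := ht'.exists_wrap h13 rfl
      rw [LTree.size_wrap] at hs
      obtain ⟨t, ht, rfl, hm⟩ := ih U (by omega) hU C' h14
      exact ⟨t, hZ, ht, l', U, rfl, hm, ⟨_, h13⟩, h15⟩
    cases hu with
    | halt D' hD' =>
      simp only [LTree.root] at hE
      subst hE
      -- A halting `E` would be neither existential nor universal, and then `C` would be halting as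
      -- well.
      exfalso
      have h : D'.state ∉ M'.existential := fun h =>
        hD'.elim (M'.not_halt_of_existential h).1 (M'.not_halt_of_existential h).2
      have h' : D'.state ∉ M'.universal := fun h =>
        hD'.elim (M'.not_halt_of_universal h).1 (M'.not_halt_of_universal h).2
      exact (M.halt_of_not (mt h5.2 h) (mt h6.2 h')).elim hC.1 hC.2
    | existential D' t' hD' ht' hr' =>
      simp only [LTree.root] at hE
      subst hE
      rw [LTree.size_node, List.map_singleton, List.sum_singleton] at hsize
      obtain ⟨t, hZ, ht, hm⟩ := hchild t' (by omega) hr' ht'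
      exact ⟨.node C [t], .existential C t (h5.1 hD') (h12 _ _ hZ).1 ht, rfl,
        S.match_node hR h3 h1 h4 h6 h7 (by simp) (.cons hm .nil)⟩
    | universal D' ts' hD' hts hnd hnext hr' =>
      simp only [LTree.root] at hE
      subst hE
      rw [LTree.size_node] at hsize
      have hex : ∀ t' ∈ ts', ∃ t, Z t.root t'.root ∧ M.IsRun t ∧
          ChildMatch enc R Q B K C D t t' := by
        intro t' ht'
        have : t'.size ≤ (ts'.map LTree.size).sum :=
          List.single_le_sum (by simp) _ (List.mem_map_of_mem ht')
        exact hchild t' (by omega) (hr' t' ht') ((hnext _).1 (List.mem_map_of_mem ht'))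
      obtain ⟨ts, hts'⟩ := exists_forall₂ hex
      have hZ : List.Forall₂ (fun d c => Z c d) (ts'.map LTree.root) (ts.map LTree.root) := by
        rw [List.forall₂_map_left_iff, List.forall₂_map_right_iff]
        exact hts'.imp fun _ _ h => h.1
      have hne : ts ≠ [] := by rintro rfl; cases hts'; exact hts rfl
      refine ⟨.node C ts, .universal C ts (h6.1 hD') hne
        (nodup_of_forall₂ (P := fun d c => Z c d) (fun d d' c h h' => h9 _ _ _ h h') hZ hnd) (fun C' => ⟨fun hC' => ?_,
        fun hC' => ?_⟩) ?_, rfl, S.match_node hR h3 h1 h4 h6 h7 hne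
        (List.Forall₂.imp (fun _ _ h => h.2.2) hts').flip⟩
      · exact forall_mem_of_forall₂ (P := fun d c => Z c d) (p := fun _ => True) (fun _ _ h _ => (h12 _ _ h).1) hZ
          (by simp) _ hC'
      · obtain ⟨D', hD'⟩ := h10 _ hC'
        by_contra hcon
        refine forall_mem_of_forall₂ (P := Z) (p := (· ∈ ts.map LTree.root))
          (q := (· ≠ D')) (fun c d h hc hd => ?_) hZ.flip (fun _ h => h) D'
          ((hnext _).2 (h12 _ _ hD').2.1) rfl
        rw [hd] at h
        exact hcon (h8 _ _ _ h hD' ▸ hc)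
      · exact forall_mem_of_forall₂ (p := fun _ => True) (fun _ _ h _ => h.2.1) hts' (by simp)

end Simulation

end ATO

-- Equality of spans under a simulation.

namespace ATO

namespace Simulation

variable {Λ₁ : Type u} {Λ₂ : Type v} {M : ATO Λ₂} {M' : ATO Λ₁}
    {enc : List (TapeSym Λ₂) → List (TapeSym Λ₁)}
    {R : ℕ → M.Config → M'.Config → Prop} {Q : ℕ → M.Config → Prop} {B : ℕ → M'.Config → Prop}
    {K : ℕ → ℕ}

/-- Transport of runs in both directions identifies the valid outputs with the relabelled valid
outputs of `M`, and relabelling by an injective code is injective on unordered trees. -/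
theorem span_eq (S : Simulation M M' enc R Q B K) (henc : Function.Injective enc) {u : List Λ₂}
    {w : List Λ₁} (hR : ∃ β, R β (M.initial u) (M'.initial w)) : M'.span w = M.span u := by
  have hinj : Function.Injective (LTree.map enc) := by
    intro t t' h
    have := congrArg (LTree.map (Function.invFun enc)) h
    rwa [LTree.map_leftInverse (Function.leftInverse_invFun henc),
      LTree.map_leftInverse (Function.leftInverse_invFun henc)] at this
  have : M'.validOutputs w = UTree.map enc '' M.validOutputs u := by
    ext O
    constructor
    · rintro ⟨T', ⟨h1, h2⟩, h3, O', h4, rfl⟩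
      obtain ⟨T, hT, hr, hm⟩ := S.exists_run_of_run _ T' le_rfl h2 (M.initial u) (h1 ▸ hR)
      rw [hm.output] at h4
      obtain ⟨O'', h5, rfl⟩ := List.map_eq_singleton_iff.1 h4
      exact ⟨O''.toUTree, ⟨T, ⟨hr, hT⟩, hm.accepting.1 h3, O'', h5, rfl⟩, rfl⟩
    · rintro ⟨_, ⟨T, ⟨h1, h2⟩, h3, O', h4, rfl⟩, rfl⟩
      obtain ⟨T', hT', hr, hm⟩ := S.exists_run h2 (M'.initial w) (h1 ▸ hR)
      refine ⟨T', ⟨hr, hT'⟩, hm.accepting.2 h3, O'.map enc, ?_, rfl⟩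
      rw [hm.output, h4, List.map_singleton]
  rw [span, span, this, (UTree.map_injective henc).encard_image]

end Simulation

end ATO

/-! ### The machine that composes a machine with a transducer -/

/-- A machine `M`, a transducer `N` for its inputs, and codes for the symbols of both. -/
structure Reduction (Λ₁ : Type u) (Λ₂ : Type v) where
  a : Λ₁
  M : ATO Λ₂
  N : Transducer Λ₁ Λ₂
  init_ne_accept : M.init ≠ M.accept
  init_ne_reject : M.init ≠ M.reject
  kN : ℕ
  codeN : TapeSym N.Work → Fin (kN + 1)
  decN : Fin (kN + 1) → TapeSym N.Work
  codeN_blank : codeN .blank = 0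
  decN_codeN : ∀ s, decN (codeN s) = s
  kM : ℕ
  codeM : TapeSym Λ₂ → Fin (kM + 1)
  decM : Fin (kM + 1) → TapeSym Λ₂
  codeM_blank : codeM .blank = 0
  decM_codeM : ∀ s, decM (codeM s) = s

namespace Reduction

variable {Λ₁ : Type u} {Λ₂ : Type v} (r : Reduction Λ₁ Λ₂)

/-- The code of a symbol as a word. -/
def block (s : TapeSym Λ₂) : List (TapeSym Λ₁) :=
  List.ofFn fun i : Fin (r.kM + 1) => if i = r.codeM s then .marker else .blank

/-- The code of a word. -/
def encode (z : List (TapeSym Λ₂)) : List (TapeSym Λ₁) := z.flatMap r.block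

theorem block_injective : Function.Injective r.block := by
  intro s t h
  have h' := congrFun (List.ofFn_injective h) (r.codeM s)
  simp only [if_true] at h'
  have : r.codeM s = r.codeM t := by
    by_contra hne
    rw [if_neg hne] at h'
    cases h'
  rw [← r.decM_codeM s, this, r.decM_codeM]

theorem encode_append (z z' : List (TapeSym Λ₂)) :
    r.encode (z ++ z') = r.encode z ++ r.encode z' := List.flatMap_append

theorem length_encode (z : List (TapeSym Λ₂)) :
    (r.encode z).length = (r.kM + 1) * z.length := by
  simp [encode, block, mul_comm]

/-- All blocks have the same positive length, so a code word is cut into blocks in only one way. -/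
theorem encode_injective : Function.Injective r.encode := by
  intro z
  induction z with
  | nil =>
    intro z' h
    have := congrArg List.length h
    rw [length_encode, length_encode] at this
    simp only [List.length_nil, mul_zero] at this
    have h0 := (Nat.mul_eq_zero.1 this.symm).resolve_left (by omega)
    exact (List.length_eq_zero_iff.1 h0).symm
  | cons s z ih =>
    intro z' h
    cases z' with
    | nil =>
      have := congrArg List.length h
      rw [length_encode, length_encode] at this
      simp at this
    | cons s' z' =>
      obtain ⟨h1, h2⟩ := List.append_inj (s₁ := r.block s) (s₂ := r.block s')
        (t₁ := r.encode z) (t₂ := r.encode z') h (by simp [block])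
      rw [r.block_injective h1, ih h2]

/-- The program that computes the symbols scanned by `M`. -/
noncomputable def fetchProg : Prog Λ₁ (Fin (r.kM + 1) × Fin (r.kM + 1)) :=
  Prog.fetch r.a r.N r.codeN r.decN r.codeM

/-- The program that writes the representation of the initial configuration of `M`. -/
noncomputable def preProg : Prog Λ₁ Unit := Prog.incN r.a 4 (r.codeM .marker)

/-- Move the input cursor of `M`. -/
noncomputable def cursorProg : Move → Prog Λ₁ Unit
  | .stay => Prog.ret ()
  | .right => Prog.inc r.a 1
  | .left => Prog.bind (Prog.dec r.a 1) fun _ => Prog.ret ()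

/-- The program that executes a transition of `M`. -/
noncomputable def execProg (d d' : Move) (c : Fin (r.kM + 1)) : Prog Λ₁ Unit :=
  Prog.bind (Prog.writeMove r.a r.kM 7 3 4 c d') fun _ => r.cursorProg d

/-- The states of the composed machine. -/
inductive St : Type
  | node (s : r.M.State) : St
  | ini : St
  | choose (s : r.M.State) (x y : Fin (r.kM + 1)) : St
  | fetch (s : r.M.State) (l : r.fetchProg.Loc) : St
  | pre (l : r.preProg.Loc) : St
  | exec (s : r.M.State) (d d' : Move) (c : Fin (r.kM + 1)) (l : (r.execProg d d' c).Loc) : St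

namespace St

variable {r}

/-- Universal states of the composed machine. -/
def IsUniversal : r.St → Prop
  | choose s _ _ => s ∈ r.M.universal
  | _ => False

/-- Labelling states of the composed machine. -/
def IsLabeling : r.St → Prop
  | node s => s ∈ r.M.labeling
  | ini => True
  | _ => False

/-- States within one of the programs. -/
def IsProg : r.St → Prop
  | fetch _ _ => True
  | pre _ => True
  | exec _ _ _ _ _ => True
  | _ => False

end St

theorem finite_st : Finite r.St := by
  have := r.M.finite_state
  have := r.fetchProg.finite_loc
  have := r.preProg.finite_loc
  have := fun x : r.M.State × Move × Move × Fin (r.kM + 1) =>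
    (r.execProg x.2.1 x.2.2.1 x.2.2.2).finite_loc
  let f : (r.M.State ⊕ Unit ⊕ (r.M.State × Fin (r.kM + 1) × Fin (r.kM + 1)) ⊕
      (r.M.State × r.fetchProg.Loc) ⊕ r.preProg.Loc ⊕
      (Σ x : r.M.State × Move × Move × Fin (r.kM + 1),
        (r.execProg x.2.1 x.2.2.1 x.2.2.2).Loc)) → r.St
    | .inl s => .node s
    | .inr (.inl _) => .ini
    | .inr (.inr (.inl x)) => .choose x.1 x.2.1 x.2.2
    | .inr (.inr (.inr (.inl x))) => .fetch x.1 x.2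
    | .inr (.inr (.inr (.inr (.inl l)))) => .pre l
    | .inr (.inr (.inr (.inr (.inr x)))) => .exec x.1.1 x.1.2.1 x.1.2.2.1 x.1.2.2.2 x.2
  refine Finite.of_surjective f fun q => ?_
  cases q with
  | node s => exact ⟨.inl s, rfl⟩
  | ini => exact ⟨.inr (.inl ()), rfl⟩
  | choose s x y => exact ⟨.inr (.inr (.inl (s, x, y))), rfl⟩
  | fetch s l => exact ⟨.inr (.inr (.inr (.inl (s, l)))), rfl⟩
  | pre l => exact ⟨.inr (.inr (.inr (.inr (.inl l)))), rfl⟩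
  | exec s d d' c l => exact ⟨.inr (.inr (.inr (.inr (.inr ⟨(s, d, d', c), l⟩)))), rfl⟩

variable {r}

/-- Embedding of the control of `fetchProg`. -/
noncomputable def fetchEmb (s : r.M.State) : r.fetchProg.Loc ⊕ (Fin (r.kM + 1) × Fin (r.kM + 1)) → r.St :=
  Sum.elim (.fetch s) fun e => .choose s e.1 e.2

/-- Embedding of the control of `preProg`. -/
noncomputable def preEmb : r.preProg.Loc ⊕ Unit → r.St :=
  Sum.elim .pre fun _ => .fetch r.M.init r.fetchProg.entry

/-- Embedding of the control of `execProg`. -/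
noncomputable def execEmb (s : r.M.State) (d d' : Move) (c : Fin (r.kM + 1)) :
    (r.execProg d d' c).Loc ⊕ Unit → r.St :=
  Sum.elim (.exec s d d' c) fun _ => .node s

/-- A step of a program as a transition. -/
def liftStep {κ : Type} (emb : κ → r.St) (x : κ × Move × Move × TapeSym Λ₁) :
    r.St × Move × Move × TapeSym Λ₁ × List (TapeSym Λ₁) :=
  (emb x.1, x.2.1, x.2.2.1, x.2.2.2, [])

variable (r) in
/-- The transition of the composed machine that starts the execution of a transition of `M`. -/
noncomputable def startExec (β : TapeSym Λ₁) (t : r.M.State × Move × Move × TapeSym Λ₂ × List (TapeSym Λ₂)) :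
    r.St × Move × Move × TapeSym Λ₁ × List (TapeSym Λ₁) :=
  (.exec t.1 t.2.1 t.2.2.1 (r.codeM t.2.2.2.1) (r.execProg _ _ _).entry, .stay, .stay, β,
    r.encode t.2.2.2.2)

/-- The transitions of the composed machine. -/
noncomputable def trans : r.St → TapeSym Λ₁ → TapeSym Λ₁ →
    Set (r.St × Move × Move × TapeSym Λ₁ × List (TapeSym Λ₁))
  | .node s, _, β => {t | (s ≠ r.M.accept ∧ s ≠ r.M.reject) ∧
      t = (.fetch s r.fetchProg.entry, .stay, .stay, β, [])}
  | .ini, _, β => {(.pre r.preProg.entry, .stay, .stay, β, [])}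
  | .choose s x y, _, β => r.startExec β '' (r.M.δ s (r.decM x) (r.decM y))
  | .fetch s l, α, β => {liftStep (fetchEmb s) (r.fetchProg.step l α β)}
  | .pre l, α, β => {liftStep preEmb (r.preProg.step l α β)}
  | .exec s d d' c l, α, β => {liftStep (execEmb s d d' c) ((r.execProg d d' c).step l α β)}

theorem finite_trans (q : r.St) (α β : TapeSym Λ₁) : (trans q α β).Finite := by
  cases q with
  | node s => exact (Set.finite_singleton _).subset fun t ht => ht.2
  | choose s x y => exact (Finset.finite_toSet _).image _
  | _ => exact Set.finite_singleton _

theorem trans_input (q : r.St) (β : TapeSym Λ₁) : ∀ t ∈ trans q .marker β, t.2.1 ≠ .left := by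
  intro t ht
  cases q with
  | node s => obtain ⟨-, rfl⟩ := ht; simp
  | ini => obtain rfl := ht; simp
  | choose s x y => obtain ⟨t, -, rfl⟩ := ht; simp [startExec]
  | fetch s l => obtain rfl := ht; exact Prog.step_input _ _ _
  | pre l => obtain rfl := ht; exact Prog.step_input _ _ _
  | exec s d d' c l => obtain rfl := ht; exact Prog.step_input _ _ _

theorem trans_work (q : r.St) (α : TapeSym Λ₁) : ∀ t ∈ trans q α .marker, t.2.2.1 ≠ .left := by
  intro t ht
  cases q with
  | node s => obtain ⟨-, rfl⟩ := ht; simp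
  | ini => obtain rfl := ht; simp
  | choose s x y => obtain ⟨t, -, rfl⟩ := ht; simp [startExec]
  | fetch s l => obtain rfl := ht; exact Prog.step_work _ _ _
  | pre l => obtain rfl := ht; exact Prog.step_work _ _ _
  | exec s d d' c l => obtain rfl := ht; exact Prog.step_work _ _ _

theorem trans_marker (q : r.St) (α β : TapeSym Λ₁) :
    ∀ t ∈ trans q α β, (t.2.2.2.1 = .marker ↔ β = .marker) := by
  intro t ht
  cases q with
  | node s => obtain ⟨-, rfl⟩ := ht; simp
  | ini => obtain rfl := ht; simp
  | choose s x y => obtain ⟨t, -, rfl⟩ := ht; simp [startExec]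
  | fetch s l => obtain rfl := ht; exact Prog.step_marker _ _ _ _
  | pre l => obtain rfl := ht; exact Prog.step_marker _ _ _ _
  | exec s d d' c l => obtain rfl := ht; exact Prog.step_marker _ _ _ _

variable (r) in
/-- The composed machine: `M` on the output of `N`. -/
noncomputable def machine : ATO Λ₁ where
  State := r.St
  finite_state := r.finite_st
  init := .ini
  accept := .node r.M.accept
  reject := .node r.M.reject
  existential := {q | (q ≠ .node r.M.accept ∧ q ≠ .node r.M.reject) ∧ ¬ q.IsUniversal}
  universal := {q | q.IsUniversal}
  labeling := {q | q.IsLabeling}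
  disjoint := Set.disjoint_left.2 fun _ h h' => h.2 h'
  partition := by
    ext q
    simp only [Set.mem_union, Set.mem_ofPred_eq, Set.mem_compl_iff, Set.mem_insert_iff,
      Set.mem_singleton_iff, not_or]
    constructor
    · rintro (h | h)
      · exact h.1
      · cases q <;> simp_all [St.IsUniversal]
    · intro h
      by_cases hq : q.IsUniversal
      · exact .inr hq
      · exact .inl ⟨h, hq⟩
  init_labeling := trivial
  δ q α β := (finite_trans q α β).toFinset
  δ_accept α β := by ext t; simp [trans]
  δ_reject α β := by ext t; simp [trans]
  δ_input q β t ht := trans_input q β t ((Set.Finite.mem_toFinset _).1 ht)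
  δ_work q α t ht := trans_work q α t ((Set.Finite.mem_toFinset _).1 ht)
  δ_marker q α β t ht := trans_marker q α β t ((Set.Finite.mem_toFinset _).1 ht)

theorem mem_next {C D : r.machine.Config} : D ∈ r.machine.next C ↔
    ∃ t ∈ trans C.state (tapeRead C.input C.inputPos) (tapeRead C.work C.workPos),
      D = r.machine.move C t := by
  constructor
  · rintro ⟨t, ht, h⟩
    exact ⟨t, (Set.Finite.mem_toFinset _).1 ht, h⟩
  · rintro ⟨t, ht, h⟩
    exact ⟨t, (Set.Finite.mem_toFinset _).2 ht, h⟩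

theorem next_eq_singleton {C : r.machine.Config}
    {t : r.St × Move × Move × TapeSym Λ₁ × List (TapeSym Λ₁)}
    (h : trans C.state (tapeRead C.input C.inputPos) (tapeRead C.work C.workPos) = {t}) :
    r.machine.next C = {r.machine.move C t} := by
  ext D
  rw [mem_next, h]
  simp

theorem existential_of_isProg {q : r.St} (h : q.IsProg) : q ∈ r.machine.existential := by
  cases q <;> first | exact h.elim | exact ⟨⟨by simp, by simp⟩, id⟩

theorem not_labeling_of_isProg {q : r.St} (h : q.IsProg) : q ∉ r.machine.labeling := by
  cases q <;> first | exact h.elim | exact id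

variable (r) in
/-- The configuration `D` has state `q`, label `z` and memory `m`. -/
structure Holds (w : List Λ₁) (z : List (TapeSym Λ₁)) (S : ℕ) (D : r.machine.Config) (q : r.St)
    (m : Mem Λ₁) : Prop where
  state : D.state = q
  input : D.input = inputTape w
  label : D.label = z
  work : tapeRead D.work = m.tape
  inputPos : D.inputPos = m.ip
  workPos : D.workPos = m.wp
  length : D.work.length ≤ S + 1

variable (r) in
/-- The configuration `X` has label `z` and is bounded by `I` and `S`. -/
structure Bounded (w : List Λ₁) (z : List (TapeSym Λ₁)) (I S : ℕ) (X : r.machine.Config) :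
    Prop where
  input : X.input = inputTape w
  label : X.label = z
  length : X.work.length ≤ S + 1
  inputPos : X.inputPos ≤ I
  workPos : X.workPos ≤ S

variable (r) in
/-- A step of a program. -/
def PStep (C D : r.machine.Config) : Prop :=
  St.IsProg (r := r) C.state ∧ r.machine.next C = {D}

theorem PStep.det {C D : r.machine.Config} (h : r.PStep C D) : r.machine.Det C D :=
  ⟨existential_of_isProg h.1, not_labeling_of_isProg h.1, h.2⟩

theorem PStep.unique (C D D' : r.machine.Config) (h : r.PStep C D) (h' : r.PStep C D') :
    D = D' := Set.singleton_injective (h.2.symm.trans h'.2)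

theorem trace_det {l : List r.machine.Config} {C D : r.machine.Config} (h : Trace r.PStep l C D) :
    Trace r.machine.Det l C D := by
  have := h.map (s := r.machine.Det) id fun _ _ h => h.det
  rwa [List.map_id] at this

variable {w : List Λ₁} {z : List (TapeSym Λ₁)} {I S : ℕ}

/-- Program states are non-labelling and their transitions append nothing, so the label never
changes. Writing happens only in cells up to `S`, which keeps the tape length at most `S + 1`. -/
theorem exec_trace {ε : Type} (p : Prog Λ₁ ε) (emb : p.Loc ⊕ ε → r.St)
    (hemb : ∀ l, (emb (.inl l)).IsProg)
    (hδ : ∀ l α β, trans (emb (.inl l)) α β = {liftStep emb (p.step l α β)})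
    {m m' : Mem Λ₁} {e : ε} (h : p.Exec (tapeRead (inputTape w)) I S m e m')
    {D : r.machine.Config} (hD : r.Holds w z S D (emb (.inl p.entry)) m) :
    ∃ l D', Trace r.PStep l D D' ∧ r.Holds w z S D' (emb (.inr e)) m' ∧
      ∀ X ∈ l, r.Bounded w z I S X := by
  suffices H : ∀ c : (p.Loc ⊕ ε) × Mem Λ₁,
      Relation.ReflTransGen (p.Step (tapeRead (inputTape w)) I S) c (.inr e, m') →
      ∀ D : r.machine.Config, r.Holds w z S D (emb c.1) c.2 →
        ∃ l D', Trace r.PStep l D D' ∧ r.Holds w z S D' (emb (.inr e)) m' ∧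
          ∀ X ∈ l, r.Bounded w z I S X from H _ h D hD
  intro c hc
  induction hc using Relation.ReflTransGen.head_induction_on with
  | refl => exact fun D hD => ⟨[], D, .nil D, hD, by simp⟩
  | @head c c' hstep _ ih =>
    intro D hD
    obtain ⟨hI, hS, l₀, hl₀, rfl⟩ := hstep
    obtain ⟨c₀, m⟩ := c
    obtain rfl : c₀ = .inl l₀ := hl₀
    have hnext := next_eq_singleton (C := D) (by rw [hD.state]; exact hδ _ _ _)
    have hprog : St.IsProg (r := r) D.state := by rw [hD.state]; exact hemb l₀
    have hread : tapeRead D.input D.inputPos = tapeRead (inputTape w) m.ip := by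
      rw [hD.input, hD.inputPos]
    have hread' : tapeRead D.work D.workPos = m.tape m.wp := by rw [hD.work, hD.workPos]
    rw [hread, hread'] at hnext
    obtain ⟨l, D', h1, h2, h3⟩ := ih _ (show r.Holds w z S (r.machine.move D (liftStep emb
        (p.step l₀ (tapeRead (inputTape w) m.ip) (m.tape m.wp)))) _ _ from
      { state := rfl
        input := hD.input
        label := by
          have := not_labeling_of_isProg hprog
          exact ((if_neg this).trans (List.append_nil _)).trans hD.label
        work := by
          simp only [ATO.move, tapeRead_tapeWrite_eq, hD.work, hD.workPos]
          rfl
        inputPos := by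
          simp only [ATO.move, hD.inputPos]
          rfl
        workPos := by
          simp only [ATO.move, hD.workPos]
          rfl
        length := by
          simp only [ATO.move, length_tapeWrite, hD.workPos]
          have := hD.length
          simp only at hS
          omega })
    refine ⟨D :: l, D', .cons ⟨hprog, hnext⟩ h1, h2, List.forall_mem_cons.2 ⟨?_, h3⟩⟩
    exact ⟨hD.input, hD.label, hD.length, hD.inputPos ▸ hI, hD.workPos ▸ hS⟩

end Reduction

/-! ### The composed machine simulates -/

/-- A list of length at most `L` is determined by its `L` optional entries. Up to these bounds there
are only finitely many configurations, and a list without repetition cannot exceed their number. -/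
theorem List.Nodup.length_le_of_bounded {Q : Type u} {A : Type v} [Finite Q] [Finite A] {L I P : ℕ}
    {l : List (Q × List A × ℕ × ℕ)} (hl : l.Nodup)
    (h : ∀ x ∈ l, x.2.1.length ≤ L ∧ x.2.2.1 ≤ I ∧ x.2.2.2 ≤ P) :
    l.length ≤ Nat.card Q * ((Nat.card A + 1) ^ L * ((I + 1) * (P + 1))) := by
  classical
  have := Fintype.ofFinite Q
  have := Fintype.ofFinite A
  let g : Q × List A × ℕ × ℕ → Q × (Fin L → Option A) × Fin (I + 1) × Fin (P + 1) := fun x =>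
    (x.1, fun i => x.2.1[(i : ℕ)]?, Fin.ofNat _ x.2.2.1, Fin.ofNat _ x.2.2.2)
  have hg : (l.map g).Nodup := by
    refine hl.map_on fun x hx y hy hxy => ?_
    obtain ⟨x1, x2, x3, x4⟩ := x
    obtain ⟨y1, y2, y3, y4⟩ := y
    obtain ⟨hx2, hx3, hx4⟩ := h _ hx
    obtain ⟨hy2, hy3, hy4⟩ := h _ hy
    simp only [g, Prod.mk.injEq] at hxy hx2 hx3 hx4 hy2 hy3 hy4
    obtain ⟨h1, h2, h3, h4⟩ := hxy
    have h3 := congrArg Fin.val h3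
    have h4 := congrArg Fin.val h4
    simp only [Fin.val_ofNat] at h3 h4
    rw [Nat.mod_eq_of_lt (by omega), Nat.mod_eq_of_lt (by omega)] at h3 h4
    have h2 : x2 = y2 := List.ext_getElem? fun i => by
      by_cases hi : i < L
      · exact congrFun h2 ⟨i, hi⟩
      · rw [List.getElem?_eq_none (by omega), List.getElem?_eq_none (by omega)]
    rw [h1, h2, h3, h4]
  have := hg.length_le_card
  rw [List.length_map] at this
  simpa [Nat.card_eq_fintype_card] using this

theorem finite_tapeSym (Λ : Type u) [Finite Λ] : Finite (TapeSym Λ) :=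
  Finite.of_surjective (fun x : Option (Option Λ) => match x with
    | none => TapeSym.blank
    | some none => .marker
    | some (some a) => .letter a) fun x => by
      cases x with
      | blank => exact ⟨none, rfl⟩
      | marker => exact ⟨some none, rfl⟩
      | letter a => exact ⟨some (some a), rfl⟩

namespace Move

/-- At position `0` moving left and staying have the same effect because subtraction is truncated;
the hypotheses exclude this collision. -/
theorem apply_injective {d d' : Move} {p : ℕ} (hd : d = .left → 0 < p) (hd' : d' = .left → 0 < p)
    (h : d.apply p = d'.apply p) : d = d' := by
  cases d <;> cases d' <;> simp only [apply, reduceCtorEq, false_imp_iff, true_imp_iff] at * <;>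
    omega

end Move

-- Legal configurations, and transitions determined by their effect.

namespace ATO

variable {Λ : Type u} (M : ATO Λ)

/-- An invariant of the configurations on input `u`. -/
structure Invariant (u : List Λ) (C : M.Config) : Prop where
  input : C.input = inputTape u
  marker : tapeRead C.work 0 = .marker
  workPos : C.workPos ≤ C.work.length

variable {M} {u : List Λ} {C : M.Config}

theorem invariant_initial : M.Invariant u (M.initial u) := ⟨rfl, rfl, Nat.zero_le _⟩

theorem Invariant.input_left (h : M.Invariant u C)
    {t : M.State × Move × Move × TapeSym Λ × List (TapeSym Λ)}
    (ht : t ∈ M.δ C.state (tapeRead C.input C.inputPos) (tapeRead C.work C.workPos))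
    (hd : t.2.1 = .left) : 0 < C.inputPos := by
  by_contra h0
  rw [show C.inputPos = 0 by omega, h.input, tapeRead_inputTape_zero] at ht
  exact M.δ_input _ _ t ht hd

theorem Invariant.work_left (h : M.Invariant u C)
    {t : M.State × Move × Move × TapeSym Λ × List (TapeSym Λ)}
    (ht : t ∈ M.δ C.state (tapeRead C.input C.inputPos) (tapeRead C.work C.workPos))
    (hd : t.2.2.1 = .left) : 0 < C.workPos := by
  by_contra h0
  rw [show C.workPos = 0 by omega, h.marker] at ht
  exact M.δ_work _ _ t ht hd

theorem Invariant.move (h : M.Invariant u C)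
    {t : M.State × Move × Move × TapeSym Λ × List (TapeSym Λ)}
    (ht : t ∈ M.δ C.state (tapeRead C.input C.inputPos) (tapeRead C.work C.workPos)) :
    M.Invariant u (M.move C t) where
  input := h.input
  marker := tapeRead_tapeWrite_zero h.marker (M.δ_marker _ _ _ t ht)
  workPos := by
    have := h.workPos
    simp only [ATO.move, length_tapeWrite]
    cases t.2.2.1 <;> simp only [Move.apply] <;> omega

/-- All components of a transition can be read off from the new configuration: the written symbol
from the old cursor cell, the moves because they are legal, the output word by cancelling the old
label. Successors of `C` thus correspond to transitions. -/
theorem Invariant.move_injective (h : M.Invariant u C)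
    {t t' : M.State × Move × Move × TapeSym Λ × List (TapeSym Λ)}
    (ht : t ∈ M.δ C.state (tapeRead C.input C.inputPos) (tapeRead C.work C.workPos))
    (ht' : t' ∈ M.δ C.state (tapeRead C.input C.inputPos) (tapeRead C.work C.workPos))
    (heq : M.move C t = M.move C t') : t = t' := by
  obtain ⟨h1, -, h3, h4, h5, h6⟩ := Config.mk.inj heq
  have e2 := Move.apply_injective (h.input_left ht) (h.input_left ht') h5
  have e3 := Move.apply_injective (h.work_left ht) (h.work_left ht') h6
  have e4 : t.2.2.2.1 = t'.2.2.2.1 := by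
    have := congrArg (fun y => tapeRead y C.workPos) h3
    simpa only [tapeRead_tapeWrite, if_true] using this
  have e5 : t.2.2.2.2 = t'.2.2.2.2 := by
    split_ifs at h4
    · exact h4
    · exact List.append_cancel_left h4
  obtain ⟨t1, t2, t3, t4, t5⟩ := t
  obtain ⟨t1', t2', t3', t4', t5'⟩ := t'
  simp only at h1 e2 e3 e4 e5
  rw [h1, e2, e3, e4, e5]

end ATO

-- Configurations of the given machine as counter values.

namespace Reduction

variable {Λ₁ : Type u} {Λ₂ : Type v} {r : Reduction Λ₁ Λ₂}

variable (r) in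
/-- The configuration `D` has state `q`, label `z` and counters `v`, bounded by `2 ^ β`. -/
def Stores (w : List Λ₁) (z : List (TapeSym Λ₁)) (β : ℕ) (D : r.machine.Config) (q : r.St)
    (v : ℕ → ℕ) : Prop :=
  ∃ m ≤ β, (∀ i, v i < 2 ^ m) ∧
    r.Holds w z (8 * β + 16) D q ⟨ctape r.a (Function.update v 0 (2 ^ m - 1)), 0, 0⟩

variable {w : List Λ₁} {z : List (TapeSym Λ₁)} {I β : ℕ} {D : r.machine.Config} {q : r.St}
    {v : ℕ → ℕ}

theorem Stores.mono (h : r.Stores w z β D q v) {β' : ℕ} (hβ : β ≤ β') :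
    r.Stores w z β' D q v := by
  obtain ⟨m, hm, hv, h⟩ := h
  exact ⟨m, hm.trans hβ, hv, { h with length := h.length.trans (by omega) }⟩

theorem Stores.state_eq (h : r.Stores w z β D q v) : D.state = q := by
  obtain ⟨m, hm, hv, h⟩ := h
  exact h.state

theorem Stores.label_eq (h : r.Stores w z β D q v) : D.label = z := by
  obtain ⟨m, hm, hv, h⟩ := h
  exact h.label

theorem Stores.length_le (h : r.Stores w z β D q v) : D.work.length ≤ 8 * β + 17 := by
  obtain ⟨m, hm, hv, h⟩ := h
  exact h.length

theorem Stores.stay (h : r.Stores w z β D q v) (q' : r.St) (z' : List (TapeSym Λ₁))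
    {z'' : List (TapeSym Λ₁)}
    (h1 : D.state ∈ r.machine.labeling → z'' = z')
    (h2 : D.state ∉ r.machine.labeling → z'' = z ++ z') :
    r.Stores w z'' β
      (r.machine.move D (q', .stay, .stay, tapeRead D.work D.workPos, z')) q' v := by
  obtain ⟨m, hm, hv, h⟩ := h
  refine ⟨m, hm, hv, ⟨rfl, h.input, ?_, ?_, h.inputPos, h.workPos, ?_⟩⟩
  · by_cases hD : D.state ∈ r.machine.labeling
    · exact (if_pos hD).trans (h1 hD).symm
    · refine (if_neg hD).trans ?_
      rw [h2 hD, h.label]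
  · simp only [ATO.move, tapeRead_tapeWrite_eq, Function.update_eq_self]
    exact h.work
  · simp only [ATO.move, length_tapeWrite, h.workPos]
    have := h.length
    omega

theorem stores_trace {ε : Type} {p : Prog Λ₁ ε} {emb : p.Loc ⊕ ε → r.St}
    (hemb : ∀ l, (emb (.inl l)).IsProg)
    (hδ : ∀ l α β, trans (emb (.inl l)) α β = {liftStep emb (p.step l α β)})
    {v' : ℕ → ℕ} {e : ε} (h : Prog.CExec r.a (tapeRead (inputTape w)) I β p v 0 e v' 0)
    (hD : r.Stores w z β D (emb (.inl p.entry)) v) :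
    ∃ l D', Trace r.PStep l D D' ∧ r.Stores w z β D' (emb (.inr e)) v' ∧
      ∀ X ∈ l, r.Bounded w z I (8 * β + 16) X := by
  obtain ⟨m, hm, hv, hD⟩ := hD
  obtain ⟨m', hm', hv', h⟩ := h m hm hv
  obtain ⟨l, D', h1, h2, h3⟩ := exec_trace p emb hemb hδ h hD
  exact ⟨l, D', h1, ⟨m', hm', hv', h2⟩, h3⟩

variable (r) in
/-- The counters that represent a configuration of the simulated machine. -/
def vec (C : r.M.Config) : ℕ → ℕ :=
  regs C.inputPos 0 (lnum r.codeM C.work C.workPos) (rnum r.codeM C.work C.workPos) 0 0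

variable (r) in
/-- The configuration `D` represents `C`. -/
def Rel (w : List Λ₁) (u : List Λ₂) (β : ℕ) (C : r.M.Config) (D : r.machine.Config) : Prop :=
  r.M.Invariant u C ∧ (r.Stores w (r.encode C.label) β D (.node C.state) (r.vec C) ∨
    C = r.M.initial u ∧ r.Stores w [] β D .ini fun _ => 0)

variable (r) in
/-- The bound `β` suffices for the simulation of a step from `C`. -/
structure Suffices (w : List Λ₁) (β : ℕ) (C : r.M.Config) : Prop where
  inputPos : C.inputPos + 1 < 2 ^ β
  work : (r.kM + 1) ^ (C.work.length + 2) ≤ 2 ^ β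
  label : C.label.length ≤ β
  transducer : ∀ X, r.N.Reaches w X → (r.kN + 1) ^ (X.work.length + 1) ≤ 2 ^ β

variable (r) in
/-- The bound on the configurations of the composed machine. -/
def Small (β : ℕ) (X : r.machine.Config) : Prop :=
  X.work.length ≤ 8 * β + 17 ∧ X.label.length ≤ (r.kM + 1) * β

variable (r) in
/-- The bound on the number of steps of a program. -/
noncomputable def steps (w : List Λ₁) (β : ℕ) : ℕ :=
  Nat.card r.St * ((Nat.card (TapeSym Λ₁) + 1) ^ (8 * β + 17) * ((w.length + 2) * (8 * β + 17)))

open Classical in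
variable (r) in
/-- The label during the simulation of a step from `C`. -/
noncomputable def restLabel (C : r.M.Config) : List (TapeSym Λ₁) :=
  if C.state ∈ r.M.labeling then [] else r.encode C.label

/-- A labelling state erases the label when it is left. The composed machine does this in its first
step, and appends the new word only when it branches. -/
theorem restLabel_append (C : r.M.Config)
    (t : r.M.State × Move × Move × TapeSym Λ₂ × List (TapeSym Λ₂)) :
    r.restLabel C ++ r.encode t.2.2.2.2 = r.encode (r.M.move C t).label := by
  unfold restLabel ATO.move
  split_ifs
  · rfl
  · exact (r.encode_append _ _).symm

theorem length_restLabel {C : r.M.Config} (h : C.label.length ≤ β) :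
    (r.restLabel C).length ≤ (r.kM + 1) * β := by
  unfold restLabel
  split_ifs
  · simp
  · rw [length_encode]
    exact Nat.mul_le_mul_left _ h

variable {u : List Λ₂} {C : r.M.Config}

theorem Rel.mono (h : r.Rel w u β C D) {β' : ℕ} (hβ : β ≤ β') : r.Rel w u β' C D :=
  ⟨h.1, h.2.imp (·.mono hβ) fun h => ⟨h.1, h.2.mono hβ⟩⟩

theorem Suffices.mono (h : r.Suffices w β C) {β' : ℕ} (hβ : β ≤ β') : r.Suffices w β' C :=
  have h2 : 2 ^ β ≤ 2 ^ β' := Nat.pow_le_pow_right (by omega) hβ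
  ⟨h.inputPos.trans_le h2, h.work.trans h2, h.label.trans hβ, fun X hX =>
    (h.transducer X hX).trans h2⟩

/-- Every configuration has some sufficient bound, so the correspondence of runs needs no resource
hypothesis on `M`. -/
theorem exists_suffices
    (hw : ∃ β, ∀ X, r.N.Reaches w X → (r.kN + 1) ^ (X.work.length + 1) ≤ 2 ^ β)
    (C : r.M.Config) : ∃ β, r.Suffices w β C := by
  obtain ⟨β, hβ⟩ := hw
  refine ⟨β + (C.inputPos + 1) + (r.kM + 1) ^ (C.work.length + 2) + C.label.length, ?_, ?_, ?_,
    fun X hX => (hβ X hX).trans (Nat.pow_le_pow_right (by omega) (by omega))⟩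
  · exact Nat.lt_two_pow_self.trans_le (Nat.pow_le_pow_right (by omega) (by omega))
  · exact Nat.lt_two_pow_self.le.trans (Nat.pow_le_pow_right (by omega) (by omega))
  · omega

/-- A zero bit is a blank, so the tape holding only the marker already stores zeros, with `m = 0`.
-/
theorem stores_initial (w : List Λ₁) :
    r.Stores w [] β (r.machine.initial w) .ini fun _ => 0 := by
  refine ⟨0, Nat.zero_le _, by simp, ⟨rfl, rfl, rfl, ?_, rfl, rfl, by simp [ATO.initial]⟩⟩
  have e : Function.update (fun _ : ℕ => 0) 0 (2 ^ 0 - 1) = fun _ => 0 := by simp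
  rw [e]
  funext i
  cases i with
  | zero => rfl
  | succ i => simp [ATO.initial, tapeRead, ctape, bitSym]

theorem rel_initial (w : List Λ₁) (u : List Λ₂) :
    r.Rel w u β (r.M.initial u) (r.machine.initial w) :=
  ⟨ATO.invariant_initial, .inr ⟨rfl, stores_initial w⟩⟩

theorem vec_initial : Function.update (fun _ : ℕ => 0) 4 (r.codeM .marker : ℕ) =
    r.vec (r.M.initial u) := by
  have : (fun _ : ℕ => 0) = regs 0 0 0 0 0 0 := by
    funext i; rcases i with _ | _ | _ | _ | _ | _ | _ | _ <;> rfl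
  rw [this, update_regs_four, vec]
  simp [ATO.initial, lnum, rnum]

end Reduction

-- One step of the given machine.

namespace Reduction

variable {Λ₁ : Type u} {Λ₂ : Type v} {r : Reduction Λ₁ Λ₂} {w : List Λ₁} {u : List Λ₂} {β : ℕ}
    {C : r.M.Config} {D : r.machine.Config} {Cf : r.N.Config}

theorem fetch_trace (hf : r.N.step w Cf = none) (hCf : r.N.Reaches w Cf) (hu : Cf.output = u)
    (hQ : r.Suffices w β C) (hC : r.M.Invariant u C) {z : List (TapeSym Λ₁)}
    (h : r.Stores w z β D (.fetch C.state r.fetchProg.entry) (r.vec C)) :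
    ∃ l E, Trace r.PStep l D E ∧
      r.Stores w z β E (.choose C.state (r.codeM (tapeRead C.input C.inputPos))
        (r.codeM (tapeRead C.work C.workPos))) (r.vec C) ∧
      ∀ X ∈ l, r.Bounded w z (w.length + 1) (8 * β + 16) X := by
  have hx := Prog.cexec_fetch (a := r.a) (I := w.length + 1) r.codeN_blank r.decN_codeN
    r.codeM_blank le_rfl hQ.transducer hf hCf C.inputPos (lnum r.codeM C.work C.workPos) C.work
    C.workPos (by have := hQ.inputPos; omega)
    ((Nat.pow_le_pow_right (by omega) (by omega)).trans hQ.work)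
  rw [hu, ← hC.input] at hx
  exact stores_trace (emb := fetchEmb C.state) (fun _ => trivial) (fun _ _ _ => rfl) hx h

theorem pre_trace (hQ : r.Suffices w β (r.M.initial u))
    (h : r.Stores w [] β D (.pre r.preProg.entry) fun _ => 0) :
    ∃ l E, Trace r.PStep l D E ∧
      r.Stores w [] β E (.fetch r.M.init r.fetchProg.entry) (r.vec (r.M.initial u)) ∧
      ∀ X ∈ l, r.Bounded w [] (w.length + 1) (8 * β + 16) X := by
  have hx := Prog.cexec_incN (a := r.a) (x := tapeRead (inputTape w)) (I := w.length + 1)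
    (β := β) (v := fun _ => 0) (ip := 0) (r := 4) (by omega) (by omega) (by omega)
    (r.codeM .marker) (by
      rw [Nat.zero_add]
      refine (r.codeM .marker).2.trans_le (le_trans ?_ hQ.work)
      exact Nat.le_self_pow (by omega) _)
  rw [Nat.zero_add, vec_initial (u := u)] at hx
  exact stores_trace (emb := preEmb) (fun _ => trivial) (fun _ _ _ => rfl) hx h

theorem not_labeling_choose {s : r.M.State} {x y : Fin (r.kM + 1)} :
    (St.choose s x y : r.St) ∉ r.machine.labeling := id

/-- The deterministic steps that determine the symbols scanned by the simulated machine. -/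
theorem select_trace (hf : r.N.step w Cf = none) (hCf : r.N.Reaches w Cf) (hu : Cf.output = u)
    (h0 : C.state ≠ r.M.accept) (h1 : C.state ≠ r.M.reject)
    (hR : r.Rel w u β C D) (hQ : r.Suffices w β C) :
    ∃ D₁ l E, D.state ∈ r.machine.existential ∧ r.machine.next D = {D₁} ∧ Trace r.PStep l D₁ E ∧
      r.Stores w (r.restLabel C) β E (.choose C.state (r.codeM (tapeRead C.input C.inputPos))
        (r.codeM (tapeRead C.work C.workPos))) (r.vec C) ∧
      ∀ X ∈ l, r.Bounded w (r.restLabel C) (w.length + 1) (8 * β + 16) X := by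
  obtain ⟨hC, hD | ⟨rfl, hD⟩⟩ := hR
  · have hnext : r.machine.next D = {r.machine.move D (.fetch C.state r.fetchProg.entry, .stay,
        .stay, tapeRead D.work D.workPos, [])} := next_eq_singleton (by
      rw [hD.state_eq]
      ext t
      exact ⟨fun h => h.2, fun h => ⟨⟨h0, h1⟩, h⟩⟩)
    have hl : D.state ∈ r.machine.labeling ↔ C.state ∈ r.M.labeling := by
      rw [hD.state_eq]; rfl
    obtain ⟨l, E, h2, h3, h4⟩ := fetch_trace hf hCf hu hQ hC (hD.stay
      (.fetch C.state r.fetchProg.entry) [] (z'' := r.restLabel C)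
      (fun h => if_pos (hl.1 h)) fun h => by
        rw [List.append_nil]; exact if_neg fun h' => h (hl.2 h'))
    refine ⟨_, l, E, ?_, hnext, h2, h3, h4⟩
    rw [hD.state_eq]
    exact ⟨⟨fun h => h0 (by injection h), fun h => h1 (by injection h)⟩, id⟩
  -- At the very start the simulated working tape is missing its marker; `preProg` writes it before
  -- the first fetch.
  · have hnext : r.machine.next D = {r.machine.move D (.pre r.preProg.entry, .stay,
        .stay, tapeRead D.work D.workPos, [])} := next_eq_singleton (by rw [hD.state_eq]; rfl)
    have hz : r.restLabel (r.M.initial u) = [] := if_pos r.M.init_labeling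
    rw [hz]
    obtain ⟨l, E, h2, h3, h4⟩ := pre_trace hQ (hD.stay (.pre r.preProg.entry) [] (z'' := [])
      (fun _ => rfl) fun _ => rfl)
    obtain ⟨l', E', h5, h6, h7⟩ := fetch_trace hf hCf hu hQ hC h3
    refine ⟨_, l ++ l', E', ?_, hnext, h2.append h5, h6, fun X hX =>
      (List.mem_append.1 hX).elim (h4 X) (h7 X)⟩
    rw [hD.state_eq]
    exact ⟨⟨by simp, by simp⟩, id⟩

/-- Legality of left moves and the bound on the working cursor come from the invariant. The physical
input cursor stays at `0`; the move of the cursor of `M` is a change of counter `1`. -/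
theorem cexec_execProg (hQ : r.Suffices w β C) (hC : r.M.Invariant u C)
    {t : r.M.State × Move × Move × TapeSym Λ₂ × List (TapeSym Λ₂)}
    (ht : t ∈ r.M.δ C.state (tapeRead C.input C.inputPos) (tapeRead C.work C.workPos)) :
    Prog.CExec r.a (tapeRead (inputTape w)) (w.length + 1) β
      (r.execProg t.2.1 t.2.2.1 (r.codeM t.2.2.2.1)) (r.vec C) 0 () (r.vec (r.M.move C t)) 0 := by
  have h1 := Prog.cexec_writeMove (a := r.a) (x := tapeRead (inputTape w)) (I := w.length + 1)
    (β := β) (ip := 0) (code := r.codeM) (l := 3) (r := 4) (t := 7) (v := r.vec C) r.codeM_blank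
    (by omega) (by omega) (by omega) (by omega) (by omega) (by omega) (by omega) (by omega)
    (by omega) (by omega) rfl C.work C.workPos rfl rfl
    ((Nat.pow_le_pow_right (by omega) (by have := hC.workPos; omega)).trans hQ.work) t.2.2.2.1
    t.2.2.1 (hC.work_left ht)
  refine Prog.cexec_bind h1 ?_
  rw [vec, update_regs_three, update_regs_four]
  have hleft := hC.input_left ht
  unfold vec
  simp only [ATO.move]
  cases t.2.1 with
  | stay => exact Prog.cexec_ret (Nat.zero_le _)
  | right =>
    have h2 := Prog.cexec_inc (a := r.a) (x := tapeRead (inputTape w)) (I := w.length + 1)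
      (β := β) (ip := 0) (r := 1) (v := regs C.inputPos 0
        (lnum r.codeM (tapeWrite C.work C.workPos t.2.2.2.1) (t.2.2.1.apply C.workPos))
        (rnum r.codeM (tapeWrite C.work C.workPos t.2.2.2.1) (t.2.2.1.apply C.workPos)) 0 0)
      (by omega) (by omega) (by omega) hQ.inputPos
    rw [update_regs_one] at h2
    exact h2
  | left =>
    have h2 := Prog.cexec_dec (a := r.a) (x := tapeRead (inputTape w)) (I := w.length + 1)
      (β := β) (ip := 0) (r := 1) (v := regs C.inputPos 0
        (lnum r.codeM (tapeWrite C.work C.workPos t.2.2.2.1) (t.2.2.1.apply C.workPos))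
        (rnum r.codeM (tapeWrite C.work C.workPos t.2.2.2.1) (t.2.2.1.apply C.workPos)) 0 0)
      (by omega) (by omega) (by omega)
    rw [update_regs_one] at h2
    exact Prog.cexec_bind h2 (Prog.cexec_ret (Nat.zero_le _))

/-- The encoded output word is appended in the branching step itself, so the label has its final
value throughout the program that follows. -/
theorem perform_trace (hQ : r.Suffices w β C) (hC : r.M.Invariant u C)
    {t : r.M.State × Move × Move × TapeSym Λ₂ × List (TapeSym Λ₂)}
    (ht : t ∈ r.M.δ C.state (tapeRead C.input C.inputPos) (tapeRead C.work C.workPos))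
    {x y : Fin (r.kM + 1)} {E : r.machine.Config}
    (hE : r.Stores w (r.restLabel C) β E (.choose C.state x y) (r.vec C)) :
    ∃ l D', Trace r.PStep l (r.machine.move E (r.startExec (tapeRead E.work E.workPos) t)) D' ∧
      r.Stores w (r.encode (r.M.move C t).label) β D' (.node (r.M.move C t).state)
        (r.vec (r.M.move C t)) ∧
      ∀ X ∈ l, r.Bounded w (r.encode (r.M.move C t).label) (w.length + 1) (8 * β + 16) X := by
  have hn : E.state ∉ r.machine.labeling := by
    rw [hE.state_eq]; exact not_labeling_choose
  exact stores_trace (emb := execEmb t.1 t.2.1 t.2.2.1 (r.codeM t.2.2.2.1)) (fun _ => trivial)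
    (fun _ _ _ => rfl) (cexec_execProg hQ hC ht)
    (hE.stay _ (r.encode t.2.2.2.2) (fun h => (hn h).elim) fun _ => (restLabel_append C t).symm)

/-- The entered state remembers the target state, the moves and the written symbol, and the label
remembers the output word. Different transitions of `M` therefore lead to different successors. -/
theorem move_startExec_injective {E : r.machine.Config} (hE : E.state ∉ r.machine.labeling)
    {b : TapeSym Λ₁} {t t' : r.M.State × Move × Move × TapeSym Λ₂ × List (TapeSym Λ₂)}
    (h : r.machine.move E (r.startExec b t) = r.machine.move E (r.startExec b t')) : t = t' := by
  obtain ⟨h1, -, -, h4, -, -⟩ := ATO.Config.mk.inj h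
  have h5 : r.encode t.2.2.2.2 = r.encode t'.2.2.2.2 := by
    rw [if_neg hE, if_neg hE] at h4
    exact List.append_cancel_left h4
  obtain ⟨t1, t2, t3, t4, t5⟩ := t
  obtain ⟨t1', t2', t3', t4', t5'⟩ := t'
  obtain ⟨e1, e2, e3, e4, -⟩ := St.exec.inj h1
  simp only at e1 e2 e3 e4 h5
  rw [e1, e2, e3, r.encode_injective h5, ← r.decM_codeM t4, e4, r.decM_codeM]

/-- Input and label are constant on `l`, so configurations differ in state, working tape or cursor
positions, and these are bounded. -/
theorem length_le_steps [Finite Λ₁] {l : List r.machine.Config} {z : List (TapeSym Λ₁)}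
    (hl : l.Nodup) (h : ∀ X ∈ l, r.Bounded w z (w.length + 1) (8 * β + 16) X) :
    l.length ≤ r.steps w β := by
  have := finite_tapeSym Λ₁
  have := r.finite_st
  let f : r.machine.Config → r.St × List (TapeSym Λ₁) × ℕ × ℕ := fun X =>
    (X.state, X.work, X.inputPos, X.workPos)
  have h1 : (l.map f).Nodup := by
    refine hl.map_on fun X hX Y hY hXY => ?_
    have hx := h X hX
    have hy := h Y hY
    obtain ⟨X1, X2, X3, X4, X5, X6⟩ := X
    obtain ⟨Y1, Y2, Y3, Y4, Y5, Y6⟩ := Y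
    obtain ⟨h1, h356⟩ := Prod.mk.inj hXY
    obtain ⟨h3, h56⟩ := Prod.mk.inj h356
    obtain ⟨h5, h6⟩ := Prod.mk.inj h56
    have h2 := hx.input.trans hy.input.symm
    have h4 := hx.label.trans hy.label.symm
    exact (ATO.Config.mk.injEq ..).mpr ⟨h1, h2, h3, h4, h5, h6⟩
  have h2 := h1.length_le_of_bounded (L := 8 * β + 17) (I := w.length + 1) (P := 8 * β + 16)
    fun x hx => by
      obtain ⟨X, hX, rfl⟩ := List.mem_map.1 hx
      exact ⟨(h X hX).length, (h X hX).inputPos, (h X hX).workPos⟩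
  rwa [List.length_map] at h2

theorem Bounded.small {z : List (TapeSym Λ₁)} {X : r.machine.Config} {I : ℕ}
    (h : r.Bounded w z I (8 * β + 16) X) (hz : z.length ≤ (r.kM + 1) * β) : r.Small β X :=
  ⟨h.length, h.label ▸ hz⟩

theorem Stores.small {z : List (TapeSym Λ₁)} {q : r.St} {v : ℕ → ℕ}
    (h : r.Stores w z β D q v) (hz : z.length ≤ (r.kM + 1) * β) : r.Small β D :=
  ⟨h.length_le, h.label_eq ▸ hz⟩

theorem not_pStep {q : r.St} (hD : D.state = q) (hq : ¬ q.IsProg) (X : r.machine.Config) :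
    ¬ r.PStep D X := fun h => hq (hD ▸ h.1)

theorem simulation [Finite Λ₁] (hf : r.N.step w Cf = none) (hCf : r.N.Reaches w Cf)
    (hu : Cf.output = u)
    (hw : ∃ β, ∀ X, r.N.Reaches w X → (r.kN + 1) ^ (X.work.length + 1) ≤ 2 ^ β) :
    ATO.Simulation r.M r.machine r.encode (r.Rel w u) (r.Suffices w) r.Small (r.steps w) where
  labeling := by
    rintro β C D ⟨-, h | ⟨rfl, h⟩⟩
    · rw [h.state_eq]; rfl
    · rw [h.state_eq]
      exact ⟨fun _ => r.M.init_labeling, fun _ => trivial⟩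
  label := by
    rintro β C D ⟨-, h | ⟨rfl, h⟩⟩ -
    · exact h.label_eq
    · exact h.label_eq
  accept := by
    rintro β C D ⟨-, h | ⟨rfl, h⟩⟩
    · rw [h.state_eq]
      exact ⟨fun h => by injection h, fun h => congrArg St.node h⟩
    · rw [h.state_eq]
      exact ⟨fun h => (by injection h : False).elim, fun h => (r.init_ne_accept h).elim⟩
  reject := by
    rintro β C D ⟨-, h | ⟨rfl, h⟩⟩
    · rw [h.state_eq]
      exact ⟨fun h => by injection h, fun h => congrArg St.node h⟩
    · rw [h.state_eq]
      exact ⟨fun h => (by injection h : False).elim, fun h => (r.init_ne_reject h).elim⟩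
  bound := by
    rintro β C D ⟨-, h | ⟨rfl, h⟩⟩ hQ
    · refine h.small ?_
      rw [length_encode]
      exact Nat.mul_le_mul_left _ hQ.label
    · exact h.small (by simp)
  step := by
    rintro C D ⟨β₁, hR₁⟩ h0 h1
    -- The segments are built with a bound large enough for existence, unrelated to the logarithmic
    -- one.
    obtain ⟨β₂, hQ₂⟩ := exists_suffices hw C
    have hR₀ := hR₁.mono (le_max_left β₁ β₂)
    have hQ₀ := hQ₂.mono (le_max_right β₁ β₂)
    set β₀ := max β₁ β₂
    have hC := hR₀.1
    obtain ⟨D₁, l, E, e1, e2, e3, e4, e5⟩ := select_trace hf hCf hu h0 h1 hR₀ hQ₀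
    have hEs := e4.state_eq
    have hEl : E.state ∉ r.machine.labeling := by rw [hEs]; exact not_labeling_choose
    have hEu : E.state ∈ r.machine.universal ↔ C.state ∈ r.M.universal := by rw [hEs]; rfl
    have hEp := not_pStep hEs id
    -- For any other admissible `β` the construction yields the same segment, by determinism; so the
    -- bounds for that `β` hold for the segment already chosen.
    have hsel : ∀ β, r.Rel w u β C D → r.Suffices w β C →
        r.Stores w (r.restLabel C) β E (.choose C.state (r.codeM (tapeRead C.input C.inputPos))
          (r.codeM (tapeRead C.work C.workPos))) (r.vec C) ∧
        ∀ X ∈ l, r.Bounded w (r.restLabel C) (w.length + 1) (8 * β + 16) X := by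
      intro β hR hQ
      obtain ⟨D₁', l', E', -, f2, f3, f4, f5⟩ := select_trace hf hCf hu h0 h1 hR hQ
      obtain rfl := Set.singleton_injective (e2.symm.trans f2)
      obtain ⟨rfl, rfl⟩ := e3.unique PStep.unique f3 hEp (not_pStep f4.state_eq id)
      exact ⟨f4, f5⟩
    -- Successors are matched when they come from the same transition of `M`; injectivity on both
    -- sides makes this a bijection.
    refine ⟨D₁, l, E, fun C' D' => ∃ t ∈ r.M.δ C.state (tapeRead C.input C.inputPos)
      (tapeRead C.work C.workPos), C' = r.M.move C t ∧
        D' = r.machine.move E (r.startExec (tapeRead E.work E.workPos) t),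
      e1, e2, trace_det e3, hEl, ?_, hEu, ?_, ?_, ?_, ?_, ?_, ?_⟩
    · have h2 : C.state ∈ r.M.existential ↔ C.state ∉ r.M.universal := by
        refine ⟨ATO.not_universal_of_existential, fun h => ?_⟩
        have : C.state ∈ r.M.existential ∪ r.M.universal := by
          rw [r.M.partition]
          simp [h0, h1]
        exact this.resolve_right h
      rw [h2, ← hEu]
      refine ⟨ATO.not_universal_of_existential, fun h => ⟨?_, h⟩⟩
      rw [hEs]
      exact ⟨by simp, by simp⟩
    · intro β hR hQ
      obtain ⟨f4, f5⟩ := hsel β hR hQ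
      have hz := length_restLabel (r := r) hQ.label
      exact ⟨fun X hX => (f5 X hX).small hz, f4.small hz,
        length_le_steps (e3.nodup PStep.unique hEp) f5⟩
    · rintro _ _ _ ⟨t, -, rfl, rfl⟩ ⟨t', -, rfl, ht'⟩
      rw [move_startExec_injective hEl ht']
    · rintro _ _ _ ⟨t, ht, rfl, rfl⟩ ⟨t', ht', htt, rfl⟩
      rw [hC.move_injective ht ht' htt]
    · rintro C' ⟨t, ht, rfl⟩
      exact ⟨_, t, ht, rfl, rfl⟩
    · intro D' hD'
      obtain ⟨_, hs, rfl⟩ := mem_next.1 hD'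
      rw [hEs] at hs
      obtain ⟨t, ht, rfl⟩ := hs
      rw [r.decM_codeM, r.decM_codeM] at ht
      exact ⟨_, t, ht, rfl, rfl⟩
    · rintro _ _ ⟨t, ht, rfl, rfl⟩
      obtain ⟨l', D', g1, g2, g3⟩ := perform_trace hQ₀ hC ht e4
      have hDp := not_pStep g2.state_eq id
      refine ⟨⟨t, ht, rfl⟩, mem_next.2 ⟨_, ?_, rfl⟩, l', D', trace_det g1,
        ⟨β₀, hC.move ht, .inl g2⟩, fun β hR hQ hQ' => ?_⟩
      · rw [hEs]
        exact ⟨t, by rwa [r.decM_codeM, r.decM_codeM], rfl⟩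
      · obtain ⟨l'', D'', k1, k2, k3⟩ := perform_trace hQ hC ht (hsel β hR hQ).1
        obtain ⟨rfl, rfl⟩ := g1.unique PStep.unique k1 hDp (not_pStep k2.state_eq id)
        refine ⟨⟨hC.move ht, .inl k2⟩, length_le_steps (g1.nodup PStep.unique hDp) k3,
          fun X hX => (k3 X hX).small ?_⟩
        rw [length_encode]
        exact Nat.mul_le_mul_left _ hQ'.label

end Reduction

/-! ### Polynomial and logarithmic bounds -/

section

variable {Λ : Type u}

/-- Functions of polynomial growth in the length of a word. -/
def PolyBounded (F : List Λ → ℕ) : Prop := ∃ a, ∀ w, F w ≤ 2 ^ (a * logBound w.length)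

/-- Functions of logarithmic growth in the length of a word. -/
def LogBounded (F : List Λ → ℕ) : Prop := ∃ a, ∀ w, F w ≤ a * logBound w.length

variable {F G : List Λ → ℕ}

theorem logBound_pos (n : ℕ) : 0 < logBound n := Nat.succ_pos _

theorem LogBounded.const (k : ℕ) : LogBounded fun _ : List Λ => k :=
  ⟨k, fun _ => Nat.le_mul_of_pos_right _ (logBound_pos _)⟩

theorem LogBounded.add (hF : LogBounded F) (hG : LogBounded G) : LogBounded fun w => F w + G w := by
  obtain ⟨a, ha⟩ := hF
  obtain ⟨b, hb⟩ := hG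
  exact ⟨a + b, fun w => by rw [add_mul]; exact Nat.add_le_add (ha w) (hb w)⟩

theorem LogBounded.const_mul (k : ℕ) (hF : LogBounded F) : LogBounded fun w => k * F w := by
  obtain ⟨a, ha⟩ := hF
  exact ⟨k * a, fun w => by rw [mul_assoc]; exact Nat.mul_le_mul_left _ (ha w)⟩

theorem LogBounded.logBound_length : LogBounded fun w : List Λ => logBound w.length :=
  ⟨1, fun _ => (one_mul _).ge⟩

/-- The inequality `k + 1 ≤ 2 ^ k` reduces any constant base to base two. -/
theorem LogBounded.const_pow (k : ℕ) (hF : LogBounded F) : PolyBounded fun w => (k + 1) ^ F w := by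
  obtain ⟨a, ha⟩ := hF
  refine ⟨k * a, fun w => ?_⟩
  calc (k + 1) ^ F w ≤ (2 ^ k) ^ F w := Nat.pow_le_pow_left (Nat.lt_two_pow_self) _
    _ = 2 ^ (k * F w) := (pow_mul ..).symm
    _ ≤ _ := Nat.pow_le_pow_right (by omega) (by rw [mul_assoc]; exact Nat.mul_le_mul_left _ (ha w))

theorem LogBounded.polyBounded (hF : LogBounded F) : PolyBounded F := by
  obtain ⟨a, ha⟩ := hF
  exact ⟨a, fun w => (ha w).trans Nat.lt_two_pow_self.le⟩

theorem PolyBounded.const (k : ℕ) : PolyBounded fun _ : List Λ => k :=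
  (LogBounded.const k).polyBounded

theorem PolyBounded.mono (hG : PolyBounded G) (h : ∀ w, F w ≤ G w) : PolyBounded F := by
  obtain ⟨a, ha⟩ := hG
  exact ⟨a, fun w => (h w).trans (ha w)⟩

theorem PolyBounded.mul (hF : PolyBounded F) (hG : PolyBounded G) :
    PolyBounded fun w => F w * G w := by
  obtain ⟨a, ha⟩ := hF
  obtain ⟨b, hb⟩ := hG
  exact ⟨a + b, fun w => by rw [add_mul, pow_add]; exact Nat.mul_le_mul (ha w) (hb w)⟩

theorem PolyBounded.add (hF : PolyBounded F) (hG : PolyBounded G) :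
    PolyBounded fun w => F w + G w := by
  obtain ⟨a, ha⟩ := hF
  obtain ⟨b, hb⟩ := hG
  -- Two powers of two are each at most their product, so their sum is at most twice the product.
  refine PolyBounded.mono (G := fun w => 2 * (2 ^ (a * logBound w.length) *
    2 ^ (b * logBound w.length))) ((PolyBounded.const 2).mul (PolyBounded.mul
      ⟨a, fun _ => le_rfl⟩ ⟨b, fun _ => le_rfl⟩)) fun w => ?_
  have h1 := Nat.le_mul_of_pos_right (2 ^ (a * logBound w.length))
    (Nat.two_pow_pos (b * logBound w.length))
  have h2 := Nat.le_mul_of_pos_left (2 ^ (b * logBound w.length))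
    (Nat.two_pow_pos (a * logBound w.length))
  have := ha w
  have := hb w
  omega

theorem PolyBounded.pow (hF : PolyBounded F) (k : ℕ) : PolyBounded fun w => F w ^ k := by
  induction k with
  | zero => exact PolyBounded.const 1
  | succ k ih => simpa only [pow_succ] using ih.mul hF

theorem PolyBounded.eval (hF : PolyBounded F) (p : Polynomial ℕ) :
    PolyBounded fun w => p.eval (F w) := by
  induction p using Polynomial.induction_on' with
  | add p q hp hq => simpa only [Polynomial.eval_add] using hp.add hq
  | monomial n a =>
    simpa only [Polynomial.eval_monomial] using (PolyBounded.const a).mul (hF.pow n)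

theorem PolyBounded.length : PolyBounded fun w : List Λ => w.length :=
  ⟨1, fun w => by
    rw [one_mul]
    exact (Nat.lt_pow_succ_log_self (by norm_num) _).le⟩

theorem PolyBounded.logBound (hF : PolyBounded F) : LogBounded fun w => logBound (F w) := by
  obtain ⟨a, ha⟩ := hF
  refine ⟨a + 1, fun w => ?_⟩
  have h := Nat.log_mono_right (b := 2) (ha w)
  rw [Nat.log_pow (by norm_num)] at h
  rw [add_mul, one_mul]
  exact Nat.add_le_add h (logBound_pos w.length)

theorem two_pow_logBound_le (n : ℕ) : 2 ^ logBound n ≤ 2 * (n + 1) := by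
  rw [logBound, pow_succ']
  refine Nat.mul_le_mul_left _ ?_
  by_cases h : n = 0
  · simp [h]
  · exact (Nat.pow_log_le_self 2 h).trans (Nat.le_succ n)

theorem PolyBounded.exists_polynomial (hF : PolyBounded F) :
    ∃ p : Polynomial ℕ, ∀ w, F w ≤ p.eval w.length := by
  obtain ⟨a, ha⟩ := hF
  refine ⟨(2 * (Polynomial.X + 1)) ^ a, fun w => (ha w).trans ?_⟩
  rw [mul_comm, pow_mul]
  simpa using Nat.pow_le_pow_left (two_pow_logBound_le w.length) a

end

/-! ### The length of the output of a transducer -/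

namespace Transducer

variable {Λ₁ : Type u} {Λ₂ : Type v} (N : Transducer Λ₁ Λ₂) {w : List Λ₁}

/-- A configuration without its output. -/
def core (C : N.Config) : N.State × List (TapeSym N.Work) × ℕ × ℕ :=
  (C.state, C.work, C.inputPos, C.workPos)

/-- The step relation, without the output. -/
def CoreStep (w : List Λ₁) (x y : N.State × List (TapeSym N.Work) × ℕ × ℕ) : Prop :=
  ∃ C D, N.step w C = some D ∧ N.core C = x ∧ N.core D = y

variable {N}

/-- The output is never read, so dropping it leaves a deterministic system. -/
theorem core_step {C C' : N.Config} (h : N.core C = N.core C') :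
    (N.step w C).map N.core = (N.step w C').map N.core := by
  obtain ⟨h1, h2⟩ := Prod.mk.inj h
  obtain ⟨h2, h3⟩ := Prod.mk.inj h2
  obtain ⟨h3, h4⟩ := Prod.mk.inj h3
  simp only [step, h1, h2, h3, h4, Option.map_map]
  rfl

theorem CoreStep.unique (x y z : N.State × List (TapeSym N.Work) × ℕ × ℕ)
    (h : N.CoreStep w x y) (h' : N.CoreStep w x z) : y = z := by
  obtain ⟨C, D, h1, rfl, rfl⟩ := h
  obtain ⟨C', D', h2, h3, rfl⟩ := h'
  have := core_step (w := w) h3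
  rw [h1, h2] at this
  exact (Option.some.inj this).symm

theorem Reaches.exists_trace {C : N.Config} (h : N.Reaches w C) :
    ∃ l, Trace (fun X Y => N.step w X = some Y) l N.initial C ∧ (∀ X ∈ l, N.Reaches w X) ∧
      C.output.length ≤ l.length := by
  induction h with
  | refl => exact ⟨[], .nil _, by simp, le_rfl⟩
  | @tail X Y hX hstep ih =>
    obtain ⟨l, h1, h2, h3⟩ := ih
    refine ⟨l ++ [X], h1.append (.cons hstep (.nil _)), fun Z hZ => ?_, ?_⟩
    · rcases List.mem_append.1 hZ with h | h
      · exact h2 Z h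
      · exact List.mem_singleton.1 h ▸ hX
    · obtain ⟨t, ht, rfl⟩ := Option.map_eq_some_iff.1 hstep
      have : t.2.2.2.2.toList.length ≤ 1 := by cases t.2.2.2.2 <;> simp
      simp only [List.length_append, List.length_singleton]
      omega

/-- Each step emits at most one letter, and a halting computation never repeats a configuration,
even with the output ignored. -/
theorem length_output_le [Finite N.State] [Finite (TapeSym N.Work)] {C : N.Config}
    (h : N.Reaches w C) (hC : N.step w C = none) {L : ℕ}
    (hL : ∀ X, N.Reaches w X → X.work.length ≤ L) :
    C.output.length ≤ Nat.card N.State * ((Nat.card (TapeSym N.Work) + 1) ^ L *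
      ((w.length + 1 + 1) * (L + 1))) := by
  obtain ⟨l, h1, h2, h3⟩ := h.exists_trace
  have h4 : (l.map N.core).Nodup := by
    refine (h1.map (s := N.CoreStep w) N.core fun X Y hXY => ⟨X, Y, hXY, rfl, rfl⟩).nodup
      CoreStep.unique fun z hz => ?_
    obtain ⟨X, Y, h5, h6, -⟩ := hz
    have := core_step (w := w) h6
    rw [h5, hC] at this
    simp at this
  have h5 := h4.length_le_of_bounded (L := L) (I := w.length + 1) (P := L) fun x hx => by
    obtain ⟨X, hX, rfl⟩ := List.mem_map.1 hx
    have := N.reaches_invariant (h2 X hX)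
    exact ⟨hL X (h2 X hX), this.2.2, this.2.1.trans (hL X (h2 X hX))⟩
  rw [List.length_map] at h5
  exact h3.trans h5

end Transducer

-- Range of the input cursor of an alternating machine.

namespace ATO

variable {Λ : Type u} {M : ATO Λ}

theorem inputPos_le_of_mem_next {C D : M.Config} (h : D ∈ M.next C) :
    D.inputPos ≤ C.inputPos + 1 := by
  obtain ⟨t, -, rfl⟩ := h
  simp only [move]
  cases t.2.1 <;> simp only [Move.apply] <;> omega

/-- The cursor advances by at most one cell per level of the tree, and a path has at most as many
nodes as the whole tree. -/
theorem IsRun.inputPos_lt {T : LTree M.Config} (hT : M.IsRun T) :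
    ∀ C ∈ T.nodes, C.inputPos < T.root.inputPos + T.size := by
  have key : ∀ (C : M.Config) (ts : List (LTree M.Config)), (∀ t ∈ ts, t.root ∈ M.next C) →
      (∀ t ∈ ts, ∀ D ∈ t.nodes, D.inputPos < t.root.inputPos + t.size) →
      ∀ D ∈ (LTree.node C ts).nodes, D.inputPos < C.inputPos + (LTree.node C ts).size := by
    intro C ts hts ih D hD
    rw [LTree.nodes_node] at hD
    rw [LTree.size_node]
    rcases List.mem_cons.1 hD with rfl | hD
    · omega
    · obtain ⟨t, ht, hD⟩ := List.mem_flatMap.1 hD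
      have h1 := ih t ht D hD
      have h2 := inputPos_le_of_mem_next (hts t ht)
      have h3 : t.size ≤ (ts.map LTree.size).sum := List.le_sum_of_mem (List.mem_map_of_mem ht)
      omega
  induction hT with
  | halt C _ => exact key C [] (by simp) (by simp)
  | existential C t _ ht _ ih => exact key C [t] (by simpa using ht) (by simpa using ih)
  | universal C ts _ _ _ hts _ ih =>
    exact key C ts (fun t ht => (hts _).1 (List.mem_map_of_mem ht)) ih

end ATO

-- Resource bounds for the composed machine.

namespace Reduction

variable {Λ₁ : Type u} {Λ₂ : Type v} {r : Reduction Λ₁ Λ₂}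

theorem wellBehaved_machine [Finite Λ₁] {h : List Λ₁ → List Λ₂}
    (hM : r.M.WellBehaved) (hN : ∀ w, ∃ C, r.N.Reaches w C ∧ r.N.step w C = none ∧ C.output = h w)
    {cN : ℕ} (hc : ∀ w C, r.N.Reaches w C → C.work.length ≤ cN * logBound w.length) :
    r.machine.WellBehaved ∧ ∀ w, r.machine.span w = r.M.span (h w) := by
  have := r.N.finite_state
  have := r.N.finite_work
  have := finite_tapeSym r.N.Work
  have hlogN : LogBounded fun w : List Λ₁ => cN * logBound w.length :=
    LogBounded.logBound_length.const_mul cN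
  obtain ⟨A₁, hA₁⟩ : PolyBounded fun w : List Λ₁ => (r.kN + 1) ^ (cN * logBound w.length + 1) :=
    (hlogN.add (.const 1)).const_pow _
  have hsim : ∀ w, ATO.Simulation r.M r.machine r.encode (r.Rel w (h w)) (r.Suffices w) r.Small
      (r.steps w) := by
    intro w
    obtain ⟨C, h1, h2, h3⟩ := hN w
    exact simulation h2 h1 h3 ⟨_, fun X hX => (Nat.pow_le_pow_right (by omega)
      (Nat.succ_le_succ (hc w X hX))).trans (hA₁ w)⟩
  refine ⟨?_, fun w => (hsim w).span_eq r.encode_injective ⟨0, rel_initial w _⟩⟩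
  have hlen : PolyBounded fun w => (h w).length := by
    refine PolyBounded.mono ((PolyBounded.const (Nat.card r.N.State)).mul ((hlogN.const_pow
      (Nat.card (TapeSym r.N.Work))).mul (((PolyBounded.length.add (.const 1)).add (.const 1)).mul
        (hlogN.polyBounded.add (.const 1))))) fun w => ?_
    obtain ⟨C, h1, h2, h3⟩ := hN w
    rw [← h3]
    exact Transducer.length_output_le h1 h2 (hc w)
  obtain ⟨pol, cM, k, hM⟩ := hM
  have hsize : PolyBounded fun w => cM * pol.eval (h w).length :=
    (PolyBounded.const cM).mul (hlen.eval pol)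
  have hlog : LogBounded fun w => cM * logBound (h w).length := hlen.logBound.const_mul cM
  obtain ⟨A₂, hA₂⟩ := hsize.add (.const 2)
  obtain ⟨A₃, hA₃⟩ := hlog
  obtain ⟨A₄, hA₄⟩ := LogBounded.const_pow r.kM (LogBounded.add ⟨A₃, hA₃⟩ (.const 2))
  -- The four exponents serve the transducer, the input position, the label and the working tape;
  -- their sum serves all conditions of `Suffices` at once.
  set A := A₁ + A₂ + A₃ + A₄ with hA
  have hβ : LogBounded fun w : List Λ₁ => A * logBound w.length :=
    LogBounded.logBound_length.const_mul A
  have hsuff : ∀ w (T : LTree r.M.Config), r.M.IsComputation (h w) T →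
      ∀ C ∈ T.nodes, r.Suffices w (A * logBound w.length) C := by
    intro w T hT C hC
    obtain ⟨h1, h2, -⟩ := hM _ _ hT
    -- The input cursor of `M` may run beyond its input, so its position is bounded by the
    -- polynomial size of the computation.
    have h3 := hT.2.inputPos_lt C hC
    rw [hT.1] at h3
    have hle : ∀ {B}, B ≤ A → 2 ^ (B * logBound w.length) ≤ 2 ^ (A * logBound w.length) :=
      fun h => Nat.pow_le_pow_right (by omega) (Nat.mul_le_mul_right _ h)
    refine ⟨?_, ?_, ?_, fun X hX => ?_⟩
    · have h4 := (hA₂ w).trans (hle (by omega))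
      have h5 : (r.M.initial (h w)).inputPos = 0 := rfl
      simp only at h4
      omega
    · exact (Nat.pow_le_pow_right (by omega) (Nat.add_le_add_right (h2 C hC).1 2)).trans
        ((hA₄ w).trans (hle (by omega)))
    · exact (h2 C hC).2.trans ((hA₃ w).trans (Nat.mul_le_mul_right _ (by omega)))
    · exact (Nat.pow_le_pow_right (by omega) (Nat.succ_le_succ (hc w X hX))).trans
        ((hA₁ w).trans (hle (by omega)))
  have hlin : LogBounded fun w : List Λ₁ => 8 * (A * logBound w.length) + 17 :=
    (hβ.const_mul 8).add (.const 17)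
  have hsteps : PolyBounded fun w => r.steps w (A * logBound w.length) :=
    (PolyBounded.const _).mul ((hlin.const_pow _).mul
      ((PolyBounded.length.add (.const 2)).mul hlin.polyBounded))
  obtain ⟨pol', hpol'⟩ := ((((PolyBounded.const 2).mul hsteps).add (.const 2)).mul
    hsize).exists_polynomial
  obtain ⟨c, hc'⟩ := hlin.add (hβ.const_mul (r.kM + 1))
  -- The constant `c + 1` is positive, so multiplying the size bound by it does no harm; `k + 1` is
  -- the loss in `Match.pathBound`.
  refine ⟨pol', c + 1, k + 1, fun w T' hT' => ?_⟩
  obtain ⟨T, hT, hr, hm⟩ := (hsim w).exists_run_of_run _ T' le_rfl hT'.2 (r.M.initial (h w))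
    ⟨0, hT'.1 ▸ rel_initial w _⟩
  obtain ⟨h1, h2, h3⟩ := hM _ _ ⟨hr, hT⟩
  obtain ⟨h4, h5⟩ := hm.bound (A * logBound w.length) (by
    rw [hr, hT'.1]; exact rel_initial w _) (hsuff w T ⟨hr, hT⟩)
  refine ⟨?_, fun C hC => ?_, hm.pathBound k h3⟩
  · have h6 := hpol' w
    have h7 := Nat.mul_le_mul_left (2 * r.steps w (A * logBound w.length) + 2) h1
    have h8 := Nat.le_mul_of_pos_left (pol'.eval w.length) (Nat.succ_pos c)
    rw [Nat.succ_eq_add_one] at h8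
    omega
  · obtain ⟨h6, h7⟩ := h4 C hC
    have h8 : 8 * (A * logBound w.length) + 17 + (r.kM + 1) * (A * logBound w.length) ≤
        c * logBound w.length := hc' w
    rw [add_mul]
    omega

end Reduction

-- Choice of codes, degenerate cases and conclusion.

theorem exists_tapeSym_code (Λ : Type u) [Finite Λ] :
    ∃ (k : ℕ) (code : TapeSym Λ → Fin (k + 1)) (dec : Fin (k + 1) → TapeSym Λ),
      code .blank = 0 ∧ ∀ s, dec (code s) = s := by
  have := finite_tapeSym Λ
  obtain ⟨n, ⟨e⟩⟩ := Finite.exists_equiv_fin (TapeSym Λ)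
  obtain ⟨k, rfl⟩ : ∃ k, n = k + 1 := by
    have := (e .blank).pos
    exact ⟨n - 1, by omega⟩
  -- The swap gives the blank the code `0`, as required by `rnum_eq`.
  let e' := e.trans (Equiv.swap (e .blank) 0)
  exact ⟨k, e', e'.symm, by simp [e'], e'.symm_apply_apply⟩

/-- The only run is a single node, whose output is the empty label whatever the input. This case is
split off because `Rel` lets the non-halting state `ini` represent the initial configuration. -/
theorem ATO.span_eq_of_init_halt {Λ : Type u} {M : ATO Λ}
    (h : M.init = M.accept ∨ M.init = M.reject) (w w' : List Λ) : M.span w = M.span w' := by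
  have key : ∀ w w' : List Λ, M.validOutputs w ⊆ M.validOutputs w' := by
    rintro w w' O ⟨T, ⟨h1, h2⟩, h3, O', h4, rfl⟩
    have hT : T = .node (M.initial w) [] := by
      rw [← h1]
      cases h2 with
      | halt C _ => rfl
      | existential C t hC =>
        have := M.not_halt_of_existential hC
        rw [show C = M.initial w from h1] at this
        exact (h.elim this.1 this.2).elim
      | universal C ts hC =>
        have := M.not_halt_of_universal hC
        rw [show C = M.initial w from h1] at this
        exact (h.elim this.1 this.2).elim
    subst hT
    refine ⟨.node (M.initial w') [], ⟨rfl, .halt _ h⟩, ?_, O', ?_, rfl⟩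
    · intro C hC
      obtain rfl := List.mem_singleton.1 hC
      exact h3 (M.initial w) (List.mem_singleton.2 rfl)
    · rw [outputForest_labeling _ M.init_labeling] at h4 ⊢
      exact h4
  rw [span, span, (key w w').antisymm (key w' w)]

theorem mainTheorem2 {Λ₁ : Type u} {Λ₂ : Type v} [Finite Λ₁] [Finite Λ₂]
    (f : List Λ₁ → ℕ) (g : List Λ₂ → ℕ) (h : List Λ₁ → List Λ₂)
    (hg : g ∈ SpanTL Λ₂) (hh : LogspaceComputable h) (hf : ∀ w, f w = g (h w)) :
    f ∈ SpanTL Λ₁ := by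
  obtain ⟨M, hM, hspan⟩ := hg
  obtain ⟨N, hN, cN, hc⟩ := hh
  have hconst : (∀ w, f w = f []) → f ∈ SpanTL Λ₁ := fun h => by
    rw [funext h]
    exact const_mem_SpanTL (f [])
  -- Over the empty alphabet the empty word is the only input; otherwise some letter `a` can
  -- represent the bit one.
  rcases isEmpty_or_nonempty Λ₁ with hΛ | ⟨⟨a⟩⟩
  · exact hconst fun w => by rw [Subsingleton.elim w []]
  by_cases hinit : M.init = M.accept ∨ M.init = M.reject
  · refine hconst fun w => ?_
    rw [hf, hf]
    have := ATO.span_eq_of_init_halt hinit (h w) (h [])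
    rw [hspan, hspan] at this
    exact_mod_cast this
  rw [not_or] at hinit
  have := N.finite_work
  obtain ⟨kN, codeN, decN, hN0, hdecN⟩ := exists_tapeSym_code N.Work
  obtain ⟨kM, codeM, decM, hM0, hdecM⟩ := exists_tapeSym_code Λ₂
  let r : Reduction Λ₁ Λ₂ := ⟨a, M, N, hinit.1, hinit.2, kN, codeN, decN, hN0, hdecN, kM, codeM,
    decM, hM0, hdecM⟩
  obtain ⟨h1, h2⟩ := r.wellBehaved_machine hM hN hc
  exact ⟨r.machine, h1, fun w => by rw [h2, hf]; exact hspan _⟩
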